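/- Let $m\ge 1$, $n=2m$, and let $(M^{n},\omega)$ be a closed symplectic manifold (smooth, compact, Hausdorff, without boundary, not necessarily connected), oriented by $\omega^m$, with a smooth Riemannian metric $g=(\cdot,\cdot)$ whose volume is the symplectic volume $\mu=\omega^m/m$ (no other compatibility of $g$ and $\omega$ is assumed). Let $\mathfrak g=\mathfrak{symp}_\omega(M)=\{v\in \mathrm{Vect}(M): L_v\omega=0\}$, with the Lie algebra structure of the group of symplectomorphisms, $\mathrm{ad}_vw=-[v,w]$ ($[\cdot,\cdot]$ the commutator of vector fields), and let $\mathfrak g^*$ be its regular dual: the space of linear functionals on $\mathfrak g$ of the form $v\mapsto\int_M\theta(v)\,\mu$ with $\theta$ a smooth 1-form. For a functional $\ell$ put $\langle w,\mathrm{ad}^*_v\ell\rangle=\langle \mathrm{ad}_vw,\ell\rangle$. Let $E(v)=\frac12\int_M(v,v)\,d\mathrm{vol}_g$. The inertia operator $A:\mathfrak g\to\mathfrak g^*$ is the symmetric linear operator with $E(v)=\frac12\langle v,Av\rangle$, and the Euler(–Arnold) equation on $\mathfrak g^*$ is $\dfrac{d\mathfrak m}{dt}=-\mathrm{ad}^*_{A^{-1}\mathfrak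 m}\,\mathfrak m$, where $\frac{d\mathfrak m}{dt}$ means the derivative of $t\mapsto\langle w,\mathfrak m(t)\rangle$ for every $w\in\mathfrak g$, and $A^{-1}\mathfrak m$ denotes the $v\in\mathfrak g$ with $Av=\mathfrak m$. Let $\Omega^j$ denote the smooth $j$-forms on $M$, and $[\alpha]$ the coset of $\alpha\in\Omega^{n-1}$ in $\Omega^{n-1}/d\Omega^{n-2}$. Then: a) The formula $$\langle v,\alpha\rangle:=\int_M\alpha\wedge i_v\omega,\qquad v\in\mathfrak g,\ \alpha\in\Omega^{n-1},$$ is well defined on cosets $[\alpha]\in\Omega^{n-1}/d\Omega^{n-2}$; the resulting pairing of $\mathfrak g$ with $\Omega^{n-1}/d\Omega^{n-2}$ is nondegenerate in both arguments and gives a linear isomorphism $\Omega^{n-1}/d\Omega^{n-2}\cong\mathfrak g^*$. The space $\mathfrak g$ is closed under the commutator. For $v\in\mathfrak g$ the Lie derivative $L_v$ on $\Omega^{n-1}$ is well defined on cosets, and under the isomorphism the coadjoint action is the Lie derivative, $\mathrm{ad}^*_v[\alpha]=[L_v\alpha]$. b) The inertia operator exists, is injective, and is given by $A v=[v^\flat\wedge\omega^{m-1}]$,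 where $v^\flat=(v,\cdot)$. c) In terms of cosets the Euler equation is $$\partial_t[\alpha]=-L_v[\alpha],$$ where $v$ is related to $\alpha$ by the inertia operator. Precisely: let $J\subset\mathbb R$ be open. If $v_t\in\mathfrak g$ is smooth in $(t,x)\in J\times M$, then so is $\alpha_t=v_t^\flat\wedge\omega^{m-1}$. If $\alpha_t\in\Omega^{n-1}$ is any family smooth in $(t,x)\in J\times M$, and $v_t\in\mathfrak g$ satisfies $Av_t=[\alpha_t]$ for $t\in J$ (for instance $\alpha_t=v_t^\flat\wedge\omega^{m-1}$), then $t\mapsto[\alpha_t]\in\mathfrak g^*$ satisfies the Euler equation on $J$ if and only if $[\partial_t\alpha_t]=-[L_{v_t}\alpha_t]$ in $\Omega^{n-1}/d\Omega^{n-2}$ for all $t\in J$. -/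

import Mathlib

open scoped Manifold ContDiff Topology
open Set

noncomputable section

/-! ## Exterior algebra of a topological vector space -/

section Wedge

variable {V : Type*} [AddCommGroup V] [Module ℝ V] [TopologicalSpace V]

/-- Exterior product of a `k`-covector and an `l`-covector with the shuffle convention
`(a ∧ b)(u₁, …, u_{k+l}) = ∑ sign(σ) a(u_{σ 1}, …, u_{σ k}) b(u_{σ(k+1)}, …, u_{σ(k+l)})`,
the sum being over `(k,l)`-shuffles.  The degree of the result is any `n` with `k + l = n`. -/
def wedge {k l n : ℕ} (h : k + l = n) (a : V [⋀^Fin k]→L[ℝ] ℝ) (b : V [⋀^Fin l]→L[ℝ] ℝ) :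
    V [⋀^Fin n]→L[ℝ] ℝ where
  toFun u := LinearMap.mul' ℝ ℝ
    ((a.toAlternatingMap.domCoprod b.toAlternatingMap)
      (fun i => u (Fin.cast h (finSumFinEquiv i))))
  map_update_add' u i x y :=
    (((LinearMap.mul' ℝ ℝ).compAlternatingMap
      (a.toAlternatingMap.domCoprod b.toAlternatingMap)).domDomCongr
        (finSumFinEquiv.trans (finCongr h))).map_update_add' u i x y
  map_update_smul' u i c x :=
    (((LinearMap.mul' ℝ ℝ).compAlternatingMap
      (a.toAlternatingMap.domCoprod b.toAlternatingMap)).domDomCongr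
        (finSumFinEquiv.trans (finCongr h))).map_update_smul' u i c x
  map_eq_zero_of_eq' u i j huv hij :=
    (((LinearMap.mul' ℝ ℝ).compAlternatingMap
      (a.toAlternatingMap.domCoprod b.toAlternatingMap)).domDomCongr
        (finSumFinEquiv.trans (finCongr h))).map_eq_zero_of_eq' u i j huv hij
  cont := by
    have key : ∀ σ : Equiv.Perm.ModSumCongr (Fin k) (Fin l), Continuous fun u : Fin n → V =>
        LinearMap.mul' ℝ ℝ (AlternatingMap.domCoprod.summand a.toAlternatingMap
          b.toAlternatingMap σ (fun i => u (Fin.cast h (finSumFinEquiv i)))) := by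
      intro σ
      induction σ using Quotient.inductionOn' with
      | h σ =>
        simp only [AlternatingMap.domCoprod.summand_mk'', Units.smul_def]
        have : ∀ u : Fin n → V, LinearMap.mul' ℝ ℝ
            ((((Equiv.Perm.sign σ : ℤˣ) : ℤ) •
              (MultilinearMap.domCoprod (a.toAlternatingMap : MultilinearMap ℝ (fun _ => V) ℝ)
                (b.toAlternatingMap : MultilinearMap ℝ (fun _ => V) ℝ)).domDomCongr σ)
              (fun i => u (Fin.cast h (finSumFinEquiv i)))) =
            (((Equiv.Perm.sign σ : ℤˣ) : ℤ) : ℝ) *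
              (a (fun i => u (Fin.cast h (finSumFinEquiv (σ (Sum.inl i))))) *
               b (fun i => u (Fin.cast h (finSumFinEquiv (σ (Sum.inr i)))))) := by
          intro u
          rw [← zsmul_eq_mul, ← LinearMap.mul'_apply (R := ℝ), ← map_zsmul]
          rfl
        simp only [this]
        refine continuous_const.mul ((a.cont.comp ?_).mul (b.cont.comp ?_))
        · exact continuous_pi fun i => continuous_apply _
        · exact continuous_pi fun i => continuous_apply _
    have : ∀ u : Fin n → V, LinearMap.mul' ℝ ℝ
        ((a.toAlternatingMap.domCoprod b.toAlternatingMap)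
          (fun i => u (Fin.cast h (finSumFinEquiv i)))) =
        ∑ σ : Equiv.Perm.ModSumCongr (Fin k) (Fin l),
          LinearMap.mul' ℝ ℝ (AlternatingMap.domCoprod.summand a.toAlternatingMap
            b.toAlternatingMap σ (fun i => u (Fin.cast h (finSumFinEquiv i)))) := by
      intro u
      rw [AlternatingMap.domCoprod_apply, _root_.sum_apply, map_sum]
    change Continuous fun u : Fin n → V => LinearMap.mul' ℝ ℝ
        ((a.toAlternatingMap.domCoprod b.toAlternatingMap)
          (fun i => u (Fin.cast h (finSumFinEquiv i))))
    simp only [this]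
    exact continuous_finsetSum _ fun σ _ => key σ

/-- Exterior powers `a ^ j` of a 2-covector. -/
def wedgePow (a : V [⋀^Fin 2]→L[ℝ] ℝ) : (j : ℕ) → V [⋀^Fin (2 * j)]→L[ℝ] ℝ
  | 0 => ContinuousAlternatingMap.constOfIsEmpty ℝ V (Fin 0) (1 : ℝ)
  | j + 1 => wedge (by omega) (wedgePow a j) a

end Wedge

/-! ## Calculus of differential forms on a manifold without boundary -/

section Forms

variable {n : ℕ} {M : Type*} [TopologicalSpace M]
  [ChartedSpace (EuclideanSpace ℝ (Fin n)) M]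

/-- (Not necessarily smooth) differential `k`-forms on the `n`-manifold `M`. -/
def DForm (n : ℕ) (M : Type*) [TopologicalSpace M]
    [ChartedSpace (EuclideanSpace ℝ (Fin n)) M] (k : ℕ) : Type _ :=
  (x : M) → (TangentSpace (𝓡 n) x) [⋀^Fin k]→L[ℝ] ℝ

instance (n : ℕ) (M : Type*) [TopologicalSpace M] [ChartedSpace (EuclideanSpace ℝ (Fin n)) M]
    (k : ℕ) : AddCommGroup (DForm n M k) :=
  inferInstanceAs (AddCommGroup ((x : M) → (TangentSpace (𝓡 n) x) [⋀^Fin k]→L[ℝ] ℝ))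

instance (n : ℕ) (M : Type*) [TopologicalSpace M] [ChartedSpace (EuclideanSpace ℝ (Fin n)) M]
    (k : ℕ) : Module ℝ (DForm n M k) :=
  inferInstanceAs (Module ℝ ((x : M) → (TangentSpace (𝓡 n) x) [⋀^Fin k]→L[ℝ] ℝ))

/-- Coordinate expression of a form in the chart around `x₀`: the pull-back of the form
by the inverse of the chart. -/
def locRep {k : ℕ} (x₀ : M) (α : DForm n M k) :
    EuclideanSpace ℝ (Fin n) → (EuclideanSpace ℝ (Fin n)) [⋀^Fin k]→L[ℝ] ℝ := fun y =>
  (α ((extChartAt (𝓡 n) x₀).symm y)).compContinuousLinearMap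
    (mfderiv 𝓘(ℝ, EuclideanSpace ℝ (Fin n)) (𝓡 n) (extChartAt (𝓡 n) x₀).symm y)

/-- Coordinate expression of a vector field in the chart around `x₀`. -/
def locField (x₀ : M) (v : (x : M) → TangentSpace (𝓡 n) x) :
    EuclideanSpace ℝ (Fin n) → EuclideanSpace ℝ (Fin n) :=
  VectorField.mpullback 𝓘(ℝ, EuclideanSpace ℝ (Fin n)) (𝓡 n) (extChartAt (𝓡 n) x₀).symm v

/-- Transport to the tangent space at `x` of a covector at the image of `x` in the chart
around `x`. -/
def fromChart {k : ℕ} (x : M) (a : (EuclideanSpace ℝ (Fin n)) [⋀^Fin k]→L[ℝ] ℝ) :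
    (TangentSpace (𝓡 n) x) [⋀^Fin k]→L[ℝ] ℝ :=
  ContinuousAlternatingMap.compContinuousLinearMap
    (M := TangentSpace (𝓡 n) x)
    (M' := TangentSpace 𝓘(ℝ, EuclideanSpace ℝ (Fin n)) (extChartAt (𝓡 n) x x)) a
    (mfderiv (𝓡 n) 𝓘(ℝ, EuclideanSpace ℝ (Fin n)) (extChartAt (𝓡 n) x) x)

theorem locRep_add {k : ℕ} (x₀ : M) (α β : DForm n M k) :
    locRep x₀ (α + β) = locRep x₀ α + locRep x₀ β := rfl

theorem locRep_smul {k : ℕ} (x₀ : M) (c : ℝ) (α : DForm n M k) :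
    locRep x₀ (c • α) = c • locRep x₀ α := rfl

/-- The space `Ω^k(M)` of smooth differential `k`-forms. -/
def smoothForms (n : ℕ) (M : Type*) [TopologicalSpace M]
    [ChartedSpace (EuclideanSpace ℝ (Fin n)) M] (k : ℕ) : Submodule ℝ (DForm n M k) where
  carrier := {α | ∀ x₀ : M, ContDiffOn ℝ ∞ (locRep x₀ α) (extChartAt (𝓡 n) x₀).target}
  add_mem' {α β} hα hβ x₀ := by rw [locRep_add]; exact (hα x₀).add (hβ x₀)
  zero_mem' x₀ := (contDiffOn_const (c := 0)).congr fun y _ => rfl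
  smul_mem' c α hα x₀ := by rw [locRep_smul]; exact contDiffOn_const.smul (hα x₀)

/-- Exterior derivative of a differential form on `M`, computed at `x` in the chart around `x`. -/
def extD {k : ℕ} (α : DForm n M k) : DForm n M (k + 1) := fun x =>
  fromChart x (extDeriv (locRep x α) (extChartAt (𝓡 n) x x))

/-- Lie derivative on a vector space, at the point `y`, of the form `a` along the field `V`:
the derivative at `t = 0` of the pull-back of `a` by `y ↦ y + t V(y)`, which agrees to first order
in `t` with the flow of `V`. -/
def flatLieDeriv {k : ℕ} (V : EuclideanSpace ℝ (Fin n) → EuclideanSpace ℝ (Fin n))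
    (a : EuclideanSpace ℝ (Fin n) → (EuclideanSpace ℝ (Fin n)) [⋀^Fin k]→L[ℝ] ℝ)
    (y : EuclideanSpace ℝ (Fin n)) : (EuclideanSpace ℝ (Fin n)) [⋀^Fin k]→L[ℝ] ℝ :=
  deriv (fun t : ℝ => (a (y + t • V y)).compContinuousLinearMap
    (ContinuousLinearMap.id ℝ (EuclideanSpace ℝ (Fin n)) + t • fderiv ℝ V y)) 0

/-- Lie derivative `L_v α` of a differential form on `M`, computed at `x` in the chart
around `x`. -/
def lieD {k : ℕ} (v : (x : M) → TangentSpace (𝓡 n) x) (α : DForm n M k) : DForm n M k :=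
  fun x => fromChart x (flatLieDeriv (locField x v) (locRep x α) (extChartAt (𝓡 n) x x))

/-- Interior product `i_v α`. -/
def interiorProd {k : ℕ} (v : (x : M) → TangentSpace (𝓡 n) x) (α : DForm n M (k + 1)) :
    DForm n M k := fun x =>
  ContinuousAlternatingMap.curryLeft (E := EuclideanSpace ℝ (Fin n)) (α x) (v x)

/-- Exterior product of differential forms. -/
def wedgeForm {k l p : ℕ} (h : k + l = p) (α : DForm n M k) (β : DForm n M l) : DForm n M p :=
  fun x => wedge h (α x) (β x)

/-- Exterior powers `α ^ j` of a 2-form. -/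
def powForm (α : DForm n M 2) (j : ℕ) : DForm n M (2 * j) := fun x => wedgePow (α x) j

end Forms

section Linearity

variable {n : ℕ} {M : Type*} [TopologicalSpace M]
  [ChartedSpace (EuclideanSpace ℝ (Fin n)) M]

theorem fromChart_add {k : ℕ} (x : M) (a b : (EuclideanSpace ℝ (Fin n)) [⋀^Fin k]→L[ℝ] ℝ) :
    fromChart x (a + b) = fromChart x a + fromChart x b := rfl

theorem fromChart_smul {k : ℕ} (x : M) (c : ℝ)
    (a : (EuclideanSpace ℝ (Fin n)) [⋀^Fin k]→L[ℝ] ℝ) :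
    fromChart x (c • a) = c • fromChart x a := rfl

theorem differentiableAt_locRep {k : ℕ} {α : DForm n M k} (hα : α ∈ smoothForms n M k) (x : M) :
    DifferentiableAt ℝ (locRep x α) (extChartAt (𝓡 n) x x) :=
  ((hα x).contDiffAt ((isOpen_extChartAt_target x).mem_nhds
    (mem_extChartAt_target x))).differentiableAt (by simp)

theorem extD_add {k : ℕ} {α β : DForm n M k} (hα : α ∈ smoothForms n M k)
    (hβ : β ∈ smoothForms n M k) : extD (α + β) = extD α + extD β := by
  funext x
  simp only [extD, locRep_add]
  rw [extDeriv_add (differentiableAt_locRep hα x) (differentiableAt_locRep hβ x), fromChart_add]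
  rfl

theorem extD_smul {k : ℕ} (c : ℝ) (α : DForm n M k) : extD (c • α) = c • extD α := by
  funext x
  simp only [extD, locRep_smul]
  rw [extDeriv_smul, fromChart_smul]
  rfl

theorem flatLieDeriv_eq {k : ℕ} {V : EuclideanSpace ℝ (Fin n) → EuclideanSpace ℝ (Fin n)}
    {a : EuclideanSpace ℝ (Fin n) → (EuclideanSpace ℝ (Fin n)) [⋀^Fin k]→L[ℝ] ℝ}
    {y : EuclideanSpace ℝ (Fin n)} (ha : DifferentiableAt ℝ a y) :
    flatLieDeriv V a y = fderiv ℝ a y (V y) +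
      (a y).fderivCompContinuousLinearMap (ContinuousLinearMap.id ℝ _) (fderiv ℝ V y) := by
  have h1 : HasDerivAt (fun t : ℝ => y + t • V y) (V y) 0 := by
    simpa using ((hasDerivAt_id (0 : ℝ)).smul_const (V y)).const_add y
  have h2 : HasDerivAt (fun t : ℝ => ContinuousLinearMap.id ℝ (EuclideanSpace ℝ (Fin n)) +
      t • fderiv ℝ V y) (fderiv ℝ V y) 0 := by
    simpa using ((hasDerivAt_id (0 : ℝ)).smul_const (fderiv ℝ V y)).const_add
      (ContinuousLinearMap.id ℝ (EuclideanSpace ℝ (Fin n)))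
  have ha' : HasFDerivAt a (fderiv ℝ a y) (y + (0 : ℝ) • V y) := by
    simpa using ha.hasFDerivAt
  have h3 := (ha'.comp_hasDerivAt (0 : ℝ) h1).hasFDerivAt
  have h4 := (h3.continuousAlternatingMapCompContinuousLinearMap h2.hasFDerivAt).hasDerivAt
  unfold flatLieDeriv
  refine h4.deriv.trans ?_
  rw [zero_smul ℝ (fderiv ℝ V y), add_zero]
  simp only [Function.comp_apply, zero_smul, add_zero, _root_.add_apply,
    ContinuousLinearMap.comp_apply, ContinuousLinearMap.toSpanSingleton_apply, one_smul]
  rfl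

theorem differentiableAt_locField [IsManifold (𝓡 n) ∞ M]
    (v : Cₛ^∞⟮𝓡 n; EuclideanSpace ℝ (Fin n), (TangentSpace (𝓡 n) : M → Type)⟯) (x : M) :
    DifferentiableAt ℝ (locField x v) (extChartAt (𝓡 n) x x) := by
  have : IsManifold (𝓡 n) 2 M := IsManifold.of_le (n := ∞) (by exact WithTop.coe_le_coe.2 (le_top : (2 : ℕ∞) ≤ ⊤))
  have h := MDifferentiableWithinAt.differentiableWithinAt_mpullbackWithin_vectorField
    (I := 𝓡 n) (s := univ) (V := v) (x := x)
    ((v.contMDiff x).mdifferentiableAt (by simp)).mdifferentiableWithinAt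
  simp only [modelWithCornersSelf_coe, range_id, preimage_univ, inter_self,
    VectorField.mpullbackWithin_univ] at h
  exact differentiableWithinAt_univ.1 h

end Linearity

/-! ## Symplectic fluids -/

section Symplectic

variable {n : ℕ} {M : Type*} [TopologicalSpace M]
  [ChartedSpace (EuclideanSpace ℝ (Fin n)) M]

/-- Symplectic forms on `M`: smooth closed nondegenerate 2-forms. -/
structure SymplecticForm (n : ℕ) (M : Type*) [TopologicalSpace M]
    [ChartedSpace (EuclideanSpace ℝ (Fin n)) M] where
  form : DForm n M 2
  smooth : form ∈ smoothForms n M 2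
  closed : extD form = 0
  nondegenerate : ∀ (x : M) (u : TangentSpace (𝓡 n) x), (∀ w, form x ![u, w] = 0) → u = 0

/-- The space `dΩ^k(M)`, as a subspace of `Ω^{k+1}(M)`. -/
def exactForms (n : ℕ) (M : Type*) [TopologicalSpace M]
    [ChartedSpace (EuclideanSpace ℝ (Fin n)) M] (k : ℕ) :
    Submodule ℝ (smoothForms n M (k + 1)) where
  carrier := {α | ∃ β ∈ smoothForms n M k, (α : DForm n M (k + 1)) = extD β}
  add_mem' := by
    rintro α α' ⟨β, hβ, h⟩ ⟨β', hβ', h'⟩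
    exact ⟨β + β', add_mem hβ hβ', by rw [extD_add hβ hβ', ← h, ← h']; rfl⟩
  zero_mem' := ⟨0, zero_mem _, by simpa using (extD_smul (0 : ℝ) (0 : DForm n M k)).symm⟩
  smul_mem' := by
    rintro c α ⟨β, hβ, h⟩
    exact ⟨c • β, Submodule.smul_mem _ c hβ, by rw [extD_smul, ← h]; rfl⟩

/-- The quotient `Ω^{k+1}(M) / dΩ^k(M)`. -/
abbrev Cosets (n : ℕ) (M : Type*) [TopologicalSpace M]
    [ChartedSpace (EuclideanSpace ℝ (Fin n)) M] (k : ℕ) : Type _ :=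
  smoothForms n M (k + 1) ⧸ exactForms n M k

/-- The coset `[α]` of a smooth form. -/
abbrev coset {k : ℕ} (α : smoothForms n M (k + 1)) : Cosets n M k := (exactForms n M k).mkQ α

variable [IsManifold (𝓡 n) ∞ M]

/-- Smooth vector fields on `M`. -/
abbrev SmoothField (n : ℕ) (M : Type*) [TopologicalSpace M]
    [ChartedSpace (EuclideanSpace ℝ (Fin n)) M] [IsManifold (𝓡 n) ∞ M] : Type _ :=
  Cₛ^∞⟮𝓡 n; EuclideanSpace ℝ (Fin n), (TangentSpace (𝓡 n) : M → Type)⟯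

/-- Smooth Riemannian metrics on `M`. -/
abbrev RiemMetric (n : ℕ) (M : Type*) [TopologicalSpace M]
    [ChartedSpace (EuclideanSpace ℝ (Fin n)) M] [IsManifold (𝓡 n) ∞ M] : Type _ :=
  Bundle.ContMDiffRiemannianMetric (𝓡 n) ∞ (EuclideanSpace ℝ (Fin n))
    (TangentSpace (𝓡 n) : M → Type)

/-- The space of symplectic vector fields, `{v | L_v ω = 0}`. -/
def symp (ω₀ : SymplecticForm n M) : Submodule ℝ (SmoothField n M) where
  carrier := {v | lieD v ω₀.form = 0}
  add_mem' := by
    intro v w hv hw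
    funext x
    have hd := differentiableAt_locRep ω₀.smooth x
    have hl : locField x (v + w : SmoothField n M) = locField x v + locField x w :=
      VectorField.mpullback_add
    have h1 := congrFun hv x
    have h2 := congrFun hw x
    have h3 : fderiv ℝ (locField x v + locField x w) (extChartAt (𝓡 n) x x) = _ :=
      fderiv_add (differentiableAt_locField v x) (differentiableAt_locField w x)
    simp only [lieD, flatLieDeriv_eq hd] at h1 h2 ⊢
    rw [hl, h3, Pi.add_apply, map_add, map_add, add_add_add_comm, fromChart_add, h1, h2]
    simp
    rfl
  zero_mem' := by
    funext x
    have hl : locField x (0 : SmoothField n M) = 0 := by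
      funext y
      exact map_zero (mfderiv 𝓘(ℝ, EuclideanSpace ℝ (Fin n)) (𝓡 n)
        (extChartAt (𝓡 n) x).symm y).inverse
    simp only [lieD, flatLieDeriv_eq (differentiableAt_locRep ω₀.smooth x), hl]
    simp [fromChart]
    rfl
  smul_mem' := by
    intro c v hv
    funext x
    have hd := differentiableAt_locRep ω₀.smooth x
    have hl : locField x (c • v : SmoothField n M) = c • locField x v :=
      VectorField.mpullback_const_smul
    have h1 := congrFun hv x
    have h3 : fderiv ℝ (c • locField x v) (extChartAt (𝓡 n) x x) = _ :=
      fderiv_const_smul (differentiableAt_locField v x) c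
    simp only [lieD, flatLieDeriv_eq hd] at h1 ⊢
    rw [hl, h3, Pi.smul_apply, map_smul, map_smul, ← smul_add, fromChart_smul, h1]
    exact smul_zero c

/-- The 1-form `v^♭ = g(v, ·)`. -/
def flat (g : RiemMetric n M) (v : (x : M) → TangentSpace (𝓡 n) x) : DForm n M 1 := fun x =>
  ContinuousAlternatingMap.ofSubsingleton ℝ (TangentSpace (𝓡 n) x) ℝ (0 : Fin 1) (g.inner x (v x))

/-- The Gram determinant of vectors `u₁, …, u_n ∈ T_x M`. -/
def gramDet (g : RiemMetric n M) (x : M) (u : Fin n → TangentSpace (𝓡 n) x) : ℝ :=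
  (Matrix.of fun i j => g.inner x (u i) (u j)).det

/-- The coordinate vector fields of the chart around `x₀`, at the point with coordinates `y`. -/
def coordVec (x₀ : M) (y : EuclideanSpace ℝ (Fin n)) (i : Fin n) :
    TangentSpace (𝓡 n) ((extChartAt (𝓡 n) x₀).symm y) :=
  mfderiv 𝓘(ℝ, EuclideanSpace ℝ (Fin n)) (𝓡 n) (extChartAt (𝓡 n) x₀).symm y
    (EuclideanSpace.single i (1 : ℝ))

variable [T2Space M] [CompactSpace M]

/-- A smooth partition of unity subordinate to the charts of `M`. -/
def chartPartition (n : ℕ) (M : Type*) [TopologicalSpace M]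
    [ChartedSpace (EuclideanSpace ℝ (Fin n)) M] [IsManifold (𝓡 n) ∞ M] [T2Space M]
    [CompactSpace M] : SmoothPartitionOfUnity M (𝓡 n) M univ :=
  (SmoothPartitionOfUnity.exists_isSubordinate_chartAt_source (𝓡 n) M).choose

/-- The integral `∫_M η` of an `n`-form over the compact `n`-manifold `M` with the orientation given
by the volume form `o`: the sum over a partition of unity of the integrals in the charts, with
the sign that compares the chart with the orientation. -/
def integralForm (o η : DForm n M n) : ℝ :=
  ∑ᶠ i : M, ∫ y in (extChartAt (𝓡 n) i).target,
    chartPartition n M i ((extChartAt (𝓡 n) i).symm y) *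
      (Real.sign (o _ (coordVec i y)) * η _ (coordVec i y))

/-- The integral of a function against the Riemannian volume, `√(det g_{ab}) dy` in charts. -/
def integralVol (g : RiemMetric n M) (f : M → ℝ) : ℝ :=
  ∑ᶠ i : M, ∫ y in (extChartAt (𝓡 n) i).target,
    chartPartition n M i ((extChartAt (𝓡 n) i).symm y) *
      (f ((extChartAt (𝓡 n) i).symm y) * √(gramDet g _ (coordVec i y)))

/-- The `L²`-energy `E(v) = ½ ∫_M (v,v) dvol_g` on symplectic fields. -/
def energy (g : RiemMetric n M) (ω₀ : SymplecticForm n M) (v : symp ω₀) : ℝ :=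
  1 / 2 * integralVol g fun x => g.inner x ((v : SmoothField n M) x) ((v : SmoothField n M) x)

end Symplectic

section HalfDimension

/- Throughout, `dim M = 2 m` with `m = k + 1`. -/

variable {k : ℕ} {M : Type*} [TopologicalSpace M]
  [ChartedSpace (EuclideanSpace ℝ (Fin (2 * (k + 1)))) M]

/-- The symplectic volume form `μ = ω^m / m`. -/
def sympVol (ω₀ : SymplecticForm (2 * (k + 1)) M) : DForm (2 * (k + 1)) M (2 * (k + 1)) :=
  ((k + 1 : ℕ) : ℝ)⁻¹ • powForm ω₀.form (k + 1)

variable [IsManifold (𝓡 (2 * (k + 1))) ∞ M]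

/-- The metric volume is the symplectic one: `|μ(u₁, …, u_n)|` is the volume of the parallelepiped
spanned by the tangent vectors `u₁, …, u_n`. -/
def VolumesAgree (g : RiemMetric (2 * (k + 1)) M) (ω₀ : SymplecticForm (2 * (k + 1)) M) : Prop :=
  ∀ (x : M) (u : Fin (2 * (k + 1)) → TangentSpace (𝓡 (2 * (k + 1))) x),
    |sympVol ω₀ x u| = √(gramDet g x u)

/-- The form `v^♭ ∧ ω^{m-1}`. -/
def momentumForm (g : RiemMetric (2 * (k + 1)) M) (ω₀ : SymplecticForm (2 * (k + 1)) M)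
    (v : symp ω₀) : DForm (2 * (k + 1)) M (2 * k + 1) :=
  wedgeForm (by omega) (flat g (v : SmoothField (2 * (k + 1)) M)) (powForm ω₀.form k)

variable [T2Space M] [CompactSpace M]

/-- The pairing `⟨v, α⟩ = ∫_M α ∧ i_v ω`, where `M` is oriented by `ω^m`. -/
def pairing (ω₀ : SymplecticForm (2 * (k + 1)) M) (v : symp ω₀)
    (α : DForm (2 * (k + 1)) M (2 * k + 1)) : ℝ :=
  integralForm (sympVol ω₀)
    (wedgeForm (by omega) α (interiorProd (v : SmoothField (2 * (k + 1)) M) ω₀.form))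

/-- The regular dual of the space of symplectic fields: the functionals with a smooth density, that
is, those of the form `v ↦ ∫_M θ(v) μ` with a smooth 1-form `θ`. -/
def regularDual (ω₀ : SymplecticForm (2 * (k + 1)) M) : Set (Module.Dual ℝ (symp ω₀)) :=
  {l | ∃ θ ∈ smoothForms (2 * (k + 1)) M 1, ∀ v : symp ω₀,
    l v = integralForm (sympVol ω₀)
      (fun x => θ x ![(v : SmoothField (2 * (k + 1)) M) x] • sympVol ω₀ x)}

end HalfDimension

/-! ## Smooth time dependence -/

section Paths

variable {n : ℕ} {M : Type*} [TopologicalSpace M]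
  [ChartedSpace (EuclideanSpace ℝ (Fin n)) M]

/-- A time-dependent form that is smooth in `(t, x)` for `t ∈ J`. -/
def SmoothFormPath {l : ℕ} (J : Set ℝ) (α : ℝ → smoothForms n M l) : Prop :=
  ∀ x₀ : M, ContDiffOn ℝ ∞
    (fun p : ℝ × EuclideanSpace ℝ (Fin n) => locRep x₀ (α p.1 : DForm n M l) p.2)
    (J ×ˢ (extChartAt (𝓡 n) x₀).target)

/-- `α' t` is the (pointwise) time derivative `∂_t α_t` for `t ∈ J`. -/
def IsTimeDeriv {l : ℕ} (J : Set ℝ) (α α' : ℝ → smoothForms n M l) : Prop :=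
  ∀ t ∈ J, ∀ (x : M) (u : Fin l → TangentSpace (𝓡 n) x),
    HasDerivAt (fun s => (α s : DForm n M l) x u) ((α' t : DForm n M l) x u) t

/-- A time-dependent vector field that is smooth in `(t, x)` for `t ∈ J`. -/
def SmoothFieldPath [IsManifold (𝓡 n) ∞ M] (J : Set ℝ) (v : ℝ → SmoothField n M) : Prop :=
  ContMDiffOn (𝓘(ℝ, ℝ).prod (𝓡 n)) (𝓡 n).tangent ∞
    (fun p : ℝ × M => (⟨p.2, v p.1 p.2⟩ : TangentBundle (𝓡 n) M)) (J ×ˢ univ)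

end Paths

/-! ## Coadjoint action and Euler equation of a Lie algebra -/

section Euler

variable {𝔤 : Type*} [AddCommGroup 𝔤] [Module ℝ 𝔤]

/-- The coadjoint action, `⟨w, ad*_v l⟩ = ⟨ad_v w, l⟩`. -/
def coad (ad : 𝔤 →ₗ[ℝ] 𝔤 →ₗ[ℝ] 𝔤) (v : 𝔤) : Module.Dual ℝ 𝔤 →ₗ[ℝ] Module.Dual ℝ 𝔤 :=
  (ad v).dualMap

/-- The Euler equation `dm/dt = - ad*_{A⁻¹ m} m` for `t ∈ J`, with inertia operator `A`; the time
derivative is that of the functional `m`. -/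
def EulerEquation (ad : 𝔤 →ₗ[ℝ] 𝔤 →ₗ[ℝ] 𝔤) (A : 𝔤 →ₗ[ℝ] Module.Dual ℝ 𝔤) (J : Set ℝ)
    (m : ℝ → Module.Dual ℝ 𝔤) : Prop :=
  ∀ t ∈ J, ∃ v : 𝔤, A v = m t ∧
    ∀ w : 𝔤, HasDerivAt (fun s => m s w) (-(coad ad v (m t) w)) t

end Euler

end

/-!
Everything rests on the pairing `⟨v, α⟩ = ∫ α ∧ i_v ω`; the dimension is `2m` with `m = k + 1`.

*The pairing.*  Since `i_v ω` is closed for a symplectic field `v`, the pairing vanishes on exact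
forms by Stokes' theorem (`pairL_extDL`, from `integralForm_extD` and `extD_wedgeForm_closed`).
Because `ω` is nondegenerate, the forms `i_v ω` are all closed 1-forms (`exists_contractL_eq`), so
that injectivity on cosets is Poincaré duality in codimension one: a form whose integrals against
all closed 1-forms vanish is exact (`mem_exactForms_of_forall_integral_eq_zero`).  The functionals
obtained are exactly the `v ↦ ∫ θ(v) μ`, by linear algebra at each point (`densityForm`, and
`pairing_wedge_powForm` for `α = θ ∧ ω ^ (m - 1)`, which rests on `wedge_wedgePow_curryLeft`).

*Poincaré duality* is proved without cohomology, through arbitrary linear functionals `L` on smooth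
forms that kill the exact ones; by linear algebra, these separate any other form from the exact
ones.  By the Poincaré lemma with supports in a cube in codimension one
(`exists_extDeriv_eq_of_closed`), `L` factors locally through the exterior derivative,
`L β = T (dβ)`.  By the same lemma in top degree (`exists_extDeriv_eq_of_integral_eq_zero`), two
local factors differ by a multiple of the integral.  Gluing them with a partition of unity gives
`L α = G (dα) + ∫ θ ∧ α` with a closed 1-form `θ` (`exists_eq_add_integral_wedge`).
Both terms vanish when `α` is orthogonal to the closed 1-forms: such an `α` is closed, as is seen by
testing it against exact 1-forms.
The two Poincaré lemmas are statements on divergences of vector fields in a cube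
(`CubeSmooth.exists_eq_divergence`, `exists_antisymm_potential`), proved one coordinate after the
other with compactly supported homotopy operators.

*The coadjoint action.*  The commutator of symplectic fields is Hamiltonian,
`i_{[v,w]} ω = - d(ω(v, w))` (`interiorProd_bracketField`).  Together with Cartan's formula
(`lieD_eq_cartan`) and integration by parts, this makes `⟨ad_v w, α⟩` and `⟨w, L_v α⟩` both equal to
`∫ ω(v, w) dα` (`coad_cosetDual`).

*The inertia operator.*  The pairing with `v^♭ ∧ ω ^ (m - 1)` is `∫ (v, w) μ` (`inertia_apply`),
which is symmetric, twice the energy on the diagonal, and positive definite, hence injective in `v`.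

*The Euler equation.*  Differentiation under the integral (`SmoothFormPath.hasDerivAt_integralForm`)
identifies the derivative of the functional of `α_t` with the functional of `∂_t α_t`; the
equivalence then follows from injectivity of the pairing and of the inertia operator
(`eulerEquation_iff`).
-/

noncomputable section

set_option maxSynthPendingDepth 3

/-! ### Exterior algebra -/

section WedgeAlgebra

open Equiv

/-- A sum over the permutations of `x, u₁, …, uₙ`, split by the position `p` of `x`; the sign
`(-1) ^ p` is that of the cycle that brings `x` to the front. -/
theorem sum_perm_fin_succ {n : ℕ} {α : Type*} (G : (Fin (n + 1) → α) → ℝ) (x : α)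
    (u : Fin n → α) :
    ∑ σ : Perm (Fin (n + 1)), ((Perm.sign σ : ℤ) : ℝ) *
        G (fun i => (Fin.cons x u : Fin (n + 1) → α) (σ i)) =
      ∑ p : Fin (n + 1), (-1) ^ (p : ℕ) *
        ∑ τ : Perm (Fin n), ((Perm.sign τ : ℤ) : ℝ) * G (p.insertNth x fun i => u (τ i)) := by
  have hinj : Function.Injective (fun q : Fin (n + 1) × Perm (Fin n) =>
      Perm.decomposeFin.symm (0, q.2) * q.1.cycleRange) := by
    rintro ⟨p, τ⟩ ⟨p', τ'⟩ h
    have h : Perm.decomposeFin.symm (0, τ) * p.cycleRange =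
      Perm.decomposeFin.symm (0, τ') * p'.cycleRange := h
    have hp : p = p' := by
      have h0 := congrArg (fun s : Perm (Fin (n + 1)) => s p) h
      simp only [Perm.coe_mul, Function.comp_apply, Fin.cycleRange_self] at h0
      have h1 : Perm.decomposeFin.symm (0, τ) (0 : Fin (n + 1)) =
        Perm.decomposeFin.symm (0, τ') (0 : Fin (n + 1)) := by simp
      rw [h1] at h0
      have h2 := (Perm.decomposeFin.symm (0, τ')).injective h0
      have h3 : (p'.cycleRange).symm 0 = p := by rw [h2]; simp
      rw [Fin.cycleRange_symm_zero] at h3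
      exact h3.symm
    subst hp
    have h1 := mul_right_cancel h
    have h2 := Perm.decomposeFin.symm.injective h1
    simpa using h2
  have hbij := (Fintype.bijective_iff_injective_and_card _).2 ⟨hinj, by
    simp [Fintype.card_perm, Nat.factorial_succ]⟩
  rw [← Function.Bijective.sum_comp hbij, Fintype.sum_prod_type]
  refine Finset.sum_congr rfl fun p _ => ?_
  rw [Finset.mul_sum]
  refine Finset.sum_congr rfl fun τ _ => ?_
  have hs : Perm.sign (Perm.decomposeFin.symm (0, τ) * p.cycleRange) =
      (-1) ^ (p : ℕ) * Perm.sign τ := by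
    rw [Perm.sign_mul, Fin.sign_cycleRange, Equiv.Perm.decomposeFin.symm_sign]
    simp [mul_comm]
  have hG : (fun i => (Fin.cons x u : Fin (n + 1) → α)
      ((Perm.decomposeFin.symm (0, τ) * p.cycleRange) i)) = p.insertNth x fun i => u (τ i) := by
    rw [← Fin.cons_comp_cycleRange]
    funext i
    simp only [Perm.coe_mul, Function.comp_apply]
    generalize p.cycleRange i = j
    refine Fin.cases ?_ (fun j => ?_) j
    · simp
    · simp
  rw [hs, hG]
  push_cast
  ring

variable {V : Type*} [AddCommGroup V] [Module ℝ V] [TopologicalSpace V]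

/-- The shuffle product as a sum over all permutations, which counts each shuffle `k! l!` times. -/
theorem wedge_apply_sum {k l n : ℕ} (h : k + l = n) (a : V [⋀^Fin k]→L[ℝ] ℝ)
    (b : V [⋀^Fin l]→L[ℝ] ℝ) (u : Fin n → V) :
    (k.factorial * l.factorial : ℝ) * wedge h a b u =
      ∑ σ : Perm (Fin n), ((Perm.sign σ : ℤ) : ℝ) *
        (a (fun i => u (σ (Fin.cast h (Fin.castAdd l i)))) *
          b (fun i => u (σ (Fin.cast h (Fin.natAdd k i))))) := by
  subst h
  have h1 := MultilinearMap.domCoprod_alternization_eq a.toAlternatingMap b.toAlternatingMap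
  have h2 := congrArg (fun f => LinearMap.mul' ℝ ℝ (f (fun i => u (finSumFinEquiv i)))) h1
  simp only [MultilinearMap.alternatization_apply] at h2
  have h3 : wedge rfl a b u = LinearMap.mul' ℝ ℝ
    ((a.toAlternatingMap.domCoprod b.toAlternatingMap) (fun i => u (finSumFinEquiv i))) := rfl
  rw [h3]
  simp only [AlternatingMap.smul_apply, map_nsmul, Fintype.card_fin] at h2
  rw [← Nat.cast_mul, ← nsmul_eq_mul, ← h2, map_sum]
  refine Fintype.sum_equiv (finSumFinEquiv.permCongr) _ _ fun σ => ?_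
  rw [Perm.sign_permCongr]
  rw [Units.smul_def]
  exact (map_zsmul (LinearMap.mul' ℝ ℝ) _ _).trans (by rw [zsmul_eq_mul]; simp)

theorem wedge_constOfIsEmpty_left {l : ℕ} (h : 0 + l = l) (c : V [⋀^Fin 0]→L[ℝ] ℝ)
    (b : V [⋀^Fin l]→L[ℝ] ℝ) : wedge h c b = c ![] • b := by
  ext u
  have h1 := wedge_apply_sum h c b u
  have h2 : ∀ σ : Perm (Fin l), ((Perm.sign σ : ℤ) : ℝ) *
        (c (fun i => u (σ (Fin.cast h (Fin.castAdd l i)))) *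
          b (fun i => u (σ (Fin.cast h (Fin.natAdd 0 i))))) = c ![] * b u := by
    intro σ
    have e1 : (fun i : Fin 0 => u (σ (Fin.cast h (Fin.castAdd l i)))) = ![] :=
      Subsingleton.elim _ _
    have e2 : (fun i => u (σ (Fin.cast h (Fin.natAdd 0 i)))) = fun i => u (σ i) := by
      funext i; congr 2; ext; simp
    have e3 : b (fun i => u (σ i)) = ((Perm.sign σ : ℤ) : ℝ) * b u := by
      have := b.toAlternatingMap.map_perm u σ
      simpa [Units.smul_def, Function.comp_def] using this
    rw [e1, e2, e3]
    have e4 : ((Perm.sign σ : ℤ) : ℝ) * ((Perm.sign σ : ℤ) : ℝ) = 1 := by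
      rw [← Int.cast_mul, ← Units.val_mul, Int.units_mul_self]; simp
    linear_combination (c ![] * b u) * e4
  rw [Finset.sum_congr rfl fun σ _ => h2 σ] at h1
  simp [Fintype.card_perm] at h1
  simpa [l.factorial_ne_zero] using h1

theorem wedge_constOfIsEmpty_right {k : ℕ} (h : k + 0 = k) (a : V [⋀^Fin k]→L[ℝ] ℝ)
    (c : V [⋀^Fin 0]→L[ℝ] ℝ) : wedge h a c = c ![] • a := by
  ext u
  have h1 := wedge_apply_sum h a c u
  have h2 : ∀ σ : Perm (Fin k), ((Perm.sign σ : ℤ) : ℝ) *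
        (a (fun i => u (σ (Fin.cast h (Fin.castAdd 0 i)))) *
          c (fun i => u (σ (Fin.cast h (Fin.natAdd k i))))) = c ![] * a u := by
    intro σ
    have e1 : (fun i : Fin 0 => u (σ (Fin.cast h (Fin.natAdd k i)))) = ![] :=
      Subsingleton.elim _ _
    have e3 : a (fun i => u (σ i)) = ((Perm.sign σ : ℤ) : ℝ) * a u := by
      have := a.toAlternatingMap.map_perm u σ
      simpa [Units.smul_def, Function.comp_def] using this
    have e2 : (fun i => u (σ (Fin.cast h (Fin.castAdd 0 i)))) = fun i => u (σ i) := by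
      funext i; congr 2
    rw [e1, e2, e3]
    have e4 : ((Perm.sign σ : ℤ) : ℝ) * ((Perm.sign σ : ℤ) : ℝ) = 1 := by
      rw [← Int.cast_mul, ← Units.val_mul, Int.units_mul_self]; simp
    linear_combination (c ![] * a u) * e4
  rw [Finset.sum_congr rfl fun σ _ => h2 σ] at h1
  simp [Fintype.card_perm] at h1
  simpa [k.factorial_ne_zero] using h1

variable {E : Type*} [NormedAddCommGroup E] [NormedSpace ℝ E]

theorem ContinuousAlternatingMap.map_insertNth_eq {k : ℕ} (a : E [⋀^Fin (k + 1)]→L[ℝ] ℝ)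
    (i : Fin (k + 1)) (x : E) (v : Fin k → E) :
    a (i.insertNth x v) = (-1) ^ (i : ℕ) * a.curryLeft x v := by
  have := a.toAlternatingMap.map_insertNth i x v
  simpa [ContinuousAlternatingMap.curryLeft_apply_apply] using this

theorem insertNth_castAdd {k l n : ℕ} {α : Type*} (h : (k + 1) + l = n + 1) (h' : k + l = n)
    (i j : Fin (k + 1)) (x : α) (w : Fin n → α) :
    (Fin.cast h (Fin.castAdd l i)).insertNth (α := fun _ => α) x w (Fin.cast h (Fin.castAdd l j)) =
      i.insertNth (α := fun _ => α) x (fun m => w (Fin.cast h' (Fin.castAdd l m))) j := by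
  rcases Fin.eq_self_or_eq_succAbove i j with rfl | ⟨m, rfl⟩
  · simp
  · have : Fin.cast h (Fin.castAdd l (i.succAbove m)) =
        (Fin.cast h (Fin.castAdd l i)).succAbove (Fin.cast h' (Fin.castAdd l m)) := by
      ext; simp [Fin.succAbove, Fin.lt_def]; split_ifs <;> simp
    rw [this, Fin.insertNth_apply_succAbove, Fin.insertNth_apply_succAbove]

theorem insertNth_castAdd_natAdd {k l n : ℕ} {α : Type*} (h : (k + 1) + l = n + 1)
    (h' : k + l = n) (i : Fin (k + 1)) (j : Fin l) (x : α) (w : Fin n → α) :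
    (Fin.cast h (Fin.castAdd l i)).insertNth (α := fun _ => α) x w
      (Fin.cast h (Fin.natAdd (k + 1) j)) = w (Fin.cast h' (Fin.natAdd k j)) := by
  have : Fin.cast h (Fin.natAdd (k + 1) j) =
      (Fin.cast h (Fin.castAdd l i)).succAbove (Fin.cast h' (Fin.natAdd k j)) := by
    ext; simp [Fin.succAbove, Fin.lt_def]; split_ifs <;> simp <;> omega
  rw [this, Fin.insertNth_apply_succAbove]

theorem insertNth_natAdd {k l n : ℕ} {α : Type*} (h : k + (l + 1) = n + 1) (h' : k + l = n)
    (i j : Fin (l + 1)) (x : α) (w : Fin n → α) :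
    (Fin.cast h (Fin.natAdd k i)).insertNth (α := fun _ => α) x w (Fin.cast h (Fin.natAdd k j)) =
      i.insertNth (α := fun _ => α) x (fun m => w (Fin.cast h' (Fin.natAdd k m))) j := by
  rcases Fin.eq_self_or_eq_succAbove i j with rfl | ⟨m, rfl⟩
  · simp
  · have : Fin.cast h (Fin.natAdd k (i.succAbove m)) =
        (Fin.cast h (Fin.natAdd k i)).succAbove (Fin.cast h' (Fin.natAdd k m)) := by
      ext; simp [Fin.succAbove, Fin.lt_def]; split_ifs <;> simp <;> omega
    rw [this, Fin.insertNth_apply_succAbove, Fin.insertNth_apply_succAbove]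

theorem insertNth_natAdd_castAdd {k l n : ℕ} {α : Type*} (h : k + (l + 1) = n + 1)
    (h' : k + l = n) (i : Fin (l + 1)) (j : Fin k) (x : α) (w : Fin n → α) :
    (Fin.cast h (Fin.natAdd k i)).insertNth (α := fun _ => α) x w
      (Fin.cast h (Fin.castAdd (l + 1) j)) = w (Fin.cast h' (Fin.castAdd l j)) := by
  have : Fin.cast h (Fin.castAdd (l + 1) j) =
      (Fin.cast h (Fin.natAdd k i)).succAbove (Fin.cast h' (Fin.castAdd l j)) := by
    ext; simp [Fin.succAbove, Fin.lt_def]; split_ifs <;> simp <;> omega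
  rw [this, Fin.insertNth_apply_succAbove]

/-- The interior product is an antiderivation of the exterior product. -/
theorem curryLeft_wedge {k l n : ℕ} (h : (k + 1) + (l + 1) = n + 1) (h₁ : k + (l + 1) = n)
    (h₂ : (k + 1) + l = n) (a : E [⋀^Fin (k + 1)]→L[ℝ] ℝ) (b : E [⋀^Fin (l + 1)]→L[ℝ] ℝ) (x : E) :
    (wedge h a b).curryLeft x =
      wedge h₁ (a.curryLeft x) b + (-1 : ℝ) ^ (k + 1) • wedge h₂ a (b.curryLeft x) := by
  ext u
  have h0 := wedge_apply_sum h a b (Fin.cons x u)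
  rw [sum_perm_fin_succ (fun w => a (fun i => w (Fin.cast h (Fin.castAdd (l + 1) i))) *
    b (fun i => w (Fin.cast h (Fin.natAdd (k + 1) i)))),
    ← (finCongr h).sum_comp, Fin.sum_univ_add] at h0
  have hA := wedge_apply_sum h₁ (a.curryLeft x) b u
  have hB := wedge_apply_sum h₂ a (b.curryLeft x) u
  have e1 : ∀ i : Fin (k + 1),
      (-1 : ℝ) ^ ((finCongr h (Fin.castAdd (l + 1) i) : Fin (n + 1)) : ℕ) *
        ∑ τ : Perm (Fin n), ((Perm.sign τ : ℤ) : ℝ) *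
          (a (fun j => (finCongr h (Fin.castAdd (l + 1) i)).insertNth (α := fun _ => E) x
            (fun i => u (τ i)) (Fin.cast h (Fin.castAdd (l + 1) j))) *
          b (fun j => (finCongr h (Fin.castAdd (l + 1) i)).insertNth (α := fun _ => E) x
            (fun i => u (τ i)) (Fin.cast h (Fin.natAdd (k + 1) j)))) =
      (k.factorial * (l + 1).factorial : ℝ) * wedge h₁ (a.curryLeft x) b u := by
    intro i
    rw [hA, Finset.mul_sum]
    refine Finset.sum_congr rfl fun τ _ => ?_
    simp only [finCongr_apply, insertNth_castAdd h h₁, insertNth_castAdd_natAdd h h₁]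
    rw [show (fun j => i.insertNth (α := fun _ => E) x
      (fun m => u (τ (Fin.cast h₁ (Fin.castAdd (l + 1) m)))) j) = i.insertNth (α := fun _ => E) x
      (fun m => u (τ (Fin.cast h₁ (Fin.castAdd (l + 1) m)))) from rfl,
      ContinuousAlternatingMap.map_insertNth_eq]
    have e4 : (-1 : ℝ) ^ (i : ℕ) * (-1 : ℝ) ^ (i : ℕ) = 1 := by
      rw [← pow_add, ← two_mul, pow_mul]; simp
    simp only [Fin.val_cast, Fin.val_castAdd]
    linear_combination (((Perm.sign τ : ℤ) : ℝ) *
      ((a.curryLeft x) (fun m => u (τ (Fin.cast h₁ (Fin.castAdd (l + 1) m)))) *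
        b fun j => u (τ (Fin.cast h₁ (Fin.natAdd k j))))) * e4
  have e2 : ∀ i : Fin (l + 1),
      (-1 : ℝ) ^ ((finCongr h (Fin.natAdd (k + 1) i) : Fin (n + 1)) : ℕ) *
        ∑ τ : Perm (Fin n), ((Perm.sign τ : ℤ) : ℝ) *
          (a (fun j => (finCongr h (Fin.natAdd (k + 1) i)).insertNth (α := fun _ => E) x
            (fun i => u (τ i)) (Fin.cast h (Fin.castAdd (l + 1) j))) *
          b (fun j => (finCongr h (Fin.natAdd (k + 1) i)).insertNth (α := fun _ => E) x
            (fun i => u (τ i)) (Fin.cast h (Fin.natAdd (k + 1) j)))) =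
      ((k + 1).factorial * l.factorial : ℝ) *
        ((-1 : ℝ) ^ (k + 1) * wedge h₂ a (b.curryLeft x) u) := by
    intro i
    rw [mul_left_comm, hB, Finset.mul_sum, Finset.mul_sum]
    refine Finset.sum_congr rfl fun τ _ => ?_
    simp only [finCongr_apply, insertNth_natAdd h h₂, insertNth_natAdd_castAdd h h₂]
    rw [show (fun j => i.insertNth (α := fun _ => E) x
      (fun m => u (τ (Fin.cast h₂ (Fin.natAdd (k + 1) m)))) j) = i.insertNth (α := fun _ => E) x
      (fun m => u (τ (Fin.cast h₂ (Fin.natAdd (k + 1) m)))) from rfl,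
      ContinuousAlternatingMap.map_insertNth_eq]
    have e4 : (-1 : ℝ) ^ (i : ℕ) * (-1 : ℝ) ^ (i : ℕ) = 1 := by
      rw [← pow_add, ← two_mul, pow_mul]; simp
    simp only [Fin.val_cast, Fin.val_natAdd, pow_add (-1 : ℝ) (k + 1)]
    linear_combination ((-1 : ℝ) ^ (k + 1) * ((Perm.sign τ : ℤ) : ℝ) *
      (a (fun m => u (τ (Fin.cast h₂ (Fin.castAdd l m)))) *
        (b.curryLeft x) fun j => u (τ (Fin.cast h₂ (Fin.natAdd (k + 1) j))))) * e4
  rw [Finset.sum_congr rfl fun i _ => e1 i, Finset.sum_congr rfl fun i _ => e2 i] at h0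
  simp only [Finset.sum_const, Finset.card_univ, Fintype.card_fin, nsmul_eq_mul,
    Nat.factorial_succ] at h0
  push_cast at h0
  have hne : ((k + 1 : ℝ) * k.factorial * ((l + 1) * l.factorial)) ≠ 0 := by positivity
  refine mul_left_cancel₀ hne ?_
  change _ * wedge h a b (Fin.cons x u) = _ * (wedge h₁ (a.curryLeft x) b u +
    (-1 : ℝ) ^ (k + 1) * wedge h₂ a (b.curryLeft x) u)
  rw [h0]
  ring

theorem wedge_apply {k l n : ℕ} (h : k + l = n) (a : V [⋀^Fin k]→L[ℝ] ℝ)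
    (b : V [⋀^Fin l]→L[ℝ] ℝ) (u : Fin n → V) :
    wedge h a b u = (k.factorial * l.factorial : ℝ)⁻¹ *
      ∑ σ : Perm (Fin n), ((Perm.sign σ : ℤ) : ℝ) *
        (a (fun i => u (σ (Fin.cast h (Fin.castAdd l i)))) *
          b (fun i => u (σ (Fin.cast h (Fin.natAdd k i))))) := by
  rw [← wedge_apply_sum h a b u, inv_mul_cancel_left₀ (by positivity)]

theorem wedge_add_left {k l n : ℕ} (h : k + l = n) (a a' : V [⋀^Fin k]→L[ℝ] ℝ)
    (b : V [⋀^Fin l]→L[ℝ] ℝ) : wedge h (a + a') b = wedge h a b + wedge h a' b := by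
  ext u
  simp only [wedge_apply, ContinuousAlternatingMap.add_apply, add_mul, mul_add,
    Finset.sum_add_distrib]

theorem wedge_add_right {k l n : ℕ} (h : k + l = n) (a : V [⋀^Fin k]→L[ℝ] ℝ)
    (b b' : V [⋀^Fin l]→L[ℝ] ℝ) : wedge h a (b + b') = wedge h a b + wedge h a b' := by
  ext u
  simp only [wedge_apply, ContinuousAlternatingMap.add_apply, mul_add,
    Finset.sum_add_distrib]

theorem wedge_smul_left {k l n : ℕ} (h : k + l = n) (c : ℝ) (a : V [⋀^Fin k]→L[ℝ] ℝ)
    (b : V [⋀^Fin l]→L[ℝ] ℝ) : wedge h (c • a) b = c • wedge h a b := by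
  ext u
  simp only [wedge_apply, ContinuousAlternatingMap.smul_apply, smul_eq_mul, Finset.mul_sum]
  exact Finset.sum_congr rfl fun _ _ => by ring

theorem wedge_smul_right {k l n : ℕ} (h : k + l = n) (c : ℝ) (a : V [⋀^Fin k]→L[ℝ] ℝ)
    (b : V [⋀^Fin l]→L[ℝ] ℝ) : wedge h a (c • b) = c • wedge h a b := by
  ext u
  simp only [wedge_apply, ContinuousAlternatingMap.smul_apply, smul_eq_mul, Finset.mul_sum]
  exact Finset.sum_congr rfl fun _ _ => by ring

theorem wedge_compContinuousLinearMap {W : Type*} [AddCommGroup W] [Module ℝ W]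
    [TopologicalSpace W] {k l n : ℕ} (h : k + l = n) (a : V [⋀^Fin k]→L[ℝ] ℝ)
    (b : V [⋀^Fin l]→L[ℝ] ℝ) (f : W →L[ℝ] V) :
    (wedge h a b).compContinuousLinearMap f =
      wedge h (a.compContinuousLinearMap f) (b.compContinuousLinearMap f) := by
  ext u
  rw [wedge_apply, ContinuousAlternatingMap.compContinuousLinearMap_apply, wedge_apply]
  rfl

theorem wedgePow_compContinuousLinearMap {W : Type*} [AddCommGroup W] [Module ℝ W]
    [TopologicalSpace W] (a : V [⋀^Fin 2]→L[ℝ] ℝ) (f : W →L[ℝ] V) (j : ℕ) :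
    (wedgePow a j).compContinuousLinearMap f = wedgePow (a.compContinuousLinearMap f) j := by
  induction j with
  | zero => rfl
  | succ j ih => rw [wedgePow, wedge_compContinuousLinearMap, ih, wedgePow]

theorem alternating_ext_curryLeft {k : ℕ} {a b : E [⋀^Fin (k + 1)]→L[ℝ] ℝ}
    (h : ∀ x, a.curryLeft x = b.curryLeft x) : a = b := by
  ext u
  have := congrArg (fun f => f (Fin.tail u)) (h (u 0))
  simpa [ContinuousAlternatingMap.curryLeft_apply_apply, Matrix.vecCons, Fin.cons_self_tail]
    using this

/-- The exterior product `θ ∧ a` of a covector with an alternating form. -/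
def covecWedge {k : ℕ} (θ : E →L[ℝ] ℝ) (a : E [⋀^Fin k]→L[ℝ] ℝ) : E [⋀^Fin (k + 1)]→L[ℝ] ℝ :=
  ContinuousAlternatingMap.alternatizeUncurryFin (θ.smulRight a)

/-- A covector, as a `1`-form. -/
abbrev covecForm (θ : E →L[ℝ] ℝ) : E [⋀^Fin 1]→L[ℝ] ℝ :=
  ContinuousAlternatingMap.ofSubsingleton ℝ E ℝ (0 : Fin 1) θ

theorem covecWedge_apply {k : ℕ} (θ : E →L[ℝ] ℝ) (a : E [⋀^Fin k]→L[ℝ] ℝ) (u : Fin (k + 1) → E) :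
    covecWedge θ a u = ∑ i : Fin (k + 1), (-1) ^ (i : ℕ) * (θ (u i) * a (i.removeNth u)) := by
  simp [covecWedge, ContinuousAlternatingMap.alternatizeUncurryFin_apply]

theorem covecWedge_add {k : ℕ} (θ : E →L[ℝ] ℝ) (a b : E [⋀^Fin k]→L[ℝ] ℝ) :
    covecWedge θ (a + b) = covecWedge θ a + covecWedge θ b := by
  ext u
  simp [covecWedge_apply, mul_add, Finset.sum_add_distrib]

theorem covecWedge_smul {k : ℕ} (θ : E →L[ℝ] ℝ) (c : ℝ) (a : E [⋀^Fin k]→L[ℝ] ℝ) :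
    covecWedge θ (c • a) = c • covecWedge θ a := by
  ext u
  simp only [covecWedge_apply, ContinuousAlternatingMap.smul_apply, smul_eq_mul, Finset.mul_sum]
  exact Finset.sum_congr rfl fun _ _ => by ring

theorem covecWedge_sub {k : ℕ} (θ : E →L[ℝ] ℝ) (a b : E [⋀^Fin k]→L[ℝ] ℝ) :
    covecWedge θ (a - b) = covecWedge θ a - covecWedge θ b := by
  ext u
  simp [covecWedge_apply, mul_sub, Finset.sum_sub_distrib]

theorem curryLeft_alternatizeUncurryFin {k : ℕ} (f : E →L[ℝ] E [⋀^Fin (k + 1)]→L[ℝ] ℝ)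
    (x : E) (u : Fin (k + 1) → E) :
    (ContinuousAlternatingMap.alternatizeUncurryFin f).curryLeft x u =
      f x u - ∑ i : Fin (k + 1), (-1) ^ (i : ℕ) * (f (u i)).curryLeft x (i.removeNth u) := by
  rw [ContinuousAlternatingMap.curryLeft_apply_apply,
    ContinuousAlternatingMap.alternatizeUncurryFin_apply, Fin.sum_univ_succ, sub_eq_add_neg,
    ← Finset.sum_neg_distrib]
  congr 1
  · simp [Matrix.vecCons]
  · refine Finset.sum_congr rfl fun i _ => ?_
    have : Fin.removeNth i.succ (Matrix.vecCons x u : Fin (k + 2) → E) =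
        Matrix.vecCons x (i.removeNth u) := by
      funext j
      refine Fin.cases ?_ (fun j => ?_) j
      · simp [Fin.removeNth]
      · simp [Fin.removeNth]
    rw [this, ContinuousAlternatingMap.curryLeft_apply_apply]
    simp [pow_succ]

theorem curryLeft_covecWedge {k : ℕ} (θ : E →L[ℝ] ℝ) (a : E [⋀^Fin (k + 1)]→L[ℝ] ℝ) (x : E) :
    (covecWedge θ a).curryLeft x = θ x • a - covecWedge θ (a.curryLeft x) := by
  ext u
  rw [covecWedge, curryLeft_alternatizeUncurryFin, ContinuousAlternatingMap.sub_apply,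
    covecWedge_apply]
  simp

theorem curryLeft_covecWedge_zero (θ : E →L[ℝ] ℝ) (a : E [⋀^Fin 0]→L[ℝ] ℝ) (x : E) :
    (covecWedge θ a).curryLeft x = θ x • a := by
  ext u
  rw [ContinuousAlternatingMap.curryLeft_apply_apply, covecWedge_apply]
  have : ∀ i : Fin 1, i.removeNth (Matrix.vecCons x u) = u := fun i => Subsingleton.elim _ _
  simp [this]

theorem curryLeft_covecForm (θ : E →L[ℝ] ℝ) (x : E) (u : Fin 0 → E) :
    (covecForm θ).curryLeft x u = θ x := by
  simp [ContinuousAlternatingMap.curryLeft_apply_apply, covecForm]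

theorem covecWedge_comm {k : ℕ} (θ η : E →L[ℝ] ℝ) (a : E [⋀^Fin k]→L[ℝ] ℝ) :
    covecWedge θ (covecWedge η a) = -covecWedge η (covecWedge θ a) := by
  induction k with
  | zero =>
    refine alternating_ext_curryLeft fun x => alternating_ext_curryLeft fun y => ?_
    rw [curryLeft_covecWedge, curryLeft_covecWedge_zero]
    have : (-covecWedge η (covecWedge θ a)).curryLeft x =
      -((covecWedge η (covecWedge θ a)).curryLeft x) := rfl
    rw [this, curryLeft_covecWedge, curryLeft_covecWedge_zero, covecWedge_smul, covecWedge_smul]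
    abel_nf
  | succ k ih =>
    refine alternating_ext_curryLeft fun x => ?_
    have : (-covecWedge η (covecWedge θ a)).curryLeft x =
      -((covecWedge η (covecWedge θ a)).curryLeft x) := rfl
    rw [this]
    simp only [curryLeft_covecWedge, covecWedge_sub, covecWedge_smul]
    rw [ih]
    abel

theorem wedge_covecForm_left {k : ℕ} (h : 1 + k = k + 1) (θ : E →L[ℝ] ℝ)
    (a : E [⋀^Fin k]→L[ℝ] ℝ) : wedge h (covecForm θ) a = covecWedge θ a := by
  induction k with
  | zero =>
    rw [wedge_constOfIsEmpty_right]
    ext u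
    rw [covecWedge_apply]
    simp [covecForm, Subsingleton.elim ((0 : Fin 1).removeNth u) ![], mul_comm]
  | succ k ih =>
    refine alternating_ext_curryLeft fun x => ?_
    rw [curryLeft_wedge (k := 0) h (by omega) (by omega), curryLeft_covecWedge, ih,
      show wedge (by omega) ((covecForm θ).curryLeft x) a = θ x • a by
        rw [wedge_constOfIsEmpty_left, curryLeft_covecForm]]
    ext u
    simp [sub_eq_add_neg]

theorem wedge_covecForm_right {k : ℕ} (h : k + 1 = k + 1) (θ : E →L[ℝ] ℝ)
    (a : E [⋀^Fin k]→L[ℝ] ℝ) : wedge h a (covecForm θ) = (-1 : ℝ) ^ k • covecWedge θ a := by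
  induction k with
  | zero =>
    rw [wedge_constOfIsEmpty_left]
    ext u
    rw [ContinuousAlternatingMap.smul_apply, ContinuousAlternatingMap.smul_apply, covecWedge_apply]
    simp [covecForm, Subsingleton.elim ((0 : Fin 1).removeNth u) ![], mul_comm]
  | succ k ih =>
    refine alternating_ext_curryLeft fun x => ?_
    have e : ((-1 : ℝ) ^ (k + 1) • covecWedge θ a).curryLeft x =
      (-1 : ℝ) ^ (k + 1) • (covecWedge θ a).curryLeft x := rfl
    rw [e, curryLeft_wedge (l := 0) h (by omega) (by omega), curryLeft_covecWedge, ih,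
      show wedge (by omega) a ((covecForm θ).curryLeft x) = θ x • a by
        rw [wedge_constOfIsEmpty_right, curryLeft_covecForm]]
    ext u
    simp [pow_succ]
    ring

theorem wedge_neg_left {k l n : ℕ} (h : k + l = n) (a : V [⋀^Fin k]→L[ℝ] ℝ)
    (b : V [⋀^Fin l]→L[ℝ] ℝ) : wedge h (-a) b = -wedge h a b := by
  ext u
  simp [wedge_apply]

theorem covecWedge_wedge {k l n : ℕ} (h : k + l = n) (h' : k + 1 + l = n + 1) (θ : E →L[ℝ] ℝ)
    (a : E [⋀^Fin k]→L[ℝ] ℝ) (b : E [⋀^Fin l]→L[ℝ] ℝ) :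
    covecWedge θ (wedge h a b) = wedge h' (covecWedge θ a) b := by
  induction n generalizing k l with
  | zero =>
    obtain rfl : k = 0 := by omega
    obtain rfl : l = 0 := by omega
    rw [wedge_constOfIsEmpty_right, wedge_constOfIsEmpty_right, covecWedge_smul]
  | succ n ih =>
    refine alternating_ext_curryLeft fun x => ?_
    rcases l with _ | l
    · obtain rfl : k = n + 1 := by omega
      rw [wedge_constOfIsEmpty_right, wedge_constOfIsEmpty_right, covecWedge_smul]
    rcases k with _ | k
    · obtain rfl : l = n := by omega
      rw [wedge_constOfIsEmpty_left, curryLeft_wedge h' (by omega) (by omega),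
        curryLeft_covecWedge_zero, wedge_smul_left, wedge_constOfIsEmpty_left, curryLeft_covecWedge,
        ← ih (by omega), wedge_constOfIsEmpty_left]
      have e : (a ![] • b).curryLeft x = a ![] • b.curryLeft x := rfl
      rw [e]
      ext u
      simp [sub_eq_add_neg]
    · rw [curryLeft_covecWedge, curryLeft_wedge h (by omega) (by omega),
        curryLeft_wedge h' (by omega) (by omega), curryLeft_covecWedge,
        ← ih (by omega), covecWedge_add, covecWedge_smul, sub_eq_add_neg (θ x • a),
        wedge_add_left, wedge_smul_left, wedge_neg_left, ← ih (k := k) (by omega)]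
      ext u
      simp [pow_succ]
      ring

/-- The induction step for `curryLeft_wedgePow`: a further factor `s` in the product. -/
theorem curryLeft_wedge_two {m : ℕ} (hm : Even m) (h : m + 2 + 2 = m + 2 + 1 + 1)
    (p : E [⋀^Fin (m + 2)]→L[ℝ] ℝ) (q : E [⋀^Fin m]→L[ℝ] ℝ) (s : E [⋀^Fin 2]→L[ℝ] ℝ) (w : E)
    (θ : E →L[ℝ] ℝ) (c : ℝ) (hθ : s.curryLeft w = covecForm θ)
    (hp : p.curryLeft w = c • covecWedge θ q) :
    (wedge h p s).curryLeft w = c • covecWedge θ (wedge rfl q s) + covecWedge θ p := by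
  rw [curryLeft_wedge (k := m + 1) (l := 1) h (by omega) (by omega), hp, hθ, wedge_smul_left,
    wedge_covecForm_right, covecWedge_wedge rfl (by omega)]
  have h1 : (-1 : ℝ) ^ (m + 1 + 1) = 1 := Even.neg_one_pow (by simpa [Nat.even_add_one] using hm)
  rw [h1]
  ext u
  simp

/-- The formula `i_w (s ^ (j + 1)) = (j + 1) (i_w s) ∧ s ^ j`. -/
theorem curryLeft_wedgePow (s : E [⋀^Fin 2]→L[ℝ] ℝ) (j : ℕ) (w : E) (θ : E →L[ℝ] ℝ)
    (hθ : s.curryLeft w = covecForm θ) :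
    ContinuousAlternatingMap.curryLeft (n := 2 * j + 1) (wedgePow s (j + 1)) w =
      ((j : ℝ) + 1) • covecWedge θ (wedgePow s j) := by
  induction j with
  | zero =>
    have h1 : wedgePow s 1 = s := by
      rw [wedgePow, wedgePow]
      exact (wedge_constOfIsEmpty_left _ _ _).trans (by simp)
    change ContinuousAlternatingMap.curryLeft (n := 1) (wedgePow s 1) w = _
    rw [h1, hθ, ← wedge_covecForm_left (by omega : 1 + 0 = 0 + 1), wedgePow]
    erw [wedge_constOfIsEmpty_right]
    ext u
    simp
  | succ j ih =>
    refine (curryLeft_wedge_two (m := 2 * j) (by simp) _ (wedgePow s (j + 1)) (wedgePow s j) s w θ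
      (j + 1) hθ ih).trans ?_
    push_cast
    ext u
    simp only [ContinuousAlternatingMap.add_apply, ContinuousAlternatingMap.smul_apply, smul_eq_mul]
    have h1 : ∀ r : ℝ, ((j : ℝ) + 1) * r + r = (j + 1 + 1) * r := fun r => by ring
    exact h1 _

/-- An alternating form whose degree exceeds the dimension vanishes. -/
theorem alternating_eq_zero_of_finrank_lt [FiniteDimensional ℝ E] {k : ℕ}
    (hk : Module.finrank ℝ E < k) (a : E [⋀^Fin k]→L[ℝ] ℝ) : a = 0 := by
  ext u
  refine a.toAlternatingMap.map_linearDependent u fun h => ?_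
  have := h.fintype_card_le_finrank
  simp at this
  omega

/-- In top degree `θ ∧ i_x μ = θ(x) μ`, by contraction of `θ ∧ μ = 0` with `x`. -/
theorem covecWedge_curryLeft_top [FiniteDimensional ℝ E] {k : ℕ} (hk : Module.finrank ℝ E = k + 1)
    (θ : E →L[ℝ] ℝ) (μ : E [⋀^Fin (k + 1)]→L[ℝ] ℝ) (x : E) :
    covecWedge θ (μ.curryLeft x) = θ x • μ := by
  have h := curryLeft_covecWedge θ μ x
  rw [alternating_eq_zero_of_finrank_lt (by omega) (covecWedge θ μ)] at h
  exact (sub_eq_zero.1 h.symm).symm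

/-- On a space of dimension `k + 1`, a `k`-form is determined by its products with covectors. -/
theorem eq_zero_of_covecWedge_eq_zero [FiniteDimensional ℝ E] {k : ℕ}
    (hk : Module.finrank ℝ E = k + 1) (a : E [⋀^Fin k]→L[ℝ] ℝ)
    (h : ∀ θ : E →L[ℝ] ℝ, covecWedge θ a = 0) : a = 0 := by
  ext u
  have hs : Submodule.span ℝ (range u) < ⊤ := by
    refine lt_top_iff_ne_top.2 fun ht => ?_
    have h1 := finrank_range_le_card (R := ℝ) u
    rw [Set.finrank, ht, finrank_top, hk] at h1
    simp at h1
  obtain ⟨f, hf0, hf⟩ := Submodule.exists_le_ker_of_lt_top _ hs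
  obtain ⟨z, hz⟩ : ∃ z, f z ≠ 0 := by
    by_contra! hc
    exact hf0 (LinearMap.ext hc)
  have hu : ∀ i, f (u i) = 0 := fun i => hf (Submodule.subset_span ⟨i, rfl⟩)
  have h1 := congrArg (fun b => b (Fin.cons z u)) (h (LinearMap.toContinuousLinearMap f))
  simp only [covecWedge_apply, Fin.sum_univ_succ] at h1
  simpa [hu, hz] using h1

theorem curryLeft_eq_covecForm (s : E [⋀^Fin 2]→L[ℝ] ℝ) (w : E) :
    ∃ θ : E →L[ℝ] ℝ, s.curryLeft w = covecForm θ :=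
  ⟨(ContinuousAlternatingMap.ofSubsingleton ℝ E ℝ (0 : Fin 1)).symm (s.curryLeft w),
    (Equiv.apply_symm_apply _ _).symm⟩

/-- The identity `(λ ∧ s ^ k) ∧ i_w s = λ(w) s ^ (k + 1) / (k + 1)` in dimension `2 (k + 1)`; it is
the contraction of `λ ∧ s ^ (k + 1) = 0` with `w`. -/
theorem wedge_wedgePow_curryLeft [FiniteDimensional ℝ E] {k : ℕ}
    (hk : Module.finrank ℝ E = 2 * (k + 1)) (h : 2 * k + 1 + 1 = 2 * (k + 1))
    (h' : 1 + 2 * k = 2 * k + 1) (lam : E →L[ℝ] ℝ) (s : E [⋀^Fin 2]→L[ℝ] ℝ) (w : E) :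
    wedge h (wedge h' (covecForm lam) (wedgePow s k)) (s.curryLeft w) =
      lam w • (((k + 1 : ℕ) : ℝ)⁻¹ • wedgePow s (k + 1)) := by
  obtain ⟨θ, hθ⟩ := curryLeft_eq_covecForm s w
  have h1 := curryLeft_covecWedge (k := 2 * k + 1) lam (wedgePow s (k + 1)) w
  rw [alternating_eq_zero_of_finrank_lt (by omega)
    (covecWedge (k := 2 * k + 1 + 1) lam (wedgePow s (k + 1))), curryLeft_wedgePow s k w θ hθ,
    covecWedge_smul] at h1
  rw [hθ, wedge_covecForm_left]
  refine (wedge_covecForm_right (k := 2 * k + 1) rfl θ _).trans ?_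
  rw [covecWedge_comm]
  ext u
  have h2 := congrArg (fun f => f u) h1
  have h3 : (lam w • wedgePow s (k + 1)) u = ((k : ℝ) + 1) *
      covecWedge lam (covecWedge θ (wedgePow s k)) u := (sub_eq_zero.1 h2.symm)
  have h4 : (lam w • (((k + 1 : ℕ) : ℝ)⁻¹ • wedgePow s (k + 1))) u =
      ((k + 1 : ℕ) : ℝ)⁻¹ * (lam w • wedgePow s (k + 1)) u := by
    simp only [ContinuousAlternatingMap.smul_apply, smul_eq_mul]
    ring
  rw [h4, h3]
  have h5 : (-1 : ℝ) ^ (2 * k + 1) = -1 := Odd.neg_one_pow ⟨k, rfl⟩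
  have h6 : ((k : ℝ) + 1) ≠ 0 := by positivity
  rw [h5]
  push_cast
  rw [inv_mul_cancel_left₀ h6]
  simp

/-- In dimension `k + 1`, a `k`-form `a` is the contraction `i_x μ` as soon as it has the products
`θ ∧ a = θ(x) μ` with covectors. -/
theorem eq_curryLeft_of_covecWedge [FiniteDimensional ℝ E] {k : ℕ}
    (hk : Module.finrank ℝ E = k + 1) (μ : E [⋀^Fin (k + 1)]→L[ℝ] ℝ) (a : E [⋀^Fin k]→L[ℝ] ℝ)
    (x : E) (h : ∀ θ : E →L[ℝ] ℝ, covecWedge θ a = θ x • μ) : a = μ.curryLeft x := by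
  refine sub_eq_zero.1 (eq_zero_of_covecWedge_eq_zero hk _ fun θ => ?_)
  rw [covecWedge_sub, h, covecWedge_curryLeft_top hk, sub_self]

end WedgeAlgebra

/-! ### Calculus of forms on a vector space -/

section FlatCalculus

variable {E : Type*} [NormedAddCommGroup E] [NormedSpace ℝ E]
variable {X : Type*} [NormedAddCommGroup X] [NormedSpace ℝ X]

theorem finBasis_ext_alternating [FiniteDimensional ℝ E] {k : ℕ} {a b : E [⋀^Fin k]→L[ℝ] ℝ}
    (h : ∀ r : Fin k → Fin (Module.finrank ℝ E), a (fun i => Module.finBasis ℝ E (r i)) =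
      b (fun i => Module.finBasis ℝ E (r i))) : a = b := by
  have : a.toMultilinearMap = b.toMultilinearMap :=
    Module.Basis.ext_multilinear (fun _ => Module.finBasis ℝ E) h
  ext u
  exact congrArg (fun f => f u) this

/-- Values of an alternating form on all families of basis vectors. -/
def basisValues [FiniteDimensional ℝ E] (k : ℕ) :
    (E [⋀^Fin k]→L[ℝ] ℝ) →ₗ[ℝ] ((Fin k → Fin (Module.finrank ℝ E)) → ℝ) where
  toFun a r := a fun i => Module.finBasis ℝ E (r i)
  map_add' _ _ := rfl
  map_smul' _ _ := rfl

theorem basisValues_injective [FiniteDimensional ℝ E] (k : ℕ) :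
    Function.Injective (basisValues (E := E) k) := fun _ _ h =>
  finBasis_ext_alternating fun r => congrFun h r

instance finiteDimensional_alternating [FiniteDimensional ℝ E] (k : ℕ) :
    FiniteDimensional ℝ (E [⋀^Fin k]→L[ℝ] ℝ) :=
  FiniteDimensional.of_injective _ (basisValues_injective k)

theorem contDiffOn_alternating_iff [FiniteDimensional ℝ E] {k : ℕ} {m : WithTop ℕ∞}
    {f : X → E [⋀^Fin k]→L[ℝ] ℝ} {s : Set X} :
    ContDiffOn ℝ m f s ↔ ∀ u : Fin k → E, ContDiffOn ℝ m (fun y => f y u) s := by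
  refine ⟨fun h u => ?_, fun h => ?_⟩
  · exact (ContinuousAlternatingMap.apply ℝ E ℝ u).contDiff.comp_contDiffOn h
  · obtain ⟨g, hg⟩ := LinearMap.exists_leftInverse_of_injective (basisValues (E := E) k)
      (LinearMap.ker_eq_bot.2 (basisValues_injective k))
    have h1 : ContDiffOn ℝ m (fun y => basisValues k (f y)) s :=
      contDiffOn_pi.2 fun r => h _
    have h2 := (LinearMap.toContinuousLinearMap g).contDiff.comp_contDiffOn h1
    refine h2.congr fun y _ => ?_
    exact (congrArg (fun l => l (f y)) hg).symm

theorem alternating_apply_eq_sum [FiniteDimensional ℝ E] {k : ℕ} (a : E [⋀^Fin k]→L[ℝ] ℝ)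
    (v : Fin k → E) : a v = ∑ r : Fin k → Fin (Module.finrank ℝ E),
      (∏ i, (Module.finBasis ℝ E).coord (r i) (v i)) * a fun i => Module.finBasis ℝ E (r i) := by
  conv_lhs => rw [show v = fun i => ∑ j, (Module.finBasis ℝ E).coord j (v i) •
    Module.finBasis ℝ E j from funext fun i => ((Module.finBasis ℝ E).sum_repr (v i)).symm]
  have h1 := a.toMultilinearMap.map_sum (fun i j => (Module.finBasis ℝ E).coord j (v i) •
    Module.finBasis ℝ E j)
  refine h1.trans (Finset.sum_congr rfl fun r _ => ?_)
  exact a.toMultilinearMap.map_smul_univ _ _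

theorem ContDiffOn.alternating_apply [FiniteDimensional ℝ E] {k : ℕ} {m : WithTop ℕ∞}
    {f : X → E [⋀^Fin k]→L[ℝ] ℝ} {v : Fin k → X → E} {s : Set X} (hf : ContDiffOn ℝ m f s)
    (hv : ∀ i, ContDiffOn ℝ m (v i) s) : ContDiffOn ℝ m (fun y => f y fun i => v i y) s := by
  simp_rw [fun y => alternating_apply_eq_sum (f y) (fun i => v i y)]
  refine ContDiffOn.sum fun r _ => ContDiffOn.mul (contDiffOn_prod fun i _ => ?_)
    (contDiffOn_alternating_iff.1 hf _)
  exact (LinearMap.toContinuousLinearMap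
    ((Module.finBasis ℝ E).coord (r i))).contDiff.comp_contDiffOn
    (hv i)

theorem ContDiffOn.wedge [FiniteDimensional ℝ E] {k l n : ℕ} (h : k + l = n) {m : WithTop ℕ∞}
    {f : X → E [⋀^Fin k]→L[ℝ] ℝ} {g : X → E [⋀^Fin l]→L[ℝ] ℝ} {s : Set X}
    (hf : ContDiffOn ℝ m f s) (hg : ContDiffOn ℝ m g s) :
    ContDiffOn ℝ m (fun y => _root_.wedge h (f y) (g y)) s := by
  refine contDiffOn_alternating_iff.2 fun u => ?_
  simp_rw [wedge_apply]
  exact contDiffOn_const.mul (ContDiffOn.sum fun σ _ => contDiffOn_const.mul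
    ((contDiffOn_alternating_iff.1 hf _).mul (contDiffOn_alternating_iff.1 hg _)))

theorem ContDiffOn.wedgePow [FiniteDimensional ℝ E] {m : WithTop ℕ∞}
    {f : X → E [⋀^Fin 2]→L[ℝ] ℝ} {s : Set X} (hf : ContDiffOn ℝ m f s) (j : ℕ) :
    ContDiffOn ℝ m (fun y => _root_.wedgePow (f y) j) s := by
  induction j with
  | zero => exact contDiffOn_const
  | succ j ih => exact ih.wedge _ hf

theorem ContDiffOn.curryLeft_apply [FiniteDimensional ℝ E] {k : ℕ} {m : WithTop ℕ∞}
    {f : X → E [⋀^Fin (k + 1)]→L[ℝ] ℝ} {v : X → E} {s : Set X} (hf : ContDiffOn ℝ m f s)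
    (hv : ContDiffOn ℝ m v s) : ContDiffOn ℝ m (fun y => (f y).curryLeft (v y)) s := by
  refine contDiffOn_alternating_iff.2 fun u => ?_
  have : ∀ y, (f y).curryLeft (v y) u =
      f y (fun i => (Fin.cons (v y) u : Fin (k + 1) → E) i) := fun y => rfl
  simp_rw [this]
  refine hf.alternating_apply fun i => ?_
  refine Fin.cases ?_ (fun j => ?_) i
  · simpa using hv
  · simpa using contDiffOn_const

theorem ContDiffOn.extDeriv {k : ℕ} {a : E → E [⋀^Fin k]→L[ℝ] ℝ} {s : Set E} (hs : IsOpen s)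
    (ha : ContDiffOn ℝ ∞ a s) : ContDiffOn ℝ ∞ (_root_.extDeriv a) s :=
  (ContinuousAlternatingMap.alternatizeUncurryFinCLM ℝ E ℝ).contDiff.comp_contDiffOn
    (ha.fderiv_of_isOpen hs (by simp))

theorem extDeriv_fun_mul {k : ℕ} {f : E → ℝ} {a : E → E [⋀^Fin k]→L[ℝ] ℝ} {y : E}
    (hf : DifferentiableAt ℝ f y) (ha : DifferentiableAt ℝ a y) :
    extDeriv (fun z => f z • a z) y = covecWedge (fderiv ℝ f y) (a y) + f y • extDeriv a y := by
  have h : fderiv ℝ (fun z => f z • a z) y =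
      f y • fderiv ℝ a y + (fderiv ℝ f y).smulRight (a y) := fderiv_fun_smul hf ha
  rw [extDeriv, h, ContinuousAlternatingMap.alternatizeUncurryFin_add,
    ContinuousAlternatingMap.alternatizeUncurryFin_smul]
  exact add_comm _ _

open ContinuousAlternatingMap in
/-- The exterior derivative of `θ ∧ b`, for a closed `1`-form `θ`. -/
theorem extDeriv_covecWedge {k : ℕ} {θ : E → E →L[ℝ] ℝ} {b : E → E [⋀^Fin k]→L[ℝ] ℝ} {y : E}
    (hθ : DifferentiableAt ℝ θ y) (hb : DifferentiableAt ℝ b y)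
    (hθ' : ∀ u v, fderiv ℝ θ y u v = fderiv ℝ θ y v u) :
    extDeriv (fun z => covecWedge (θ z) (b z)) y = -covecWedge (θ y) (extDeriv b y) := by
  let B : (E →L[ℝ] ℝ) →L[ℝ] (E [⋀^Fin k]→L[ℝ] ℝ) →L[ℝ] E →L[ℝ] E [⋀^Fin k]→L[ℝ] ℝ :=
    ContinuousLinearMap.smulRightL ℝ E (E [⋀^Fin k]→L[ℝ] ℝ)
  have h0 : HasFDerivAt (fun z => B (θ z) (b z)) _ y :=
    B.hasFDerivAt_of_bilinear hθ.hasFDerivAt hb.hasFDerivAt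
  have h1 := (alternatizeUncurryFinCLM ℝ E ℝ).hasFDerivAt.comp y h0
  have h2 : fderiv ℝ (fun z => covecWedge (θ z) (b z)) y = _ := h1.fderiv
  rw [extDeriv, h2, ContinuousLinearMap.comp_add, alternatizeUncurryFin_add]
  have h3 : alternatizeUncurryFin (alternatizeUncurryFinCLM ℝ E ℝ ∘L
      B.precompL E (fderiv ℝ θ y) (b y)) = 0 := by
    apply alternatizeUncurryFin_alternatizeUncurryFinCLM_comp_of_symmetric
    intro u v
    simp [B, hθ' u v]
  have h4 : alternatizeUncurryFin (alternatizeUncurryFinCLM ℝ E ℝ ∘L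
      (B.precompR E (θ y) (fderiv ℝ b y) + (B.precompR E (θ y) (fderiv ℝ b y)).flip)) = 0 := by
    apply alternatizeUncurryFin_alternatizeUncurryFinCLM_comp_of_symmetric
    intro u v
    simp [add_comm]
  rw [ContinuousLinearMap.comp_add, alternatizeUncurryFin_add] at h4
  have h5 : alternatizeUncurryFin (alternatizeUncurryFinCLM ℝ E ℝ ∘L
      (B.precompR E (θ y) (fderiv ℝ b y)).flip) = covecWedge (θ y) (extDeriv b y) := by
    rw [covecWedge]
    congr 1
    ext u v
    simp [B, alternatizeUncurryFin_apply, extDeriv, Finset.mul_sum, mul_left_comm]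
  rw [h3, add_zero, ← h5]
  exact eq_neg_of_add_eq_zero_left h4

theorem HasFDerivAt.curryLeft_apply {k : ℕ} {a : E → E [⋀^Fin (k + 1)]→L[ℝ] ℝ} {V : E → E} {y : E}
    (ha : DifferentiableAt ℝ a y) (hV : DifferentiableAt ℝ V y) (z : E) (u : Fin k → E) :
    fderiv ℝ (fun x => (a x).curryLeft (V x)) y z u =
      (fderiv ℝ a y z).curryLeft (V y) u + (a y).curryLeft (fderiv ℝ V y z) u := by
  let C : (E [⋀^Fin (k + 1)]→L[ℝ] ℝ) →L[ℝ] E →L[ℝ] E [⋀^Fin k]→L[ℝ] ℝ :=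
    (ContinuousAlternatingMap.curryLeftLI (𝕜 := ℝ) (E := E) (F := ℝ) (n := k)).toContinuousLinearMap
  have h0 : HasFDerivAt (fun x => (C (a x)) (V x)) _ y :=
    C.hasFDerivAt_of_bilinear ha.hasFDerivAt hV.hasFDerivAt
  have h1 : fderiv ℝ (fun x => (a x).curryLeft (V x)) y = _ := h0.fderiv
  rw [h1]
  simp only [_root_.add_apply, ContinuousLinearMap.precompR_apply,
    ContinuousLinearMap.precompL_apply]
  rw [add_comm]
  rfl

end FlatCalculus

/-! ### Cartan's formula on Euclidean space -/

section Cartan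

variable {n : ℕ}

local notation "𝔼" => EuclideanSpace ℝ (Fin n)

open ContinuousAlternatingMap in
/-- Cartan's formula `L_V = d i_V + i_V d`. -/
theorem flatLieDeriv_eq_cartan {k : ℕ} {V : 𝔼 → 𝔼} {a : 𝔼 → 𝔼 [⋀^Fin (k + 1)]→L[ℝ] ℝ} {y : 𝔼}
    (ha : DifferentiableAt ℝ a y) (hV : DifferentiableAt ℝ V y) :
    flatLieDeriv V a y =
      extDeriv (fun z => (a z).curryLeft (V z)) y + (extDeriv a y).curryLeft (V y) := by
  rw [flatLieDeriv_eq ha, fderivCompContinuousLinearMap_eq_alternatizeUncurryFin]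
  ext u
  simp only [ContinuousAlternatingMap.add_apply]
  rw [extDeriv, extDeriv, curryLeft_alternatizeUncurryFin, alternatizeUncurryFin_apply]
  simp only [HasFDerivAt.curryLeft_apply ha hV, smul_add, Finset.sum_add_distrib]
  have : (alternatizeUncurryFinCLM ℝ 𝔼 ℝ ∘L ((compContinuousLinearMapCLM
      (ContinuousLinearMap.id ℝ 𝔼) ∘L (a y).curryLeft).postcomp 𝔼)) (fderiv ℝ V y) u =
      ∑ i : Fin (k + 1), (-1) ^ (i : ℕ) • (a y).curryLeft (fderiv ℝ V y (u i)) (i.removeNth u) := by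
    simp [alternatizeUncurryFin_apply]
  rw [this]
  simp only [zsmul_eq_mul]
  push_cast
  ring

theorem flatLieDeriv_two_apply {V : 𝔼 → 𝔼} {a : 𝔼 → 𝔼 [⋀^Fin 2]→L[ℝ] ℝ} {y : 𝔼}
    (ha : DifferentiableAt ℝ a y) (p q : 𝔼) :
    flatLieDeriv V a y ![p, q] = fderiv ℝ a y (V y) ![p, q] + a y ![fderiv ℝ V y p, q] +
      a y ![p, fderiv ℝ V y q] := by
  rw [flatLieDeriv_eq ha, ContinuousAlternatingMap.add_apply,
    ContinuousAlternatingMap.fderivCompContinuousLinearMap_apply, Fin.sum_univ_two, add_assoc]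
  congr 3
  · ext i; fin_cases i <;> simp
  · ext i; fin_cases i <;> simp

theorem extDeriv_two_apply {a : 𝔼 → 𝔼 [⋀^Fin 2]→L[ℝ] ℝ} {y : 𝔼} (p q r : 𝔼) :
    extDeriv a y ![p, q, r] = fderiv ℝ a y p ![q, r] - fderiv ℝ a y q ![p, r] +
      fderiv ℝ a y r ![p, q] := by
  rw [extDeriv, ContinuousAlternatingMap.alternatizeUncurryFin_apply, Fin.sum_univ_three]
  have h0 : (0 : Fin 3).removeNth ![p, q, r] = ![q, r] := by
    ext i; fin_cases i <;> rfl
  have h1 : (1 : Fin 3).removeNth ![p, q, r] = ![p, r] := by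
    ext i; fin_cases i <;> rfl
  have h2 : (2 : Fin 3).removeNth ![p, q, r] = ![p, q] := by
    ext i; fin_cases i <;> rfl
  rw [h0, h1, h2]
  simp [sub_eq_add_neg]

theorem fderiv_two_apply {V W : 𝔼 → 𝔼} {a : 𝔼 → 𝔼 [⋀^Fin 2]→L[ℝ] ℝ} {y : 𝔼}
    (ha : DifferentiableAt ℝ a y) (hV : DifferentiableAt ℝ V y) (hW : DifferentiableAt ℝ W y)
    (c : 𝔼) : fderiv ℝ (fun z => a z ![V z, W z]) y c = fderiv ℝ a y c ![V y, W y] +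
      a y ![fderiv ℝ V y c, W y] + a y ![V y, fderiv ℝ W y c] := by
  have h := ha.hasFDerivAt.continuousAlternatingMap_apply (g := ![V, W])
    (g' := ![fderiv ℝ V y, fderiv ℝ W y])
    (by intro i; fin_cases i; exacts [hV.hasFDerivAt, hW.hasFDerivAt])
  have e : (fun z => a z ![V z, W z]) = fun z => a z fun i => ![V, W] i z := by
    funext z; congr 1; ext i; fin_cases i <;> rfl
  rw [e, h.fderiv]
  have e2 : (fun i => (![V, W] : Fin 2 → 𝔼 → 𝔼) i y) = ![V y, W y] := by
    ext i; fin_cases i <;> rfl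
  rw [e2]
  have u0 : ∀ p : 𝔼, Function.update ![V y, W y] 0 p = ![p, W y] := fun p => by
    ext i; fin_cases i <;> simp
  have u1 : ∀ p : 𝔼, Function.update ![V y, W y] 1 p = ![V y, p] := fun p => by
    ext i; fin_cases i <;> simp
  rw [Fin.sum_univ_two, add_assoc]
  refine Eq.trans (b := fderiv ℝ a y c ![V y, W y] +
    (a y (Function.update ![V y, W y] 0 (fderiv ℝ V y c)) +
      a y (Function.update ![V y, W y] 1 (fderiv ℝ W y c)))) rfl ?_
  rw [u0, u1]

/-- For fields preserving a closed `2`-form `a`, contraction with the commutator is exact: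
`i_[V,W] a = - d (a(V, W))`. -/
theorem apply_lieBracket_of_flatLieDeriv_eq_zero {V W : 𝔼 → 𝔼} {a : 𝔼 → 𝔼 [⋀^Fin 2]→L[ℝ] ℝ} {y : 𝔼}
    (ha : DifferentiableAt ℝ a y) (hV : DifferentiableAt ℝ V y) (hW : DifferentiableAt ℝ W y)
    (hd : extDeriv a y = 0) (hVa : flatLieDeriv V a y = 0) (hWa : flatLieDeriv W a y = 0) (c : 𝔼) :
    a y ![VectorField.lieBracket ℝ V W y, c] = -fderiv ℝ (fun z => a z ![V z, W z]) y c := by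
  have h1 : extDeriv a y ![V y, W y, c] = 0 := by rw [hd]; rfl
  have h2 : flatLieDeriv V a y ![W y, c] = 0 := by rw [hVa]; rfl
  have h3 : flatLieDeriv W a y ![V y, c] = 0 := by rw [hWa]; rfl
  rw [extDeriv_two_apply] at h1
  rw [flatLieDeriv_two_apply ha] at h2 h3
  rw [fderiv_two_apply ha hV hW, VectorField.lieBracket]
  have h4 : a y ![fderiv ℝ W y (V y) - fderiv ℝ V y (W y), c] =
      a y ![fderiv ℝ W y (V y), c] - a y ![fderiv ℝ V y (W y), c] :=
    a y |>.map_vecCons_sub _ _ _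
  have swap : ∀ p q, a y ![p, q] = -a y ![q, p] := by
    intro p q
    have := (a y).toAlternatingMap.map_swap ![q, p] (i := 0) (j := 1) (by simp)
    rw [show ![q, p] ∘ Equiv.swap (0 : Fin 2) 1 = ![p, q] by
      ext i; fin_cases i <;> simp] at this
    exact this
  rw [h4]
  have h5 := swap (W y) (fderiv ℝ V y c)
  linear_combination h3 - h2 + h1 + h5

end Cartan

/-! ### Parametric integrals -/

section ParametricIntegrals

open MeasureTheory

/-- Differentiation under the integral sign over a compact set. -/
theorem hasDerivAt_setIntegral_of_continuousOn {Y : Type*} [TopologicalSpace Y] [T2Space Y]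
    [MeasurableSpace Y] [OpensMeasurableSpace Y] {μ : Measure Y} [IsFiniteMeasureOnCompacts μ]
    {K : Set Y} (hK : IsCompact K) {H H' : ℝ → Y → ℝ} {t₀ : ℝ} {U : Set ℝ} (hU : U ∈ 𝓝 t₀)
    (hH : ∀ t ∈ U, ContinuousOn (H t) K) (hH' : ContinuousOn (Function.uncurry H') (U ×ˢ K))
    (hd : ∀ t ∈ U, ∀ y ∈ K, HasDerivAt (fun s => H s y) (H' t y) t) :
    HasDerivAt (fun t => ∫ y in K, H t y ∂μ) (∫ y in K, H' t₀ y ∂μ) t₀ := by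
  obtain ⟨ε, hε, hεU⟩ := Metric.nhds_basis_closedBall.mem_iff.1 hU
  have ht₀ : t₀ ∈ U := mem_of_mem_nhds hU
  obtain ⟨C, hC⟩ := ((isCompact_closedBall t₀ ε).prod hK).exists_bound_of_continuousOn
    (hH'.mono (prod_mono_left hεU))
  have hsec : ∀ t ∈ U, ContinuousOn (H' t) K := fun t ht =>
    hH'.comp (Continuous.prodMk_right t).continuousOn fun y hy => ⟨ht, hy⟩
  refine (hasDerivAt_integral_of_dominated_loc_of_deriv_le (bound := fun _ => C)
    (s := Metric.closedBall t₀ ε) (Metric.closedBall_mem_nhds t₀ hε) ?_ ?_ ?_ ?_ ?_ ?_).2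
  · filter_upwards [Metric.closedBall_mem_nhds t₀ hε] with t ht
    exact (hH t (hεU ht)).aestronglyMeasurable_of_isCompact hK hK.measurableSet
  · exact (hH t₀ ht₀).integrableOn_compact hK
  · exact (hsec t₀ ht₀).aestronglyMeasurable_of_isCompact hK hK.measurableSet
  · filter_upwards [ae_restrict_mem hK.measurableSet] with y hy t ht
    exact hC (t, y) ⟨ht, hy⟩
  · exact continuousOn_const.integrableOn_compact hK
  · filter_upwards [ae_restrict_mem hK.measurableSet] with y hy t ht
    exact hd t (hεU ht) y hy

theorem hasDerivAt_intervalIntegral_param {H H' : ℝ → ℝ → ℝ} {t₀ : ℝ} (a b : ℝ)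
    (hH : ∀ t, Continuous (H t)) (hH' : Continuous (Function.uncurry H'))
    (hd : ∀ t s, HasDerivAt (fun t => H t s) (H' t s) t) :
    HasDerivAt (fun t => ∫ s in a..b, H t s) (∫ s in a..b, H' t₀ s) t₀ := by
  have key : ∀ a b : ℝ, a ≤ b →
      HasDerivAt (fun t => ∫ s in a..b, H t s) (∫ s in a..b, H' t₀ s) t₀ := by
    intro a b hab
    simp only [intervalIntegral.integral_of_le hab, ← integral_Icc_eq_integral_Ioc]
    exact hasDerivAt_setIntegral_of_continuousOn isCompact_Icc Filter.univ_mem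
      (fun t _ => (hH t).continuousOn) hH'.continuousOn fun t _ s _ => hd t s
  rcases le_total a b with hab | hab
  · exact key a b hab
  · simp only [intervalIntegral.integral_symm b a]
    exact (key b a hab).neg

/-- The integral over an interval of a smooth function is smooth in the parameter. -/
theorem contDiff_intervalIntegral_param {P : Type*} [NormedAddCommGroup P] [NormedSpace ℝ P]
    {H : P × ℝ → ℝ} (hH : ContDiff ℝ ∞ H) :
    ContDiff ℝ ∞ fun p => ∫ t in (0 : ℝ)..1, H (p, t) := by
  let χ : ContDiffBump (0 : ℝ) := ⟨2, 3, by norm_num, by norm_num⟩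
  have h1 := contDiffOn_convolution_right_with_param_comp (n := ⊤) (μ := volume)
    (ContinuousLinearMap.mul ℝ ℝ) (s := (univ : Set P)) (v := fun _ => (0 : ℝ)) contDiffOn_const
    (f := (Ioc (0 : ℝ) 1).indicator 1) (g := fun p x => χ x * H (p, -x))
    (k := Metric.closedBall 0 3) isOpen_univ (isCompact_closedBall 0 3)
    (fun p x _ hx => by
      have : χ x = 0 := χ.zero_of_le_dist (by
        rw [Metric.mem_closedBall] at hx
        exact (not_le.1 hx).le)
      simp [this])
    (((integrable_indicator_iff measurableSet_Ioc).2
      (continuous_const.integrableOn_Ioc :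
        IntegrableOn (fun _ : ℝ => (1 : ℝ)) (Ioc 0 1) volume)).locallyIntegrable)
    (ContDiff.contDiffOn (by
      change ContDiff ℝ ∞ fun q : P × ℝ => χ q.2 * H (q.1, -q.2)
      exact (χ.contDiff.comp contDiff_snd).mul
        (hH.comp (contDiff_fst.prodMk contDiff_snd.neg))))
  rw [contDiffOn_univ] at h1
  convert h1 using 2 with p
  rw [intervalIntegral.integral_of_le zero_le_one, ← integral_indicator measurableSet_Ioc]
  refine integral_congr_ae (Filter.Eventually.of_forall fun t => ?_)
  by_cases ht : t ∈ Ioc (0 : ℝ) 1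
  · have : χ (-t) = 1 := χ.one_of_mem_closedBall (by
      rw [Metric.mem_closedBall, dist_zero_right, norm_neg, Real.norm_eq_abs, abs_of_pos ht.1]
      exact ht.2.trans (by norm_num))
    simp [ht, this]
  · simp [ht]

theorem integral_fderiv_eq_zero {E : Type*} [NormedAddCommGroup E] [NormedSpace ℝ E]
    [MeasurableSpace E] [BorelSpace E] [FiniteDimensional ℝ E] {μ : Measure E}
    [μ.IsAddHaarMeasure] {f : E → ℝ} (hf : ContDiff ℝ ∞ f) (hc : HasCompactSupport f) (v : E) :
    ∫ y, fderiv ℝ f y v ∂μ = 0 := by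
  have hcont : Continuous fun y => fderiv ℝ f y v :=
    (hf.continuous_fderiv (by simp)).clm_apply continuous_const
  have h := integral_smul_fderiv_eq_neg_fderiv_smul_of_integrable (𝕜 := ℝ) (μ := μ)
    (f := fun _ : E => (1 : ℝ)) (g := f) (v := v) (by simp)
    (by simpa using hcont.integrable_of_hasCompactSupport (hc.fderiv_apply ℝ v))
    (by simpa using hf.continuous.integrable_of_hasCompactSupport hc)
    (fun _ _ => differentiableAt_const _) (fun y _ => hf.differentiable (by simp) y)
  simpa using h

end ParametricIntegrals

/-! ### Integration along coordinates in a cube -/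

section Cube

open MeasureTheory

variable {n : ℕ}

local notation "𝔼" => EuclideanSpace ℝ (Fin n)

/-- The standard basis vectors of Euclidean space. -/
abbrev stdVec (i : Fin n) : 𝔼 := EuclideanSpace.single i (1 : ℝ)

/-- Replace the `i`-th coordinate of `y` by `s`. -/
def slide (i : Fin n) (y : 𝔼) (s : ℝ) : 𝔼 := y + (s - y i) • stdVec i

/-- Closed cubes. -/
def cube (c : 𝔼) (r : ℝ) : Set 𝔼 := {y | ∀ j, |y j - c j| ≤ r}

/-- Smooth functions vanishing outside the cube. -/
def CubeSmooth (c : 𝔼) (r : ℝ) (f : 𝔼 → ℝ) : Prop := ContDiff ℝ ∞ f ∧ ∀ y ∉ cube c r, f y = 0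

/-- Partial derivatives. -/
def pderiv (i : Fin n) (f : 𝔼 → ℝ) (y : 𝔼) : ℝ := fderiv ℝ f y (stdVec i)

theorem slide_apply_self (i : Fin n) (y : 𝔼) (s : ℝ) : slide i y s i = s := by
  simp [slide]

theorem slide_apply_of_ne {i j : Fin n} (h : j ≠ i) (y : 𝔼) (s : ℝ) : slide i y s j = y j := by
  simp [slide, h]

theorem slide_self (i : Fin n) (y : 𝔼) : slide i y (y i) = y := by simp [slide]

theorem slide_add_self (i : Fin n) (y : 𝔼) (s t : ℝ) :
    slide i (y + t • stdVec i) s = slide i y s := by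
  ext j
  by_cases h : j = i
  · subst h; simp [slide_apply_self]
  · simp [slide_apply_of_ne h, h]

theorem slide_add_of_ne {i j : Fin n} (h : j ≠ i) (y : 𝔼) (s t : ℝ) :
    slide i (y + t • stdVec j) s = slide i y s + t • stdVec j := by
  ext l
  by_cases hl : l = i
  · subst hl; simp [slide_apply_self, h.symm]
  · simp [slide_apply_of_ne hl]

theorem contDiff_slide (i : Fin n) : ContDiff ℝ ∞ fun p : 𝔼 × ℝ => slide i p.1 p.2 :=
  contDiff_fst.add ((contDiff_snd.sub
    ((EuclideanSpace.proj (𝕜 := ℝ) i).contDiff.comp contDiff_fst)).smul contDiff_const)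

theorem continuous_slide (i : Fin n) (y : 𝔼) : Continuous (slide i y) :=
  (contDiff_slide i).continuous.comp (Continuous.prodMk_right y)

theorem contDiff_coord (i : Fin n) : ContDiff ℝ ∞ fun y : 𝔼 => y i :=
  (EuclideanSpace.proj (𝕜 := ℝ) i).contDiff

theorem isClosed_cube (c : 𝔼) (r : ℝ) : IsClosed (cube c r) := by
  have : cube c r = ⋂ j, {y | |y j - c j| ≤ r} := by ext; simp [cube]
  rw [this]
  exact isClosed_iInter fun j => isClosed_le
    (((contDiff_coord j).continuous.sub continuous_const).abs) continuous_const

theorem isCompact_cube (c : 𝔼) (r : ℝ) : IsCompact (cube c r) := by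
  refine Metric.isCompact_of_isClosed_isBounded (isClosed_cube c r) ?_
  have h1 : Bornology.IsBounded ((EuclideanSpace.equiv (Fin n) ℝ) ⁻¹'
      (univ.pi fun j => Metric.closedBall (c j) r)) := by
    refine ((isCompact_univ_pi fun j => isCompact_closedBall (c j) r).isBounded.image
      ((EuclideanSpace.equiv (Fin n) ℝ).symm : (Fin n → ℝ) →L[ℝ] 𝔼)).subset ?_
    intro y hy
    exact ⟨EuclideanSpace.equiv (Fin n) ℝ y, hy, by simp⟩
  refine h1.subset fun y hy j _ => ?_
  simpa [Real.dist_eq] using hy j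

/-- The primitive of `f` in the direction of the `i`-th coordinate, from the hyperplane
`y i = a`. -/
def primAlong (i : Fin n) (a : ℝ) (f : 𝔼 → ℝ) (y : 𝔼) : ℝ := ∫ s in a..y i, f (slide i y s)

/-- The integral of `f` over segments in the direction of the `i`-th coordinate. -/
def massAlong (i : Fin n) (a b : ℝ) (f : 𝔼 → ℝ) (y : 𝔼) : ℝ := ∫ s in a..b, f (slide i y s)

theorem intervalIntegral_eq_unit (g : ℝ → ℝ) (a x : ℝ) :
    ∫ s in a..x, g s = (x - a) * ∫ t in (0 : ℝ)..1, g ((x - a) * t + a) := by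
  rw [intervalIntegral.mul_integral_comp_mul_add]
  simp

theorem contDiff_primAlong (i : Fin n) (a : ℝ) {f : 𝔼 → ℝ} (hf : ContDiff ℝ ∞ f) :
    ContDiff ℝ ∞ (primAlong i a f) := by
  have h : primAlong i a f = fun y => (y i - a) * ∫ t in (0 : ℝ)..1,
      f (slide i y ((y i - a) * t + a)) := funext fun y => intervalIntegral_eq_unit _ _ _
  rw [h]
  have hi : ContDiff ℝ ∞ fun p : 𝔼 × ℝ => p.1 i := (contDiff_coord i).comp contDiff_fst
  exact ((contDiff_coord i).sub contDiff_const).mul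
    (contDiff_intervalIntegral_param (H := fun p : 𝔼 × ℝ => f (slide i p.1 ((p.1 i - a) * p.2 + a)))
      (hf.comp ((contDiff_slide i).comp (contDiff_fst.prodMk
        (((hi.sub contDiff_const).mul contDiff_snd).add contDiff_const)))))

theorem contDiff_massAlong (i : Fin n) (a b : ℝ) {f : 𝔼 → ℝ} (hf : ContDiff ℝ ∞ f) :
    ContDiff ℝ ∞ (massAlong i a b f) := by
  have h : massAlong i a b f = fun y => (b - a) * ∫ t in (0 : ℝ)..1,
      f (slide i y ((b - a) * t + a)) := funext fun y => intervalIntegral_eq_unit _ _ _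
  rw [h]
  exact contDiff_const.mul
    (contDiff_intervalIntegral_param (H := fun p : 𝔼 × ℝ => f (slide i p.1 ((b - a) * p.2 + a)))
      (hf.comp ((contDiff_slide i).comp (contDiff_fst.prodMk
        ((contDiff_const.mul contDiff_snd).add contDiff_const)))))

theorem pderiv_eq_of_hasDerivAt {i : Fin n} {f : 𝔼 → ℝ} {y : 𝔼} {d : ℝ} (hf : ContDiff ℝ ∞ f)
    (h : HasDerivAt (fun t : ℝ => f (y + t • stdVec i)) d 0) : pderiv i f y = d := by
  have h1 : lineDeriv ℝ f y (stdVec i) = d := h.deriv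
  rw [← h1]
  exact ((hf.differentiable (by simp) y).lineDeriv_eq_fderiv).symm

theorem hasDerivAt_line {f : 𝔼 → ℝ} (hf : ContDiff ℝ ∞ f) (i : Fin n) (y : 𝔼) (t : ℝ) :
    HasDerivAt (fun t : ℝ => f (y + t • stdVec i)) (pderiv i f (y + t • stdVec i)) t := by
  have h1 : HasDerivAt (fun t : ℝ => y + t • stdVec i) (stdVec i) t := by
    simpa using ((hasDerivAt_id t).smul_const (stdVec i)).const_add y
  exact ((hf.differentiable (by simp) _).hasFDerivAt).comp_hasDerivAt t h1

theorem contDiff_pderiv (i : Fin n) {f : 𝔼 → ℝ} (hf : ContDiff ℝ ∞ f) :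
    ContDiff ℝ ∞ (pderiv i f) :=
  (hf.fderiv_right (m := ∞) (by simp)).clm_apply contDiff_const

theorem continuous_comp_slide {f : 𝔼 → ℝ} (hf : ContDiff ℝ ∞ f) (i : Fin n) (y : 𝔼) :
    Continuous fun s => f (slide i y s) := hf.continuous.comp (continuous_slide i y)

theorem pderiv_primAlong_self (i : Fin n) (a : ℝ) {f : 𝔼 → ℝ} (hf : ContDiff ℝ ∞ f) (y : 𝔼) :
    pderiv i (primAlong i a f) y = f y := by
  refine pderiv_eq_of_hasDerivAt (contDiff_primAlong i a hf) ?_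
  have h1 : (fun t : ℝ => primAlong i a f (y + t • stdVec i)) =
      fun t : ℝ => ∫ s in a..(y i + t), f (slide i y s) := by
    funext t
    simp [primAlong, slide_add_self]
  rw [h1]
  have hc := continuous_comp_slide hf i y
  have h2 := intervalIntegral.integral_hasDerivAt_right (hc.intervalIntegrable a (y i + 0))
    (hc.stronglyMeasurableAtFilter _ _) hc.continuousAt
  have h3 := h2.comp_const_add (y i) 0
  simpa [slide_self] using h3

theorem pderiv_line_slide {f : 𝔼 → ℝ} (hf : ContDiff ℝ ∞ f) {i j : Fin n} (h : j ≠ i) (y : 𝔼)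
    (a b : ℝ) : HasDerivAt (fun t : ℝ => ∫ s in a..b, f (slide i (y + t • stdVec j) s))
      (∫ s in a..b, pderiv j f (slide i y s)) 0 := by
  simp_rw [slide_add_of_ne h]
  have h1 := hasDerivAt_intervalIntegral_param (t₀ := 0)
    (H := fun t s => f (slide i y s + t • stdVec j))
    (H' := fun t s => pderiv j f (slide i y s + t • stdVec j)) a b
    (fun t => hf.continuous.comp ((continuous_slide i y).add continuous_const))
    ((contDiff_pderiv j hf).continuous.comp
      (((continuous_slide i y).comp continuous_snd).add (continuous_fst.smul continuous_const)))
    (fun t s => hasDerivAt_line hf j _ t)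
  simpa using h1

theorem pderiv_primAlong_of_ne {i j : Fin n} (h : j ≠ i) (a : ℝ) {f : 𝔼 → ℝ} (hf : ContDiff ℝ ∞ f)
    (y : 𝔼) : pderiv j (primAlong i a f) y = primAlong i a (pderiv j f) y := by
  refine pderiv_eq_of_hasDerivAt (contDiff_primAlong i a hf) ?_
  have h1 : (fun t : ℝ => primAlong i a f (y + t • stdVec j)) =
      fun t : ℝ => ∫ s in a..y i, f (slide i (y + t • stdVec j) s) := by
    funext t
    simp [primAlong, h.symm]
  rw [h1]
  exact pderiv_line_slide hf h y a (y i)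

theorem pderiv_massAlong_of_ne {i j : Fin n} (h : j ≠ i) (a b : ℝ) {f : 𝔼 → ℝ}
    (hf : ContDiff ℝ ∞ f) (y : 𝔼) :
    pderiv j (massAlong i a b f) y = massAlong i a b (pderiv j f) y :=
  pderiv_eq_of_hasDerivAt (contDiff_massAlong i a b hf) (pderiv_line_slide hf h y a b)

theorem pderiv_massAlong_self (i : Fin n) (a b : ℝ) {f : 𝔼 → ℝ}
    (hf : ContDiff ℝ ∞ f) (y : 𝔼) : pderiv i (massAlong i a b f) y = 0 := by
  refine pderiv_eq_of_hasDerivAt (contDiff_massAlong i a b hf) ?_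
  simp only [massAlong, slide_add_self]
  exact hasDerivAt_const _ _

theorem hasDerivAt_slide {f : 𝔼 → ℝ} (hf : ContDiff ℝ ∞ f) (i : Fin n) (y : 𝔼) (s : ℝ) :
    HasDerivAt (fun s => f (slide i y s)) (pderiv i f (slide i y s)) s := by
  have h1 : HasDerivAt (fun s : ℝ => slide i y s) (stdVec i) s := by
    unfold slide
    simpa using! (((hasDerivAt_id s).sub_const (y i)).smul_const (stdVec i)).const_add y
  exact ((hf.differentiable (by simp) _).hasFDerivAt).comp_hasDerivAt s h1

theorem integral_slide_pderiv {f : 𝔼 → ℝ} (hf : ContDiff ℝ ∞ f) (i : Fin n) (y : 𝔼) (a b : ℝ) :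
    ∫ s in a..b, pderiv i f (slide i y s) = f (slide i y b) - f (slide i y a) :=
  intervalIntegral.integral_eq_sub_of_hasDerivAt (fun s _ => hasDerivAt_slide hf i y s)
    ((continuous_comp_slide (contDiff_pderiv i hf) i y).intervalIntegrable _ _)

/-- A smooth function of mass one supported in the `r`-neighbourhood of `c`. -/
def unitBump (c : ℝ) {r : ℝ} (hr : 0 < r) : ℝ → ℝ :=
  (⟨r / 2, r, by positivity, by linarith⟩ : ContDiffBump c).normed volume

theorem contDiff_unitBump (c : ℝ) {r : ℝ} (hr : 0 < r) : ContDiff ℝ ∞ (unitBump c hr) :=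
  ContDiffBump.contDiff_normed _

theorem unitBump_nonneg (c : ℝ) {r : ℝ} (hr : 0 < r) (s : ℝ) : 0 ≤ unitBump c hr s :=
  ContDiffBump.nonneg_normed _ _

theorem unitBump_pos (c : ℝ) {r : ℝ} (hr : 0 < r) : 0 < unitBump c hr c :=
  div_pos (ContDiffBump.pos_of_mem_ball _ (by simpa using hr)) (ContDiffBump.integral_pos _)

theorem unitBump_eq_zero {c : ℝ} {r : ℝ} (hr : 0 < r) {s : ℝ} (hs : r ≤ |s - c|) :
    unitBump c hr s = 0 := by
  have h := ContDiffBump.support_normed_eq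
    (⟨r / 2, r, by positivity, by linarith⟩ : ContDiffBump c) (μ := volume)
  by_contra hne
  have : s ∈ Metric.ball c r := by rw [← h]; exact hne
  rw [Metric.mem_ball, Real.dist_eq] at this
  linarith

theorem integral_unitBump (c : ℝ) {r : ℝ} (hr : 0 < r) {a b : ℝ} (ha : a ≤ c - r) (hb : c + r ≤ b) :
    ∫ s in a..b, unitBump c hr s = 1 := by
  rw [intervalIntegral.integral_of_le (by linarith),
    setIntegral_eq_integral_of_forall_compl_eq_zero]
  · exact ContDiffBump.integral_normed _
  · intro s hs
    refine unitBump_eq_zero hr ?_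
    rcases le_or_gt s a with h | h
    · rw [abs_of_nonpos (by linarith)]; linarith
    · have : b < s := by by_contra hh; exact hs ⟨h, not_lt.1 hh⟩
      rw [abs_of_nonneg (by linarith)]; linarith

variable {c : EuclideanSpace ℝ (Fin n)} {r : ℝ}

/-- The projection of the homotopy formula in the direction of the `i`-th coordinate: the integral
along that direction, concentrated again by a bump function. -/
def smearAlong (c : 𝔼) (hr : 0 < r) (i : Fin n) (f : 𝔼 → ℝ) (y : 𝔼) : ℝ :=
  unitBump (c i) hr (y i) * massAlong i (c i - r) (c i + r) f y

/-- The homotopy operator in the direction of the `i`-th coordinate; it preserves smooth functions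
supported in the cube. -/
def homotopyAlong (c : 𝔼) (hr : 0 < r) (i : Fin n) (f : 𝔼 → ℝ) (y : 𝔼) : ℝ :=
  primAlong i (c i - r) f y -
    (∫ s in (c i - r)..y i, unitBump (c i) hr s) * massAlong i (c i - r) (c i + r) f y

theorem CubeSmooth.slide_eq_zero {f : 𝔼 → ℝ} (hf : CubeSmooth c r f) {i j : Fin n} (h : j ≠ i)
    {y : 𝔼} (hy : r < |y j - c j|) (s : ℝ) : f (slide i y s) = 0 :=
  hf.2 _ fun hm => by
    have := hm j
    rw [slide_apply_of_ne h] at this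
    linarith

theorem CubeSmooth.slide_eq_zero_self {f : 𝔼 → ℝ} (hf : CubeSmooth c r f) {i : Fin n}
    {y : 𝔼} {s : ℝ} (hs : r < |s - c i|) : f (slide i y s) = 0 :=
  hf.2 _ fun hm => by
    have := hm i
    rw [slide_apply_self] at this
    linarith

theorem CubeSmooth.massAlong_eq_zero {f : 𝔼 → ℝ} (hf : CubeSmooth c r f) {i j : Fin n} (h : j ≠ i)
    {y : 𝔼} (hy : r < |y j - c j|) (a b : ℝ) : massAlong i a b f y = 0 := by
  simp [massAlong, hf.slide_eq_zero h hy]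

theorem CubeSmooth.smearAlong (hr : 0 < r) (i : Fin n) {f : 𝔼 → ℝ} (hf : CubeSmooth c r f) :
    CubeSmooth c r (smearAlong c hr i f) := by
  refine ⟨((contDiff_unitBump _ hr).comp (contDiff_coord i)).mul (contDiff_massAlong i _ _ hf.1),
    fun y hy => ?_⟩
  obtain ⟨j, hj⟩ : ∃ j, r < |y j - c j| := by simpa [cube] using hy
  by_cases h : j = i
  · subst h
    simp [_root_.smearAlong, unitBump_eq_zero hr hj.le]
  · simp [_root_.smearAlong, hf.massAlong_eq_zero h hj]

theorem bumpPrim_eq (hr : 0 < r) (i : Fin n) :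
    (fun y : 𝔼 => ∫ s in (c i - r)..y i, unitBump (c i) hr s) =
      primAlong i (c i - r) fun y => unitBump (c i) hr (y i) :=
  funext fun y => by simp [primAlong, slide_apply_self]

theorem contDiff_unitBump_coord (hr : 0 < r) (i : Fin n) :
    ContDiff ℝ ∞ fun y : 𝔼 => unitBump (c i) hr (y i) :=
  (contDiff_unitBump (c i) hr).comp (contDiff_coord i)

theorem contDiff_bumpPrim (hr : 0 < r) (i : Fin n) :
    ContDiff ℝ ∞ fun y : 𝔼 => ∫ s in (c i - r)..y i, unitBump (c i) hr s := by
  rw [bumpPrim_eq]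
  exact contDiff_primAlong i (c i - r) (contDiff_unitBump_coord hr i)

theorem CubeSmooth.homotopyAlong (hr : 0 < r) (i : Fin n) {f : 𝔼 → ℝ} (hf : CubeSmooth c r f) :
    CubeSmooth c r (homotopyAlong c hr i f) := by
  refine ⟨(contDiff_primAlong i _ hf.1).sub (ContDiff.mul ?_ (contDiff_massAlong i _ _ hf.1)),
    fun y hy => ?_⟩
  · exact contDiff_bumpPrim hr i
  obtain ⟨j, hj⟩ : ∃ j, r < |y j - c j| := by simpa [cube] using hy
  by_cases h : j = i
  · subst h
    -- above the upper face the integrals of `f` and of the bump are complete and cancel; below the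
    -- lower face both vanish
    rcases lt_abs.1 hj with h1 | h1
    · have h2 : primAlong j (c j - r) f y = massAlong j (c j - r) (c j + r) f y := by
        have hc := continuous_comp_slide hf.1 j y
        rw [primAlong, massAlong, ← intervalIntegral.integral_add_adjacent_intervals
          (hc.intervalIntegrable (c j - r) (c j + r)) (hc.intervalIntegrable (c j + r) (y j))]
        rw [intervalIntegral.integral_congr_ae (g := fun _ => (0 : ℝ)) (a := c j + r)]
        · simp
        · refine Filter.Eventually.of_forall fun s hs => hf.slide_eq_zero_self ?_
          rw [uIoc_of_le (by linarith)] at hs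
          rw [abs_of_nonneg (by linarith [hs.1])]
          linarith [hs.1]
      rw [_root_.homotopyAlong, h2, integral_unitBump (c j) hr le_rfl (by linarith)]
      ring
    · have h2 : primAlong j (c j - r) f y = 0 := by
        rw [primAlong, intervalIntegral.integral_congr_ae (g := fun _ => (0 : ℝ))]
        · simp
        · refine (ae_iff.2 (measure_mono_null (t := {c j - r}) ?_ (by simp)))
          intro s hs
          simp only [Set.mem_ofPred_eq, Classical.not_imp] at hs
          obtain ⟨hs1, hs2⟩ := hs
          rw [uIoc_of_ge (by linarith)] at hs1
          by_contra hne
          have : s < c j - r := lt_of_le_of_ne hs1.2 hne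
          refine hs2 (hf.slide_eq_zero_self ?_)
          rw [abs_of_nonpos (by linarith)]
          linarith
      have h3 : ∫ s in (c j - r)..y j, unitBump (c j) hr s = 0 := by
        rw [intervalIntegral.integral_congr (g := fun _ => (0 : ℝ))]
        · simp
        · intro s hs
          rw [uIcc_of_ge (by linarith)] at hs
          refine unitBump_eq_zero hr ?_
          rw [abs_of_nonpos (by linarith [hs.2])]
          linarith [hs.2]
      rw [_root_.homotopyAlong, h2, h3]
      ring
  · have h2 : primAlong i (c i - r) f y = 0 := by
      simp [primAlong, hf.slide_eq_zero h hj]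
    rw [_root_.homotopyAlong, h2, hf.massAlong_eq_zero h hj]
    ring

theorem pderiv_sub {i : Fin n} {f g : 𝔼 → ℝ} (hf : ContDiff ℝ ∞ f) (hg : ContDiff ℝ ∞ g) (y : 𝔼) :
    pderiv i (fun y => f y - g y) y = pderiv i f y - pderiv i g y := by
  rw [pderiv, fderiv_fun_sub (hf.differentiable (by simp) y) (hg.differentiable (by simp) y)]
  rfl

theorem pderiv_mul {i : Fin n} {f g : 𝔼 → ℝ} (hf : ContDiff ℝ ∞ f) (hg : ContDiff ℝ ∞ g) (y : 𝔼) :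
    pderiv i (fun y => f y * g y) y = f y * pderiv i g y + pderiv i f y * g y := by
  rw [pderiv, fderiv_fun_mul (hf.differentiable (by simp) y) (hg.differentiable (by simp) y)]
  simp [pderiv, mul_comm]

theorem pderiv_add {i : Fin n} {f g : 𝔼 → ℝ} (hf : ContDiff ℝ ∞ f) (hg : ContDiff ℝ ∞ g) (y : 𝔼) :
    pderiv i (fun y => f y + g y) y = pderiv i f y + pderiv i g y := by
  rw [pderiv, fderiv_fun_add (hf.differentiable (by simp) y) (hg.differentiable (by simp) y)]
  rfl

theorem pderiv_comp_coord_of_ne {i j : Fin n} (h : j ≠ i) {g : ℝ → ℝ}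
    (hg : ContDiff ℝ ∞ fun y : 𝔼 => g (y i)) (y : 𝔼) : pderiv j (fun y : 𝔼 => g (y i)) y = 0 := by
  refine pderiv_eq_of_hasDerivAt hg ?_
  simp only [PiLp.add_apply, PiLp.smul_apply, PiLp.single_apply, h.symm, if_false,
    smul_zero, add_zero]
  exact hasDerivAt_const _ _

theorem pderiv_homotopyAlong_self (hr : 0 < r) (i : Fin n) {f : 𝔼 → ℝ} (hf : CubeSmooth c r f)
    (y : 𝔼) : pderiv i (homotopyAlong c hr i f) y = f y - smearAlong c hr i f y := by
  have h1 := pderiv_sub (i := i) (contDiff_primAlong i (c i - r) hf.1)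
    ((contDiff_bumpPrim (c := c) hr i).mul (contDiff_massAlong i (c i - r) (c i + r) hf.1)) y
  have h2 := pderiv_mul (i := i) (contDiff_bumpPrim (c := c) hr i)
    (contDiff_massAlong i (c i - r) (c i + r) hf.1) y
  have h3 : pderiv i (fun y : 𝔼 => ∫ s in (c i - r)..y i, unitBump (c i) hr s) y =
      unitBump (c i) hr (y i) := by
    rw [bumpPrim_eq, pderiv_primAlong_self i (c i - r) (contDiff_unitBump_coord hr i)]
  refine h1.trans ?_
  rw [h2, pderiv_primAlong_self i _ hf.1, pderiv_massAlong_self i _ _ hf.1, h3, smearAlong]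
  ring

theorem pderiv_homotopyAlong_of_ne (hr : 0 < r) {i j : Fin n} (h : j ≠ i) {f : 𝔼 → ℝ}
    (hf : CubeSmooth c r f) (y : 𝔼) :
    pderiv j (homotopyAlong c hr i f) y = homotopyAlong c hr i (pderiv j f) y := by
  have h1 := pderiv_sub (i := j) (contDiff_primAlong i (c i - r) hf.1)
    ((contDiff_bumpPrim (c := c) hr i).mul (contDiff_massAlong i (c i - r) (c i + r) hf.1)) y
  have h2 := pderiv_mul (i := j) (contDiff_bumpPrim (c := c) hr i)
    (contDiff_massAlong i (c i - r) (c i + r) hf.1) y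
  refine h1.trans ?_
  rw [h2, pderiv_primAlong_of_ne h _ hf.1, pderiv_massAlong_of_ne h _ _ hf.1,
    pderiv_comp_coord_of_ne h (g := fun x => ∫ s in (c i - r)..x, unitBump (c i) hr s)
      (contDiff_bumpPrim hr i), homotopyAlong]
  ring

theorem pderiv_smearAlong_of_ne (hr : 0 < r) {i j : Fin n} (h : j ≠ i) {f : 𝔼 → ℝ}
    (hf : CubeSmooth c r f) (y : 𝔼) :
    pderiv j (smearAlong c hr i f) y = smearAlong c hr i (pderiv j f) y := by
  have hb : ContDiff ℝ ∞ fun y : 𝔼 => unitBump (c i) hr (y i) :=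
    (contDiff_unitBump (c i) hr).comp (contDiff_coord i)
  refine (pderiv_mul (i := j) hb (contDiff_massAlong i (c i - r) (c i + r) hf.1) y).trans ?_
  rw [pderiv_massAlong_of_ne h _ _ hf.1, pderiv_comp_coord_of_ne h hb, smearAlong]
  ring

/-- A function supported in the closed cube vanishes on its boundary, by continuity. -/
theorem CubeSmooth.slide_boundary {f : 𝔼 → ℝ} (hf : CubeSmooth c r f) (i : Fin n) (y : 𝔼) {s : ℝ}
    (hs : |s - c i| = r) : f (slide i y s) = 0 := by
  by_contra hne
  have hc := (continuous_comp_slide hf.1 i y)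
  have hopen : {t | f (slide i y t) ≠ 0} ∈ 𝓝 s := (isOpen_ne.preimage hc).mem_nhds hne
  have hsub : {t | f (slide i y t) ≠ 0} ⊆ Metric.closedBall (c i) r := fun t ht => by
    rw [Metric.mem_closedBall, Real.dist_eq]
    by_contra hh
    exact ht (hf.slide_eq_zero_self (not_le.1 hh))
  have h2 := mem_interior_iff_mem_nhds.2 (Filter.mem_of_superset hopen hsub)
  rw [Real.closedBall_eq_Icc, interior_Icc] at h2
  rcases abs_cases (s - c i) with h3 | h3 <;> linarith [h2.1, h2.2]

theorem massAlong_pderiv_self (hr : 0 < r) (i : Fin n) {f : 𝔼 → ℝ} (hf : CubeSmooth c r f) (y : 𝔼) :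
    massAlong i (c i - r) (c i + r) (pderiv i f) y = 0 := by
  rw [massAlong, integral_slide_pderiv hf.1, hf.slide_boundary i y, hf.slide_boundary i y, sub_zero]
  · rw [show c i - r - c i = -r by ring, abs_neg, abs_of_pos hr]
  · rw [show c i + r - c i = r by ring, abs_of_pos hr]

theorem homotopyAlong_pderiv_self (hr : 0 < r) (i : Fin n) {f : 𝔼 → ℝ} (hf : CubeSmooth c r f)
    (y : 𝔼) : homotopyAlong c hr i (pderiv i f) y = f y := by
  rw [homotopyAlong, massAlong_pderiv_self hr i hf, primAlong, integral_slide_pderiv hf.1,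
    slide_self, hf.slide_boundary i y (s := c i - r)]
  · ring
  · rw [show c i - r - c i = -r by ring, abs_neg, abs_of_pos hr]

theorem smearAlong_pderiv_self (hr : 0 < r) (i : Fin n) {f : 𝔼 → ℝ} (hf : CubeSmooth c r f)
    (y : 𝔼) : smearAlong c hr i (pderiv i f) y = 0 := by
  rw [smearAlong, massAlong_pderiv_self hr i hf, mul_zero]

theorem massAlong_sum {ι : Type*} (s : Finset ι) (i : Fin n) (a b : ℝ) {f : ι → 𝔼 → ℝ}
    (hf : ∀ j ∈ s, ContDiff ℝ ∞ (f j)) (y : 𝔼) :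
    massAlong i a b (fun y => ∑ j ∈ s, f j y) y = ∑ j ∈ s, massAlong i a b (f j) y :=
  intervalIntegral.integral_finsetSum fun j hj =>
    (continuous_comp_slide (hf j hj) i y).intervalIntegrable _ _

theorem smearAlong_sum {ι : Type*} (s : Finset ι) (hr : 0 < r) (i : Fin n) {f : ι → 𝔼 → ℝ}
    (hf : ∀ j ∈ s, ContDiff ℝ ∞ (f j)) (y : 𝔼) :
    smearAlong c hr i (fun y => ∑ j ∈ s, f j y) y = ∑ j ∈ s, smearAlong c hr i (f j) y := by
  simp only [smearAlong, massAlong_sum s i _ _ hf, Finset.mul_sum]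

theorem homotopyAlong_sum {ι : Type*} (s : Finset ι) (hr : 0 < r) (i : Fin n) {f : ι → 𝔼 → ℝ}
    (hf : ∀ j ∈ s, ContDiff ℝ ∞ (f j)) (y : 𝔼) :
    homotopyAlong c hr i (fun y => ∑ j ∈ s, f j y) y = ∑ j ∈ s, homotopyAlong c hr i (f j) y := by
  have h : primAlong i (c i - r) (fun y => ∑ j ∈ s, f j y) y =
      ∑ j ∈ s, primAlong i (c i - r) (f j) y := massAlong_sum s i _ _ hf y
  simp only [homotopyAlong, massAlong_sum s i _ _ hf, h, Finset.mul_sum, Finset.sum_sub_distrib]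

end Cube

/-! ### Divergences of vector fields supported in a cube -/

section CubePoincare

open MeasureTheory

variable {n : ℕ} {c : EuclideanSpace ℝ (Fin n)} {r : ℝ}

local notation "𝔼" => EuclideanSpace ℝ (Fin n)

theorem CubeSmooth.zero : CubeSmooth c r (fun _ => (0 : ℝ)) := ⟨contDiff_const, fun _ _ => rfl⟩

theorem CubeSmooth.add {f g : 𝔼 → ℝ} (hf : CubeSmooth c r f) (hg : CubeSmooth c r g) :
    CubeSmooth c r fun y => f y + g y :=
  ⟨hf.1.add hg.1, fun y hy => by simp [hf.2 y hy, hg.2 y hy]⟩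

theorem CubeSmooth.hasCompactSupport {f : 𝔼 → ℝ} (hf : CubeSmooth c r f) : HasCompactSupport f :=
  HasCompactSupport.of_support_subset_isCompact (isCompact_cube c r) fun y hy => by
    by_contra h
    exact hy (hf.2 y h)

theorem CubeSmooth.integral_pderiv {f : 𝔼 → ℝ} (hf : CubeSmooth c r f) (i : Fin n) :
    ∫ y, pderiv i f y = 0 :=
  integral_fderiv_eq_zero hf.1 hf.hasCompactSupport _

theorem CubeSmooth.pderiv {f : 𝔼 → ℝ} (hf : CubeSmooth c r f) (i : Fin n) :
    CubeSmooth c r (pderiv i f) := by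
  refine ⟨contDiff_pderiv i hf.1, fun y hy => ?_⟩
  have h : f =ᶠ[𝓝 y] fun _ => (0 : ℝ) :=
    Filter.eventually_of_mem ((isClosed_cube c r).isOpen_compl.mem_nhds hy) fun z hz => hf.2 z hz
  rw [_root_.pderiv, h.fderiv_eq]
  simp

theorem CubeSmooth.integrable {f : 𝔼 → ℝ} (hf : CubeSmooth c r f) : Integrable f :=
  hf.1.continuous.integrable_of_hasCompactSupport hf.hasCompactSupport

theorem fderiv_eq_zero_of_pderiv {f : 𝔼 → ℝ} {y : 𝔼} (h : ∀ i, pderiv i f y = 0) :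
    fderiv ℝ f y = 0 := by
  refine (ContinuousLinearMap.coe_injective ((EuclideanSpace.basisFun (Fin n) ℝ).toBasis.ext ?_))
  intro i
  simpa [EuclideanSpace.basisFun_apply, pderiv] using h i

/-- Modulo derivatives of functions supported in the cube, a function supported in the cube can be
replaced by a product of bump functions in the coordinates from `S` with a function of the
remaining coordinates. -/
theorem CubeSmooth.exists_bump_mul (hr : 0 < r) {f : 𝔼 → ℝ} (hf : CubeSmooth c r f)
    (S : Finset (Fin n)) :
    ∃ (F : Fin n → 𝔼 → ℝ) (h : 𝔼 → ℝ), (∀ j, CubeSmooth c r (F j)) ∧ ContDiff ℝ ∞ h ∧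
      (∀ j ∈ S, ∀ y, _root_.pderiv j h y = 0) ∧
      CubeSmooth c r (fun y => (∏ j ∈ S, unitBump (c j) hr (y j)) * h y) ∧
      ∀ y, f y = (∑ j, _root_.pderiv j (F j) y) + (∏ j ∈ S, unitBump (c j) hr (y j)) * h y := by
  induction S using Finset.induction_on with
  | empty =>
    refine ⟨fun _ _ => 0, f, fun _ => .zero, hf.1, by simp, by simpa using hf, fun y => ?_⟩
    simp [_root_.pderiv]
  | insert i S hi ih =>
    obtain ⟨F, h, hF, hh, hS, hg, hfe⟩ := ih
    set g : 𝔼 → ℝ := fun y => (∏ j ∈ S, unitBump (c j) hr (y j)) * h y with hgdef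
    have hm : ∀ y, massAlong i (c i - r) (c i + r) g y =
        (∏ j ∈ S, unitBump (c j) hr (y j)) * massAlong i (c i - r) (c i + r) h y := by
      intro y
      simp only [massAlong, hgdef]
      rw [← intervalIntegral.integral_const_mul]
      congr 1
      funext s
      congr 1
      refine Finset.prod_congr rfl fun j hj => ?_
      rw [slide_apply_of_ne (by rintro rfl; exact hi hj)]
    have hs : ∀ y, (∏ j ∈ insert i S, unitBump (c j) hr (y j)) *
        massAlong i (c i - r) (c i + r) h y = _root_.smearAlong c hr i g y := by
      intro y
      rw [_root_.smearAlong, hm, Finset.prod_insert hi, mul_assoc]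
    refine ⟨fun j => if j = i then fun y => F i y + _root_.homotopyAlong c hr i g y else F j,
      massAlong i (c i - r) (c i + r) h, fun j => ?_, contDiff_massAlong i _ _ hh, ?_, ?_, ?_⟩
    · dsimp only
      split_ifs with hj
      · exact (hF i).add (hg.homotopyAlong hr i)
      · exact hF j
    · intro j hj y
      rcases Finset.mem_insert.1 hj with rfl | hj
      · exact pderiv_massAlong_self _ _ _ hh y
      · have hji : j ≠ i := fun he => hi (by rw [← he]; exact hj)
        rw [pderiv_massAlong_of_ne hji _ _ hh]
        simp [massAlong, hS j hj]
    · simp only [hs]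
      exact hg.smearAlong hr i
    · intro y
      rw [hfe y, hs]
      rw [← Finset.add_sum_erase _ _ (Finset.mem_univ i),
        ← Finset.add_sum_erase (Finset.univ : Finset (Fin n)) _ (Finset.mem_univ i)]
      simp only [if_pos]
      rw [pderiv_add (hF i).1 (hg.homotopyAlong hr i).1, pderiv_homotopyAlong_self hr i hg]
      have h1 : ∀ j ∈ Finset.univ.erase i, _root_.pderiv j (if j = i then fun y =>
          F i y + _root_.homotopyAlong c hr i g y else F j) y = _root_.pderiv j (F j) y :=
        fun j hj => by rw [if_neg (Finset.ne_of_mem_erase hj)]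
      rw [Finset.sum_congr rfl h1]
      simp only [hgdef]
      ring

/-- A smooth function supported in a cube with integral zero is a divergence of a vector field
supported in the cube. -/
theorem CubeSmooth.exists_eq_divergence (hr : 0 < r) {f : 𝔼 → ℝ} (hf : CubeSmooth c r f)
    (h0 : ∫ y, f y = 0) :
    ∃ F : Fin n → 𝔼 → ℝ, (∀ j, CubeSmooth c r (F j)) ∧
      ∀ y, f y = ∑ j, _root_.pderiv j (F j) y := by
  obtain ⟨F, h, hF, hh, hS, hg, hfe⟩ := hf.exists_bump_mul hr Finset.univ
  have hconst : ∀ y, h y = h c := fun y =>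
    is_const_of_fderiv_eq_zero (𝕜 := ℝ) (hh.differentiable (by simp))
      (fun y => fderiv_eq_zero_of_pderiv fun i => hS i (Finset.mem_univ i) y) y c
  -- `f` is a divergence plus a constant multiple of the product bump `B`, and `∫ f` determines the
  -- constant
  set B : 𝔼 → ℝ := fun y => ∏ j, unitBump (c j) hr (y j)
  have hBc : Continuous B := continuous_finsetProd _ fun j _ =>
    (contDiff_unitBump_coord hr j).continuous
  have hBs : HasCompactSupport B :=
    HasCompactSupport.of_support_subset_isCompact (isCompact_cube c r) fun y hy j => by
      by_contra hne
      exact hy (Finset.prod_eq_zero (Finset.mem_univ j) (unitBump_eq_zero hr (not_le.1 hne).le))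
  have hBpos : 0 < ∫ y, B y :=
    hBc.integral_pos_of_hasCompactSupport_nonneg_nonzero hBs
      (fun y => Finset.prod_nonneg fun j _ => unitBump_nonneg _ hr _)
      (x := c) (Finset.prod_pos fun j _ => unitBump_pos _ hr).ne'
  have hint : ∫ y, f y = h c * ∫ y, B y := by
    simp_rw [hfe, hconst]
    rw [integral_add, integral_finsetSum, ← integral_const_mul]
    · rw [Finset.sum_eq_zero fun j _ => (hF j).integral_pderiv j, zero_add]
      simp_rw [mul_comm (h c)]
      rfl
    · exact fun j _ => ((hF j).pderiv j).integrable
    · exact integrable_finsetSum _ fun j _ => ((hF j).pderiv j).integrable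
    · simpa [hconst] using hg.integrable
  have hc0 : h c = 0 := by
    rcases mul_eq_zero.1 (hint.symm.trans h0) with h1 | h1
    · exact h1
    · exact absurd h1 hBpos.ne'
  refine ⟨F, hF, fun y => ?_⟩
  rw [hfe y, hconst, hc0]
  ring

/-- Induction on the set `S` of directions in which `X` may have components. Averaging in a
direction `i` (`smearAlong`) turns `X` into a divergence-free field `Y` without `i`-th component,
and `X - Y` is the divergence of an antisymmetric tensor made of the functions `homotopyAlong`. -/
theorem exists_antisymm_potential_aux (hr : 0 < r) (S : Finset (Fin n)) :
    ∀ X : Fin n → 𝔼 → ℝ, (∀ j, CubeSmooth c r (X j)) → (∀ j ∉ S, ∀ y, X j y = 0) →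
      (∀ y, ∑ j, pderiv j (X j) y = 0) →
      ∃ K : Fin n → Fin n → 𝔼 → ℝ, (∀ i j, CubeSmooth c r (K i j)) ∧
        ∀ j y, X j y = ∑ i, (pderiv i (K i j) y - pderiv i (K j i) y) := by
  induction S using Finset.induction_on with
  | empty =>
    intro X _ h0 _
    refine ⟨fun _ _ _ => 0, fun _ _ => .zero, fun j y => ?_⟩
    simp [h0 j (by simp)]
  | insert i S hi ih =>
    intro X hX h0 hdiv
    -- the averaged field, with its `i`-th component removed
    set Y : Fin n → 𝔼 → ℝ := fun j => if j = i then fun _ => 0 else smearAlong c hr i (X j) with hY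
    have hYi : Y i = fun _ => 0 := by simp [hY]
    have hYj : ∀ j, j ≠ i → Y j = smearAlong c hr i (X j) := fun j hj => by simp [hY, hj]
    have hYS : ∀ j, CubeSmooth c r (Y j) := fun j => by
      by_cases hj : j = i
      · rw [hj, hYi]; exact .zero
      · rw [hYj j hj]; exact (hX j).smearAlong hr i
    have hXi : ∀ y, ∑ j ∈ Finset.univ.erase i, pderiv j (X j) y = -pderiv i (X i) y := fun y => by
      have := hdiv y
      rw [← Finset.add_sum_erase _ _ (Finset.mem_univ i)] at this
      linarith
    obtain ⟨K, hK, hXK⟩ := ih Y hYS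
      (fun j hj y => by
        by_cases hji : j = i
        · rw [hji, hYi]
        · rw [hYj j hji, smearAlong, massAlong]
          simp [h0 j (by simp [hji, hj])])
      (fun y => by
        rw [← Finset.add_sum_erase _ _ (Finset.mem_univ i), hYi]
        have h1 : ∀ j ∈ Finset.univ.erase i, pderiv j (Y j) y =
            smearAlong c hr i (pderiv j (X j)) y := fun j hj => by
          rw [hYj j (Finset.ne_of_mem_erase hj),
            pderiv_smearAlong_of_ne hr (Finset.ne_of_mem_erase hj) (hX j)]
        rw [Finset.sum_congr rfl h1,
          ← smearAlong_sum _ hr i (fun j _ => contDiff_pderiv j (hX j).1)]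
        have h2 : (fun y => ∑ j ∈ Finset.univ.erase i, pderiv j (X j) y) =
            pderiv i (fun y => -X i y) := by
          funext y
          rw [hXi, pderiv, pderiv, fderiv_fun_neg]
          rfl
        rw [h2, smearAlong_pderiv_self hr i ⟨(hX i).1.neg, fun y hy => by simp [(hX i).2 y hy]⟩]
        simp [pderiv])
    -- `∂ᵢ (L i j) = X j - Y j` for `j ≠ i`, and `∑ⱼ ∂ⱼ (L i j) = - X i` because `div X = 0`
    set L : Fin n → Fin n → 𝔼 → ℝ := fun a j => if a = i ∧ j ≠ i then homotopyAlong c hr i (X j)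
      else fun _ => 0 with hL
    have hLi : ∀ j, j ≠ i → L i j = homotopyAlong c hr i (X j) := fun j hj => by simp [hL, hj]
    have hL0 : ∀ a, a ≠ i → ∀ j, L a j = fun _ => 0 := fun a ha j => by simp [hL, ha]
    have hLii : L i i = fun _ => 0 := by simp [hL]
    have hLS : ∀ a j, CubeSmooth c r (L a j) := fun a j => by
      simp only [hL]
      split_ifs
      · exact (hX j).homotopyAlong hr i
      · exact .zero
    refine ⟨fun a j y => K a j y + L a j y, fun a j => (hK a j).add (hLS a j), fun j y => ?_⟩
    have hsum : ∑ a, (pderiv a (fun y => K a j y + L a j y) y -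
        pderiv a (fun y => K j a y + L j a y) y) =
        Y j y + ∑ a, (pderiv a (L a j) y - pderiv a (L j a) y) := by
      rw [hXK, ← Finset.sum_add_distrib]
      refine Finset.sum_congr rfl fun a _ => ?_
      rw [pderiv_add (hK a j).1 (hLS a j).1, pderiv_add (hK j a).1 (hLS j a).1]
      ring
    rw [hsum]
    have hp0 : ∀ a, pderiv a (fun _ : 𝔼 => (0 : ℝ)) y = 0 := fun a => by simp [pderiv]
    by_cases hj : j = i
    · subst hj
      rw [hYi, ← Finset.add_sum_erase _ _ (Finset.mem_univ j), sub_self, zero_add, zero_add]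
      have h1 : ∀ a ∈ Finset.univ.erase j, pderiv a (L a j) y - pderiv a (L j a) y =
          -homotopyAlong c hr j (pderiv a (X a)) y := fun a ha => by
        have ha' := Finset.ne_of_mem_erase ha
        rw [hL0 a ha', hLi a ha', hp0, pderiv_homotopyAlong_of_ne hr ha' (hX a), zero_sub]
      rw [Finset.sum_congr rfl h1, Finset.sum_neg_distrib,
        ← homotopyAlong_sum _ hr j (fun a _ => contDiff_pderiv a (hX a).1)]
      have h2 : (fun y => ∑ a ∈ Finset.univ.erase j, pderiv a (X a) y) =
          pderiv j (fun y => -X j y) := by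
        funext y
        rw [hXi, pderiv, pderiv, fderiv_fun_neg]
        rfl
      rw [h2, homotopyAlong_pderiv_self hr j ⟨(hX j).1.neg, fun y hy => by simp [(hX j).2 y hy]⟩]
      ring
    · rw [hYj j hj, Finset.sum_eq_single i]
      · rw [hLi j hj, hL0 j hj, hp0, pderiv_homotopyAlong_self hr i (hX j)]
        ring
      · intro a _ ha
        rw [hL0 a ha, hL0 j hj, hp0, sub_self]
      · simp

/-- A divergence-free vector field supported in a cube is the divergence of an antisymmetric
2-tensor supported in the cube. -/
theorem exists_antisymm_potential (hr : 0 < r) {X : Fin n → 𝔼 → ℝ}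
    (hX : ∀ j, CubeSmooth c r (X j)) (hdiv : ∀ y, ∑ j, pderiv j (X j) y = 0) :
    ∃ K : Fin n → Fin n → 𝔼 → ℝ, (∀ i j, CubeSmooth c r (K i j)) ∧
        ∀ j y, X j y = ∑ i, (pderiv i (K i j) y - pderiv i (K j i) y) :=
  exists_antisymm_potential_aux hr Finset.univ X hX (fun j hj => absurd (Finset.mem_univ j) hj) hdiv

/-- The form of degree `n` on Euclidean space with value one on the standard basis. -/
def stdTop (n : ℕ) : (EuclideanSpace ℝ (Fin n)) [⋀^Fin n]→L[ℝ] ℝ :=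
  { (EuclideanSpace.basisFun (Fin n) ℝ).toBasis.det with
    cont := by
      change Continuous fun v : Fin n → EuclideanSpace ℝ (Fin n) =>
        (EuclideanSpace.basisFun (Fin n) ℝ).toBasis.det v
      simp only [Module.Basis.det_apply]
      refine Continuous.matrix_det (continuous_matrix fun i j => ?_)
      simp only [Module.Basis.toMatrix_apply, OrthonormalBasis.coe_toBasis_repr_apply,
        EuclideanSpace.basisFun_repr]
      exact ((EuclideanSpace.proj (𝕜 := ℝ) i).continuous).comp (continuous_apply j) }

theorem stdTop_apply : stdTop n (fun i => stdVec i) = 1 := by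
  have h : (fun i => stdVec i) = (EuclideanSpace.basisFun (Fin n) ℝ).toBasis := by
    funext i
    simp [EuclideanSpace.basisFun_apply]
  rw [h]
  exact (EuclideanSpace.basisFun (Fin n) ℝ).toBasis.det_self

theorem eq_smul_stdTop (a : 𝔼 [⋀^Fin n]→L[ℝ] ℝ) : a = a (fun i => stdVec i) • stdTop n := by
  have h : (fun i => stdVec i) = (EuclideanSpace.basisFun (Fin n) ℝ).toBasis := by
    funext i
    simp [EuclideanSpace.basisFun_apply]
  apply ContinuousAlternatingMap.toAlternatingMap_injective
  rw [h]
  exact AlternatingMap.eq_smul_basis_det _ (a.toAlternatingMap)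

theorem top_ext {a b : 𝔼 [⋀^Fin n]→L[ℝ] ℝ}
    (h : a (fun i => stdVec i) = b (fun i => stdVec i)) : a = b := by
  rw [eq_smul_stdTop a, h, ← eq_smul_stdTop b]

theorem extDeriv_const {E : Type*} [NormedAddCommGroup E] [NormedSpace ℝ E] {k : ℕ}
    (a : E [⋀^Fin k]→L[ℝ] ℝ) (y : E) : extDeriv (fun _ => a) y = 0 := by
  ext u
  simp [extDeriv, ContinuousAlternatingMap.alternatizeUncurryFin_apply]

theorem extDeriv_sum_smul_const {ι : Type*} (s : Finset ι) {k : ℕ} {f : ι → 𝔼 → ℝ}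
    (hf : ∀ j ∈ s, ContDiff ℝ ∞ (f j)) (b : ι → 𝔼 [⋀^Fin k]→L[ℝ] ℝ) (y : 𝔼) :
    extDeriv (fun y => ∑ j ∈ s, f j y • b j) y = ∑ j ∈ s, covecWedge (fderiv ℝ (f j) y) (b j) := by
  classical
  induction s using Finset.induction_on with
  | empty =>
    simp only [Finset.sum_empty]
    exact extDeriv_const 0 y
  | insert i s hi ih =>
    have hd : ∀ j ∈ insert i s, DifferentiableAt ℝ (fun y => f j y • b j) y := fun j hj =>
      ((hf j hj).differentiable (by simp) y).smul_const _
    simp only [Finset.sum_insert hi]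
    rw [← ih fun j hj => hf j (Finset.mem_insert_of_mem hj)]
    rw [show (fun y => f i y • b i + ∑ j ∈ s, f j y • b j) =
      (fun y => f i y • b i) + fun y => ∑ j ∈ s, f j y • b j from rfl,
      extDeriv_add (hd i (Finset.mem_insert_self _ _))
        (DifferentiableAt.fun_sum fun j hj => hd j (Finset.mem_insert_of_mem hj)),
      extDeriv_fun_mul ((hf i (Finset.mem_insert_self _ _)).differentiable (by simp) y)
        (differentiableAt_const _), extDeriv_const, smul_zero, add_zero]

end CubePoincare

/-! ### The Poincaré lemma with supports in a cube -/

section CubeForms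

open MeasureTheory

variable {d : ℕ} {c : EuclideanSpace ℝ (Fin (d + 1))} {r : ℝ}

theorem covector_eq_sum {n : ℕ} (θ : EuclideanSpace ℝ (Fin n) →L[ℝ] ℝ) :
    θ = ∑ j, θ (stdVec j) • EuclideanSpace.proj (𝕜 := ℝ) j := by
  refine (ContinuousLinearMap.coe_injective ((EuclideanSpace.basisFun (Fin n) ℝ).toBasis.ext ?_))
  intro i
  simp [EuclideanSpace.basisFun_apply]

/-- A form of codegree one is the contraction of the standard volume with a vector. -/
theorem eq_sum_curryLeft_stdTop (a : (EuclideanSpace ℝ (Fin (d + 1))) [⋀^Fin d]→L[ℝ] ℝ) :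
    a = ∑ j, covecWedge (EuclideanSpace.proj (𝕜 := ℝ) j) a (fun i => stdVec i) •
      (stdTop (d + 1)).curryLeft (stdVec j) := by
  set X : EuclideanSpace ℝ (Fin (d + 1)) :=
    ∑ j, covecWedge (EuclideanSpace.proj (𝕜 := ℝ) j) a (fun i => stdVec i) • stdVec j with hX
  have h1 : a = (stdTop (d + 1)).curryLeft X := by
    refine eq_curryLeft_of_covecWedge (by simp) _ _ _ fun θ => top_ext ?_
    have h2 : covecWedge θ a (fun i => stdVec i) =
        ∑ j, θ (stdVec j) * covecWedge (EuclideanSpace.proj (𝕜 := ℝ) j) a (fun i => stdVec i) := by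
      conv_lhs => rw [covector_eq_sum θ]
      simp only [covecWedge_apply, _root_.sum_apply, Finset.sum_mul, Finset.mul_sum,
        _root_.smul_apply, smul_eq_mul]
      rw [Finset.sum_comm]
      exact Finset.sum_congr rfl fun i _ => Finset.sum_congr rfl fun j _ => by ring
    rw [h2, hX, map_sum]
    simp only [map_smul, ContinuousAlternatingMap.smul_apply, stdTop_apply, smul_eq_mul, mul_one]
    exact Finset.sum_congr rfl fun j _ => mul_comm _ _
  refine h1.trans ?_
  rw [hX, map_sum]
  simp only [map_smul]

theorem contDiff_alternating_iff {X E : Type*} [NormedAddCommGroup X] [NormedSpace ℝ X]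
    [NormedAddCommGroup E] [NormedSpace ℝ E] [FiniteDimensional ℝ E] {k : ℕ}
    {m : WithTop ℕ∞} {f : X → E [⋀^Fin k]→L[ℝ] ℝ} :
    ContDiff ℝ m f ↔ ∀ u : Fin k → E, ContDiff ℝ m (fun y => f y u) := by
  simp only [← contDiffOn_univ]
  exact contDiffOn_alternating_iff

/-- On top-degree forms written through interior products, the exterior derivative is the
divergence. -/
theorem extDeriv_sum_curryLeft {X : Fin (d + 1) → EuclideanSpace ℝ (Fin (d + 1)) → ℝ}
    (hX : ∀ j, ContDiff ℝ ∞ (X j)) (y : EuclideanSpace ℝ (Fin (d + 1))) :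
    extDeriv (fun y => ∑ j, X j y • (stdTop (d + 1)).curryLeft (stdVec j)) y =
      (∑ j, pderiv j (X j) y) • stdTop (d + 1) := by
  rw [extDeriv_sum_smul_const _ (fun j _ => hX j), Finset.sum_smul]
  exact Finset.sum_congr rfl fun j _ => covecWedge_curryLeft_top (by simp) _ _ _

/-- A smooth top-degree form supported in a cube with integral zero is the differential of a form
supported in the cube. -/
theorem exists_extDeriv_eq_of_integral_eq_zero (hr : 0 < r)
    {η : EuclideanSpace ℝ (Fin (d + 1)) →
      (EuclideanSpace ℝ (Fin (d + 1))) [⋀^Fin (d + 1)]→L[ℝ] ℝ}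
    (hη : ContDiff ℝ ∞ η) (hs : ∀ y ∉ cube c r, η y = 0)
    (h0 : ∫ y, η y (fun i => stdVec i) = 0) :
    ∃ b : EuclideanSpace ℝ (Fin (d + 1)) → (EuclideanSpace ℝ (Fin (d + 1))) [⋀^Fin d]→L[ℝ] ℝ,
      ContDiff ℝ ∞ b ∧ (∀ y ∉ cube c r, b y = 0) ∧ ∀ y, extDeriv b y = η y := by
  have hf : CubeSmooth c r fun y => η y (fun i => stdVec i) :=
    ⟨contDiff_alternating_iff.1 hη _, fun y hy => by simp [hs y hy]⟩
  obtain ⟨F, hF, hFe⟩ := hf.exists_eq_divergence hr h0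
  refine ⟨fun y => ∑ j, F j y • (stdTop (d + 1)).curryLeft (stdVec j),
    ContDiff.sum fun j _ => (hF j).1.smul contDiff_const,
    fun y hy => Finset.sum_eq_zero fun j _ => by rw [(hF j).2 y hy, zero_smul], fun y => ?_⟩
  rw [extDeriv_sum_curryLeft fun j => (hF j).1, ← hFe y, ← eq_smul_stdTop]

/-- The Poincaré lemma with supports for closed forms of codegree one on a cube. -/
theorem exists_extDeriv_eq_of_closed {d : ℕ} {c : EuclideanSpace ℝ (Fin (d + 1 + 1))} (hr : 0 < r)
    {a : EuclideanSpace ℝ (Fin (d + 1 + 1)) →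
      (EuclideanSpace ℝ (Fin (d + 1 + 1))) [⋀^Fin (d + 1)]→L[ℝ] ℝ}
    (ha : ContDiff ℝ ∞ a) (hs : ∀ y ∉ cube c r, a y = 0) (h0 : ∀ y, extDeriv a y = 0) :
    ∃ b : EuclideanSpace ℝ (Fin (d + 1 + 1)) →
        (EuclideanSpace ℝ (Fin (d + 1 + 1))) [⋀^Fin d]→L[ℝ] ℝ,
      ContDiff ℝ ∞ b ∧ (∀ y ∉ cube c r, b y = 0) ∧ ∀ y, extDeriv b y = a y := by
  -- `a` is the contraction of the volume with the field `X`, and `da = 0` means `div X = 0`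
  set X : Fin (d + 1 + 1) → EuclideanSpace ℝ (Fin (d + 1 + 1)) → ℝ := fun j y =>
    covecWedge (EuclideanSpace.proj (𝕜 := ℝ) j) (a y) (fun i => stdVec i) with hXdef
  have hX : ∀ j, CubeSmooth c r (X j) := fun j => by
    refine ⟨?_, fun y hy => ?_⟩
    · simp only [hXdef, covecWedge_apply]
      exact ContDiff.sum fun i _ => contDiff_const.mul (contDiff_const.mul
        (contDiff_alternating_iff.1 ha _))
    · simp [hXdef, covecWedge_apply, hs y hy]
  have haX : a = fun y => ∑ j, X j y • (stdTop (d + 1 + 1)).curryLeft (stdVec j) :=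
    funext fun y => eq_sum_curryLeft_stdTop (a y)
  have hdiv : ∀ y, ∑ j, pderiv j (X j) y = 0 := fun y => by
    have h1 := h0 y
    rw [haX, extDeriv_sum_curryLeft fun j => (hX j).1] at h1
    have h2 := congrArg (fun b => b fun i => stdVec i) h1
    simpa [stdTop_apply] using h2
  obtain ⟨K, hK, hKX⟩ := exists_antisymm_potential hr hX hdiv
  -- the contraction of the volume with the 2-tensor `K` is a primitive
  set γ : Fin (d + 1 + 1) × Fin (d + 1 + 1) →
      (EuclideanSpace ℝ (Fin (d + 1 + 1))) [⋀^Fin d]→L[ℝ] ℝ := fun p =>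
    ((stdTop (d + 1 + 1)).curryLeft (stdVec p.2)).curryLeft (stdVec p.1) with hγ
  have hθγ : ∀ (θ : EuclideanSpace ℝ (Fin (d + 1 + 1)) →L[ℝ] ℝ) (p), covecWedge θ (γ p) =
      θ (stdVec p.1) • (stdTop (d + 1 + 1)).curryLeft (stdVec p.2) -
        θ (stdVec p.2) • (stdTop (d + 1 + 1)).curryLeft (stdVec p.1) := by
    intro θ p
    have h1 := curryLeft_covecWedge θ ((stdTop (d + 1 + 1)).curryLeft (stdVec p.2)) (stdVec p.1)
    rw [covecWedge_curryLeft_top (by simp)] at h1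
    have h2 : (θ (stdVec p.2) • stdTop (d + 1 + 1)).curryLeft (stdVec p.1) =
      θ (stdVec p.2) • (stdTop (d + 1 + 1)).curryLeft (stdVec p.1) := rfl
    rw [h2] at h1
    rw [h1, hγ]
    abel
  refine ⟨fun y => ∑ p, K p.1 p.2 y • γ p,
    ContDiff.sum fun p _ => (hK _ _).1.smul contDiff_const,
    fun y hy => Finset.sum_eq_zero fun p _ => by rw [(hK _ _).2 y hy, zero_smul], fun y => ?_⟩
  rw [extDeriv_sum_smul_const _ (fun p _ => (hK _ _).1), haX]
  simp only [hθγ, hKX, Finset.sum_smul, Finset.sum_sub_distrib, sub_smul]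
  rw [Fintype.sum_prod_type_right, Fintype.sum_prod_type]
  rfl

end CubeForms

/-! ### Differential forms in charts -/

section Charts

variable {n : ℕ} {M : Type*} [TopologicalSpace M] [ChartedSpace (EuclideanSpace ℝ (Fin n)) M]

local notation "𝔼" => EuclideanSpace ℝ (Fin n)

/-- The derivative of the inverse of the chart around `x`, at the point with coordinates `y`, with
the tangent spaces read as Euclidean space. -/
def chartInv (x : M) (y : 𝔼) : 𝔼 →L[ℝ] 𝔼 :=
  mfderiv 𝓘(ℝ, EuclideanSpace ℝ (Fin n)) (𝓡 n) (extChartAt (𝓡 n) x).symm y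

/-- The derivative at `p` of the chart around `x`, with the tangent spaces read as Euclidean
space. -/
def chartDer (x p : M) : 𝔼 →L[ℝ] 𝔼 :=
  mfderiv (𝓡 n) 𝓘(ℝ, EuclideanSpace ℝ (Fin n)) (extChartAt (𝓡 n) x) p

/-- The value of a form at `p`, with the tangent space read as Euclidean space. -/
def DForm.val {k : ℕ} (α : DForm n M k) (p : M) : 𝔼 [⋀^Fin k]→L[ℝ] ℝ := α p

/-- The change of coordinates from the chart around `x₁` to the chart around `x₀`. -/
def transition (x₀ x₁ : M) (y : 𝔼) : 𝔼 := extChartAt (𝓡 n) x₀ ((extChartAt (𝓡 n) x₁).symm y)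

/-- The domain of the change of coordinates from the chart around `x₁` to that around `x₀`. -/
def overlap (x₀ x₁ : M) : Set 𝔼 :=
  (extChartAt (𝓡 n) x₁).target ∩ (extChartAt (𝓡 n) x₁).symm ⁻¹' (extChartAt (𝓡 n) x₀).source

theorem isOpen_overlap (x₀ x₁ : M) : IsOpen (overlap (n := n) x₀ x₁) :=
  (continuousOn_extChartAt_symm x₁).isOpen_inter_preimage (isOpen_extChartAt_target x₁)
    (isOpen_extChartAt_source x₀)

theorem locRep_eq {k : ℕ} (x : M) (α : DForm n M k) (y : 𝔼) :
    locRep x α y = (α.val ((extChartAt (𝓡 n) x).symm y)).compContinuousLinearMap (chartInv x y) :=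
  rfl

theorem DForm.ext_val {k : ℕ} {α β : DForm n M k} (h : ∀ p, α.val p = β.val p) : α = β := funext h

theorem comp_comp {k : ℕ} (a : 𝔼 [⋀^Fin k]→L[ℝ] ℝ) (f g : 𝔼 →L[ℝ] 𝔼) :
    (a.compContinuousLinearMap f).compContinuousLinearMap g = a.compContinuousLinearMap (f ∘L g) :=
  rfl

theorem comp_id {k : ℕ} (a : 𝔼 [⋀^Fin k]→L[ℝ] ℝ) :
    a.compContinuousLinearMap (ContinuousLinearMap.id ℝ 𝔼) = a := rfl

theorem locRep_eq_curryLeft_comp {k : ℕ} (a : 𝔼 [⋀^Fin (k + 1)]→L[ℝ] ℝ) (f : 𝔼 →L[ℝ] 𝔼) (v : 𝔼) :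
    (a.compContinuousLinearMap f).curryLeft v = (a.curryLeft (f v)).compContinuousLinearMap f := by
  ext u
  simp only [ContinuousAlternatingMap.curryLeft_apply_apply,
    ContinuousAlternatingMap.compContinuousLinearMap_apply]
  congr 1
  funext i
  refine Fin.cases ?_ (fun j => ?_) i <;> simp

variable [IsManifold (𝓡 n) ∞ M]

instance isManifold_one : IsManifold (𝓡 n) 1 M :=
  IsManifold.of_le (n := ∞) (by exact WithTop.coe_le_coe.2 (le_top : (1 : ℕ∞) ≤ ⊤))

theorem chartDer_comp_chartInv {x : M} {y : 𝔼} (hy : y ∈ (extChartAt (𝓡 n) x).target) :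
    chartDer x ((extChartAt (𝓡 n) x).symm y) ∘L chartInv x y = ContinuousLinearMap.id ℝ 𝔼 := by
  have h := mfderiv_extChartAt_comp_mfderivWithin_extChartAt_symm (I := 𝓡 n) hy
  rw [modelWithCornersSelf_coe, range_id, mfderivWithin_univ] at h
  exact h

theorem chartInv_comp_chartDer' {x : M} {y : 𝔼} (hy : y ∈ (extChartAt (𝓡 n) x).target) :
    chartInv x y ∘L chartDer x ((extChartAt (𝓡 n) x).symm y) = ContinuousLinearMap.id ℝ 𝔼 := by
  have h := mfderivWithin_extChartAt_symm_comp_mfderiv_extChartAt (I := 𝓡 n) hy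
  rw [modelWithCornersSelf_coe, range_id, mfderivWithin_univ] at h
  exact h

theorem chartInv_comp_chartDer {x p : M} (hp : p ∈ (extChartAt (𝓡 n) x).source) :
    chartInv x (extChartAt (𝓡 n) x p) ∘L chartDer x p = ContinuousLinearMap.id ℝ 𝔼 := by
  have h := chartInv_comp_chartDer' ((extChartAt (𝓡 n) x).map_source hp)
  rwa [(extChartAt (𝓡 n) x).left_inv hp] at h

theorem chartDer_chartInv_apply {x : M} {y : 𝔼} (hy : y ∈ (extChartAt (𝓡 n) x).target) (v : 𝔼) :
    chartDer x ((extChartAt (𝓡 n) x).symm y) (chartInv x y v) = v :=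
  congrArg (fun f => f v) (chartDer_comp_chartInv hy)

theorem chartInv_chartDer_apply {x : M} {y : 𝔼} (hy : y ∈ (extChartAt (𝓡 n) x).target) (v : 𝔼) :
    chartInv x y (chartDer x ((extChartAt (𝓡 n) x).symm y) v) = v :=
  congrArg (fun f => f v) (chartInv_comp_chartDer' hy)

theorem mdifferentiableAt_symm {x : M} {y : 𝔼} (hy : y ∈ (extChartAt (𝓡 n) x).target) :
    MDifferentiableAt 𝓘(ℝ, EuclideanSpace ℝ (Fin n)) (𝓡 n) (extChartAt (𝓡 n) x).symm y := by
  have h := mdifferentiableWithinAt_extChartAt_symm (I := 𝓡 n) hy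
  rwa [modelWithCornersSelf_coe, range_id, mdifferentiableWithinAt_univ] at h

theorem fderiv_transition {x₀ x₁ : M} {y : 𝔼} (hy : y ∈ overlap (n := n) x₀ x₁) :
    fderiv ℝ (transition x₀ x₁) y =
      chartDer x₀ ((extChartAt (𝓡 n) x₁).symm y) ∘L chartInv x₁ y := by
  rw [← mfderiv_eq_fderiv]
  have hs : (extChartAt (𝓡 n) x₁).symm y ∈ (chartAt (EuclideanSpace ℝ (Fin n)) x₀).source := by
    have := hy.2
    rwa [mem_preimage, extChartAt_source] at this
  exact mfderiv_comp y (mdifferentiableAt_extChartAt (I := 𝓡 n) hs) (mdifferentiableAt_symm hy.1)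

theorem contDiffOn_transition (x₀ x₁ : M) :
    ContDiffOn ℝ ∞ (transition (n := n) x₀ x₁) (overlap x₀ x₁) := by
  have h1 : ContMDiffOn 𝓘(ℝ, EuclideanSpace ℝ (Fin n)) (𝓡 n) ∞ (extChartAt (𝓡 n) x₁).symm
      (overlap x₀ x₁) := (contMDiffOn_extChartAt_symm x₁).mono inter_subset_left
  have h2 : ContMDiffOn (𝓡 n) 𝓘(ℝ, EuclideanSpace ℝ (Fin n)) ∞ (extChartAt (𝓡 n) x₀)
      (chartAt (EuclideanSpace ℝ (Fin n)) x₀).source := contMDiffOn_extChartAt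
  exact contMDiffOn_iff_contDiffOn.1 (h2.comp h1 fun y hy => by
    have := hy.2
    rwa [mem_preimage, extChartAt_source] at this)

theorem two_le_infty : minSmoothness ℝ 2 ≤ (∞ : WithTop ℕ∞) := by
  rw [minSmoothness_of_isRCLikeNormedField]
  exact WithTop.coe_le_coe.2 (le_top : (2 : ℕ∞) ≤ ⊤)

theorem mem_overlap_self {x : M} {y : 𝔼} (hy : y ∈ (extChartAt (𝓡 n) x).target) :
    y ∈ overlap (n := n) ((extChartAt (𝓡 n) x).symm y) x :=
  ⟨hy, mem_extChartAt_source _⟩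

theorem transition_mem_overlap {x₀ x₁ : M} {y : 𝔼} (hy : y ∈ overlap (n := n) x₀ x₁) :
    transition x₀ x₁ y ∈ overlap (n := n) x₁ x₀ := by
  refine ⟨(extChartAt (𝓡 n) x₀).map_source hy.2, ?_⟩
  rw [mem_preimage, transition, (extChartAt (𝓡 n) x₀).left_inv hy.2]
  exact (extChartAt (𝓡 n) x₁).map_target hy.1

theorem symm_transition {x₀ x₁ : M} {y : 𝔼} (hy : y ∈ overlap (n := n) x₀ x₁) :
    (extChartAt (𝓡 n) x₀).symm (transition x₀ x₁ y) = (extChartAt (𝓡 n) x₁).symm y :=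
  (extChartAt (𝓡 n) x₀).left_inv hy.2

theorem transition_transition {x₀ x₁ : M} {y : 𝔼} (hy : y ∈ overlap (n := n) x₀ x₁) :
    transition x₁ x₀ (transition x₀ x₁ y) = y := by
  rw [transition, symm_transition hy, (extChartAt (𝓡 n) x₁).right_inv hy.1]

theorem chartInv_transition {x₀ x₁ : M} {y : 𝔼} (hy : y ∈ overlap (n := n) x₀ x₁) :
    chartInv x₁ y = chartInv x₀ (transition x₀ x₁ y) ∘L fderiv ℝ (transition x₀ x₁) y := by
  have h := chartInv_comp_chartDer' (transition_mem_overlap hy).1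
  rw [symm_transition hy] at h
  rw [fderiv_transition hy, ← ContinuousLinearMap.comp_assoc, h, ContinuousLinearMap.id_comp]

/-- Coordinate expressions in two charts are related by pull-back along the change of coordinates.
-/
theorem locRep_transition {k : ℕ} {x₀ x₁ : M} {y : 𝔼} (hy : y ∈ overlap (n := n) x₀ x₁)
    (α : DForm n M k) : locRep x₁ α y =
      (locRep x₀ α (transition x₀ x₁ y)).compContinuousLinearMap
        (fderiv ℝ (transition x₀ x₁) y) := by
  rw [locRep_eq, locRep_eq, comp_comp, ← chartInv_transition hy, symm_transition hy]

/-- A form is recovered from its coordinate expression. -/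
theorem val_eq_locRep {k : ℕ} (α : DForm n M k) {x p : M} (hp : p ∈ (extChartAt (𝓡 n) x).source) :
    α.val p = (locRep x α (extChartAt (𝓡 n) x p)).compContinuousLinearMap (chartDer x p) := by
  rw [locRep_eq, comp_comp, chartInv_comp_chartDer hp, comp_id, (extChartAt (𝓡 n) x).left_inv hp]

theorem fromChart_locRep {k : ℕ} (α : DForm n M k) (x : M) :
    fromChart x (locRep x α (extChartAt (𝓡 n) x x)) = α x :=
  (val_eq_locRep α (mem_extChartAt_source x)).symm

theorem DForm.ext_locRep {k : ℕ} {α β : DForm n M k}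
    (h : ∀ x : M, ∀ y ∈ (extChartAt (𝓡 n) x).target, locRep x α y = locRep x β y) : α = β :=
  DForm.ext_val fun p => by
    rw [val_eq_locRep α (mem_extChartAt_source p), h p _ (mem_extChartAt_target p),
      ← val_eq_locRep β (mem_extChartAt_source p)]

theorem locRep_fromChart {k : ℕ} {x : M} {y : 𝔼} (hy : y ∈ (extChartAt (𝓡 n) x).target)
    (A : (p : M) → 𝔼 [⋀^Fin k]→L[ℝ] ℝ) :
    locRep x (fun p => fromChart p (A p) : DForm n M k) y =
      (A ((extChartAt (𝓡 n) x).symm y)).compContinuousLinearMap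
        (fderiv ℝ (transition ((extChartAt (𝓡 n) x).symm y) x) y) := by
  rw [fderiv_transition (mem_overlap_self hy)]
  rfl

/-- The exterior derivative is computed by the exterior derivative of coordinate expressions in any
chart. -/
theorem locRep_extD {k : ℕ} {α : DForm n M k} (hα : α ∈ smoothForms n M k) {x : M} {y : 𝔼}
    (hy : y ∈ (extChartAt (𝓡 n) x).target) : locRep x (extD α) y = extDeriv (locRep x α) y := by
  set p := (extChartAt (𝓡 n) x).symm y with hp
  have hov : y ∈ overlap (n := n) p x := mem_overlap_self hy
  have h1 : locRep x α =ᶠ[𝓝 y] fun z => (locRep p α (transition p x z)).compContinuousLinearMap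
      (fderiv ℝ (transition p x) z) :=
    Filter.eventually_of_mem ((isOpen_overlap p x).mem_nhds hov) fun z hz => locRep_transition hz α
  rw [h1.extDeriv_eq, extDeriv_pullback (r := ∞)]
  · exact locRep_fromChart hy fun q => extDeriv (locRep q α) (extChartAt (𝓡 n) q q)
  · exact differentiableAt_locRep hα p
  · exact (contDiffOn_transition p x).contDiffAt ((isOpen_overlap p x).mem_nhds hov)
  · exact two_le_infty

theorem extD_mem {k : ℕ} {α : DForm n M k} (hα : α ∈ smoothForms n M k) :
    extD α ∈ smoothForms n M (k + 1) := fun x =>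
  (ContDiffOn.extDeriv (isOpen_extChartAt_target x) (hα x)).congr fun _ hy => locRep_extD hα hy

theorem contDiffAt_locRep {k : ℕ} {α : DForm n M k} (hα : α ∈ smoothForms n M k) {x : M} {y : 𝔼}
    (hy : y ∈ (extChartAt (𝓡 n) x).target) : ContDiffAt ℝ ∞ (locRep x α) y :=
  (hα x).contDiffAt ((isOpen_extChartAt_target x).mem_nhds hy)

theorem extDeriv_congr_target {k : ℕ} {x : M} {y : 𝔼} (hy : y ∈ (extChartAt (𝓡 n) x).target)
    {a b : 𝔼 → 𝔼 [⋀^Fin k]→L[ℝ] ℝ} (h : ∀ z ∈ (extChartAt (𝓡 n) x).target, a z = b z) :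
    extDeriv a y = extDeriv b y :=
  Filter.EventuallyEq.extDeriv_eq
    (Filter.eventually_of_mem ((isOpen_extChartAt_target x).mem_nhds hy) h)

theorem extD_extD {k : ℕ} {α : DForm n M k} (hα : α ∈ smoothForms n M k) : extD (extD α) = 0 :=
  DForm.ext_locRep fun x y hy => by
    rw [locRep_extD (extD_mem hα) hy,
      extDeriv_congr_target hy (b := extDeriv (locRep x α)) fun z hz => locRep_extD hα hz,
      extDeriv_extDeriv_apply (contDiffAt_locRep hα hy) two_le_infty]
    rfl

theorem locRep_wedgeForm {k l p : ℕ} (h : k + l = p) (α : DForm n M k) (β : DForm n M l) (x : M)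
    (y : 𝔼) : locRep x (wedgeForm h α β) y = wedge h (locRep x α y) (locRep x β y) :=
  wedge_compContinuousLinearMap h (α.val _) (β.val _) (chartInv x y)

theorem wedgeForm_mem {k l p : ℕ} (h : k + l = p) {α : DForm n M k} {β : DForm n M l}
    (hα : α ∈ smoothForms n M k) (hβ : β ∈ smoothForms n M l) :
    wedgeForm h α β ∈ smoothForms n M p := fun x =>
  (ContDiffOn.wedge h (hα x) (hβ x)).congr fun y _ => locRep_wedgeForm h α β x y

theorem locRep_powForm (α : DForm n M 2) (j : ℕ) (x : M) (y : 𝔼) :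
    locRep x (powForm α j) y = wedgePow (locRep x α y) j :=
  wedgePow_compContinuousLinearMap (α.val _) (chartInv x y) j

theorem powForm_mem {α : DForm n M 2} (hα : α ∈ smoothForms n M 2) (j : ℕ) :
    powForm α j ∈ smoothForms n M (2 * j) := fun x =>
  ((hα x).wedgePow j).congr fun y _ => locRep_powForm α j x y

/-- The product of a function and a form. -/
def funMul {k : ℕ} (f : M → ℝ) (α : DForm n M k) : DForm n M k := fun p => f p • α.val p

theorem locRep_funMul {k : ℕ} (f : M → ℝ) (α : DForm n M k) (x : M) (y : 𝔼) :
    locRep x (funMul f α) y = f ((extChartAt (𝓡 n) x).symm y) • locRep x α y := rfl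

/-- The coordinate expression of a smooth function is smooth. -/
theorem ContMDiff.contDiffOn_symm {f : M → ℝ} (hf : ContMDiff (𝓡 n) 𝓘(ℝ, ℝ) ∞ f) (x : M) :
    ContDiffOn ℝ ∞ (fun y => f ((extChartAt (𝓡 n) x).symm y)) (extChartAt (𝓡 n) x).target :=
  contMDiffOn_iff_contDiffOn.1
    (hf.comp_contMDiffOn (contMDiffOn_extChartAt_symm (I := 𝓡 n) (n := ∞) x))

theorem contMDiff_of_contDiffOn_symm {f : M → ℝ} (hf : ∀ x : M,
    ContDiffOn ℝ ∞ (fun y => f ((extChartAt (𝓡 n) x).symm y)) (extChartAt (𝓡 n) x).target) :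
    ContMDiff (𝓡 n) 𝓘(ℝ, ℝ) ∞ f := fun p => by
  have h1 := (contMDiffOn_iff_contDiffOn.2 (hf p)).comp
    (contMDiffOn_extChartAt (I := 𝓡 n) (n := ∞) (x := p)) (fun q hq => by
      rw [← extChartAt_source (𝓡 n)] at hq
      exact (extChartAt (𝓡 n) p).map_source hq)
  have h2 : (chartAt (EuclideanSpace ℝ (Fin n)) p).source ∈ 𝓝 p := chart_source_mem_nhds _ _
  refine (h1.contMDiffAt h2).congr_of_eventuallyEq ?_
  filter_upwards [h2] with q hq
  rw [← extChartAt_source (𝓡 n)] at hq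
  simp only [Function.comp_apply, (extChartAt (𝓡 n) p).left_inv hq]

theorem funMul_mem {k : ℕ} {f : M → ℝ} (hf : ContMDiff (𝓡 n) 𝓘(ℝ, ℝ) ∞ f) {α : DForm n M k}
    (hα : α ∈ smoothForms n M k) : funMul f α ∈ smoothForms n M k := fun x =>
  (hf.contDiffOn_symm x).smul (hα x)

/-- The differential of a function. -/
def dFun (f : M → ℝ) : DForm n M 1 := fun p =>
  covecForm (fderiv ℝ (fun y => f ((extChartAt (𝓡 n) p).symm y)) (extChartAt (𝓡 n) p p) ∘L
    chartDer p p)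

theorem covecForm_comp (θ : 𝔼 →L[ℝ] ℝ) (f : 𝔼 →L[ℝ] 𝔼) :
    (covecForm θ).compContinuousLinearMap f = covecForm (θ ∘L f) := by
  ext u
  simp [covecForm]

theorem locRep_dFun {f : M → ℝ} (hf : ContMDiff (𝓡 n) 𝓘(ℝ, ℝ) ∞ f) {x : M} {y : 𝔼}
    (hy : y ∈ (extChartAt (𝓡 n) x).target) : locRep x (dFun f : DForm n M 1) y =
      covecForm (fderiv ℝ (fun y => f ((extChartAt (𝓡 n) x).symm y)) y) := by
  set p := (extChartAt (𝓡 n) x).symm y with hp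
  have hov : y ∈ overlap (n := n) p x := mem_overlap_self hy
  have h1 : (fun y => f ((extChartAt (𝓡 n) x).symm y)) =ᶠ[𝓝 y]
      (fun y => f ((extChartAt (𝓡 n) p).symm y)) ∘ transition p x :=
    Filter.eventually_of_mem ((isOpen_overlap p x).mem_nhds hov) fun z hz => by
      simp only [Function.comp_apply, symm_transition hz]
  have hd : DifferentiableAt ℝ (fun y => f ((extChartAt (𝓡 n) p).symm y)) (transition p x y) :=
    ((hf.contDiffOn_symm p).contDiffAt ((isOpen_extChartAt_target p).mem_nhds
      (mem_extChartAt_target p))).differentiableAt (by simp)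
  rw [h1.fderiv_eq, fderiv_comp y hd (((contDiffOn_transition p x).contDiffAt
    ((isOpen_overlap p x).mem_nhds hov)).differentiableAt (by simp)), fderiv_transition hov,
    locRep_eq]
  change (covecForm _).compContinuousLinearMap _ = _
  rw [covecForm_comp]
  rfl

theorem covecForm_contDiffOn {X : Type*} [NormedAddCommGroup X] [NormedSpace ℝ X]
    {θ : X → 𝔼 →L[ℝ] ℝ} {s : Set X} (h : ContDiffOn ℝ ∞ θ s) :
    ContDiffOn ℝ ∞ (fun y => covecForm (θ y)) s :=
  contDiffOn_alternating_iff.2 fun u => by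
    simp only [covecForm, ContinuousAlternatingMap.ofSubsingleton_apply_apply]
    exact h.clm_apply contDiffOn_const

theorem dFun_mem {f : M → ℝ} (hf : ContMDiff (𝓡 n) 𝓘(ℝ, ℝ) ∞ f) :
    dFun f ∈ smoothForms n M 1 := fun x =>
  (covecForm_contDiffOn (((hf.contDiffOn_symm x).fderiv_of_isOpen (isOpen_extChartAt_target x)
    (m := ∞) (by simp)))).congr fun _ hy => locRep_dFun hf hy

/-- The Leibniz rule. -/
theorem extD_funMul {k : ℕ} {f : M → ℝ} (hf : ContMDiff (𝓡 n) 𝓘(ℝ, ℝ) ∞ f) {α : DForm n M k}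
    (hα : α ∈ smoothForms n M k) : extD (funMul f α) =
      wedgeForm (Nat.add_comm 1 k) (dFun f) α + funMul f (extD α) :=
  DForm.ext_locRep fun x y hy => by
    rw [locRep_extD (funMul_mem hf hα) hy, locRep_add, Pi.add_apply, locRep_wedgeForm,
      locRep_dFun hf hy, locRep_funMul, locRep_extD hα hy, wedge_covecForm_left]
    exact extDeriv_fun_mul (((hf.contDiffOn_symm x).contDiffAt
      ((isOpen_extChartAt_target x).mem_nhds hy)).differentiableAt (by simp))
      ((contDiffAt_locRep hα hy).differentiableAt (by simp))

end Charts

/-! ### Vector fields, Lie derivatives and commutators -/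

section Fields

variable {n : ℕ} {M : Type*} [TopologicalSpace M] [ChartedSpace (EuclideanSpace ℝ (Fin n)) M]

local notation "𝔼" => EuclideanSpace ℝ (Fin n)

/-- The value of a vector field at `p`, with the tangent space read as Euclidean space. -/
def fieldVal (v : (x : M) → TangentSpace (𝓡 n) x) (p : M) : 𝔼 := v p

theorem interiorProd_val {k : ℕ} (v : (x : M) → TangentSpace (𝓡 n) x) (α : DForm n M (k + 1))
    (p : M) : (interiorProd v α).val p = (α.val p).curryLeft (fieldVal v p) := rfl

variable [IsManifold (𝓡 n) ∞ M]

theorem locField_eq (v : (x : M) → TangentSpace (𝓡 n) x) {x : M} {y : 𝔼}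
    (hy : y ∈ (extChartAt (𝓡 n) x).target) : locField x v y =
      chartDer x ((extChartAt (𝓡 n) x).symm y) (fieldVal v ((extChartAt (𝓡 n) x).symm y)) := by
  have h : (chartInv x y).inverse = chartDer x ((extChartAt (𝓡 n) x).symm y) :=
    ContinuousLinearMap.inverse_eq (chartInv_comp_chartDer' hy) (chartDer_comp_chartInv hy)
  rw [← h]
  rfl

theorem chartInv_locField (v : (x : M) → TangentSpace (𝓡 n) x) {x : M} {y : 𝔼}
    (hy : y ∈ (extChartAt (𝓡 n) x).target) :
    chartInv x y (locField x v y) = fieldVal v ((extChartAt (𝓡 n) x).symm y) := by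
  rw [locField_eq v hy, chartInv_chartDer_apply hy]

theorem trivializationAt_snd {x p : M} (hp : p ∈ (extChartAt (𝓡 n) x).source) (u : 𝔼) :
    (trivializationAt (EuclideanSpace ℝ (Fin n)) (TangentSpace (𝓡 n) : M → Type) x
      (⟨p, u⟩ : TangentBundle (𝓡 n) M)).2 = chartDer x p u := by
  have hp' : p ∈ (chartAt (EuclideanSpace ℝ (Fin n)) x).source := by
    rwa [extChartAt_source] at hp
  have h := TangentBundle.continuousLinearMapAt_trivializationAt (I := 𝓡 n) hp'
  have h2 := congrArg (fun f : 𝔼 →L[ℝ] 𝔼 => f u) h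
  refine Eq.trans ?_ h2
  exact (Bundle.Trivialization.continuousLinearMapAt_apply_of_mem (R := ℝ) _
    (by rwa [TangentBundle.trivializationAt_baseSet]) _).symm

theorem mem_trivializationAt_source {x p : M} (hp : p ∈ (extChartAt (𝓡 n) x).source) (u : 𝔼) :
    (⟨p, u⟩ : TangentBundle (𝓡 n) M) ∈
      (trivializationAt (EuclideanSpace ℝ (Fin n)) (TangentSpace (𝓡 n) : M → Type) x).source := by
  rw [TangentBundle.trivializationAt_source]
  rwa [extChartAt_source] at hp

/-- The coordinate expression of a smooth time-dependent field is smooth. -/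
theorem SmoothFieldPath.contDiffOn {J : Set ℝ} {v : ℝ → SmoothField n M} (hv : SmoothFieldPath J v)
    (x : M) : ContDiffOn ℝ ∞ (fun p : ℝ × 𝔼 => locField x (v p.1) p.2)
      (J ×ˢ (extChartAt (𝓡 n) x).target) := by
  have h1 : ContMDiffOn 𝓘(ℝ, ℝ × EuclideanSpace ℝ (Fin n)) (𝓘(ℝ, ℝ).prod (𝓡 n)) ∞
      (fun p : ℝ × EuclideanSpace ℝ (Fin n) => (p.1, (extChartAt (𝓡 n) x).symm p.2))
      (J ×ˢ (extChartAt (𝓡 n) x).target) :=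
    ContMDiffOn.prodMk (contDiff_fst.contMDiff.contMDiffOn)
      ((contMDiffOn_extChartAt_symm x).comp (contDiff_snd.contMDiff.contMDiffOn) fun p hp => hp.2)
  have h2 := ContMDiffOn.comp hv h1 fun p hp => ⟨hp.1, mem_univ _⟩
  have h3 := ((Bundle.Trivialization.contMDiffOn_iff
    (e := trivializationAt (EuclideanSpace ℝ (Fin n)) (TangentSpace (𝓡 n) : M → Type) x)
    fun p hp => mem_trivializationAt_source ((extChartAt (𝓡 n) x).map_target hp.2) _).1 h2).2
  refine (contMDiffOn_iff_contDiffOn.1 h3).congr fun p hp => ?_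
  rw [locField_eq _ hp.2]
  exact (trivializationAt_snd ((extChartAt (𝓡 n) x).map_target hp.2) _).symm

theorem contDiffOn_slice {X Y Z : Type*} [NormedAddCommGroup X] [NormedSpace ℝ X]
    [NormedAddCommGroup Y] [NormedSpace ℝ Y] [NormedAddCommGroup Z] [NormedSpace ℝ Z]
    {f : X × Y → Z} {J : Set X} {s : Set Y} (h : ContDiffOn ℝ ∞ f (J ×ˢ s)) {t : X} (ht : t ∈ J) :
    ContDiffOn ℝ ∞ (fun y => f (t, y)) s :=
  h.comp (contDiff_const.prodMk contDiff_id).contDiffOn fun _ hy => ⟨ht, hy⟩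

theorem SmoothField.smoothFieldPath_const (v : SmoothField n M) :
    SmoothFieldPath univ fun _ : ℝ => v := by
  have hs : ContMDiff (𝓘(ℝ, ℝ).prod (𝓡 n)) (𝓡 n) ∞ fun p : ℝ × M => p.2 := contMDiff_snd
  exact fun p _ => (ContMDiffAt.comp (g := fun q => (⟨q, v q⟩ : TangentBundle (𝓡 n) M)) p
    (v.contMDiff p.2) (hs p)).contMDiffWithinAt

theorem contDiffOn_locField (v : SmoothField n M) (x : M) :
    ContDiffOn ℝ ∞ (locField x v) (extChartAt (𝓡 n) x).target := by
  have h := contDiffOn_slice (v.smoothFieldPath_const.contDiffOn x) (mem_univ (0 : ℝ))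
  exact h

theorem contDiffAt_locField (v : SmoothField n M) {x : M} {y : 𝔼}
    (hy : y ∈ (extChartAt (𝓡 n) x).target) : ContDiffAt ℝ ∞ (locField x v) y :=
  (contDiffOn_locField v x).contDiffAt ((isOpen_extChartAt_target x).mem_nhds hy)

/-- A vector field with smooth coordinate expressions, as a smooth section. -/
def SmoothField.ofLocal (v : (x : M) → TangentSpace (𝓡 n) x)
    (hv : ∀ x, ContDiffOn ℝ ∞ (locField x v) (extChartAt (𝓡 n) x).target) : SmoothField n M where
  toFun := v
  contMDiff_toFun p := by
    have hp := mem_extChartAt_source (I := 𝓡 n) p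
    rw [Bundle.Trivialization.contMDiffAt_section_iff
      (trivializationAt (EuclideanSpace ℝ (Fin n)) (TangentSpace (𝓡 n) : M → Type) p)
      (by rw [TangentBundle.trivializationAt_baseSet]; rwa [extChartAt_source] at hp)]
    have h1 := (contMDiffOn_iff_contDiffOn.2 (hv p)).comp
      (contMDiffOn_extChartAt (I := 𝓡 n) (n := ∞) (x := p)) (fun q hq => by
        rw [← extChartAt_source (𝓡 n)] at hq
        exact (extChartAt (𝓡 n) p).map_source hq)
    have h2 : (chartAt (EuclideanSpace ℝ (Fin n)) p).source ∈ 𝓝 p := chart_source_mem_nhds _ _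
    refine (h1.contMDiffAt h2).congr_of_eventuallyEq ?_
    filter_upwards [h2] with q hq
    rw [← extChartAt_source (𝓡 n)] at hq
    rw [Function.comp_apply, locField_eq v ((extChartAt (𝓡 n) p).map_source hq),
      (extChartAt (𝓡 n) p).left_inv hq]
    exact trivializationAt_snd hq _

theorem locRep_interiorProd {k : ℕ} (v : (x : M) → TangentSpace (𝓡 n) x) (α : DForm n M (k + 1))
    {x : M} {y : 𝔼} (hy : y ∈ (extChartAt (𝓡 n) x).target) :
    locRep x (interiorProd v α) y = (locRep x α y).curryLeft (locField x v y) := by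
  rw [locRep_eq, locRep_eq, locRep_eq_curryLeft_comp, chartInv_locField v hy, interiorProd_val]

theorem interiorProd_mem {k : ℕ} (v : SmoothField n M) {α : DForm n M (k + 1)}
    (hα : α ∈ smoothForms n M (k + 1)) : interiorProd v α ∈ smoothForms n M k := fun x =>
  ((hα x).curryLeft_apply (contDiffOn_locField v x)).congr fun _ hy => locRep_interiorProd v α hy

/-- Cartan's formula `L_v = d i_v + i_v d` for the Lie derivative of forms on the manifold. -/
theorem lieD_eq_cartan {k : ℕ} (v : SmoothField n M) {α : DForm n M (k + 1)}
    (hα : α ∈ smoothForms n M (k + 1)) :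
    lieD v α = extD (interiorProd v α) + interiorProd v (extD α) := by
  refine DForm.ext_locRep fun x y hy => ?_
  have hloc : ∀ p : M, flatLieDeriv (locField p v) (locRep p α) (extChartAt (𝓡 n) p p) =
      locRep p (extD (interiorProd v α) + interiorProd v (extD α)) (extChartAt (𝓡 n) p p) := by
    intro p
    have hp := mem_extChartAt_target (I := 𝓡 n) p
    rw [flatLieDeriv_eq_cartan (differentiableAt_locRep hα p) (differentiableAt_locField v p),
      locRep_add, Pi.add_apply, locRep_extD (interiorProd_mem v hα) hp, locRep_interiorProd _ _ hp,
      locRep_extD hα hp]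
    congr 1
    exact extDeriv_congr_target hp fun z hz => (locRep_interiorProd v α hz).symm
  have h1 : lieD v α = extD (interiorProd v α) + interiorProd v (extD α) := by
    funext p
    rw [lieD, hloc, fromChart_locRep]
  rw [h1]

theorem lieD_mem {k : ℕ} (v : SmoothField n M) {α : DForm n M (k + 1)}
    (hα : α ∈ smoothForms n M (k + 1)) : lieD v α ∈ smoothForms n M (k + 1) := by
  rw [lieD_eq_cartan v hα]
  exact add_mem (extD_mem (interiorProd_mem v hα)) (interiorProd_mem v (extD_mem hα))

theorem locRep_lieD {k : ℕ} (v : SmoothField n M) {α : DForm n M (k + 1)}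
    (hα : α ∈ smoothForms n M (k + 1)) {x : M} {y : 𝔼} (hy : y ∈ (extChartAt (𝓡 n) x).target) :
    locRep x (lieD v α) y = flatLieDeriv (locField x v) (locRep x α) y := by
  rw [lieD_eq_cartan v hα, flatLieDeriv_eq_cartan ((contDiffAt_locRep hα hy).differentiableAt
    (by simp)) ((contDiffAt_locField v hy).differentiableAt (by simp)), locRep_add, Pi.add_apply,
    locRep_extD (interiorProd_mem v hα) hy, locRep_interiorProd _ _ hy, locRep_extD hα hy]
  congr 1
  exact extDeriv_congr_target hy fun z hz => locRep_interiorProd v α hz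

theorem interiorProd_add {k : ℕ} (v : SmoothField n M) (α β : DForm n M (k + 1)) :
    interiorProd v (α + β) = interiorProd v α + interiorProd v β := rfl

theorem interiorProd_smul {k : ℕ} (v : SmoothField n M) (c : ℝ) (α : DForm n M (k + 1)) :
    interiorProd v (c • α) = c • interiorProd v α := rfl

theorem interiorProd_zero {k : ℕ} (v : SmoothField n M) :
    interiorProd v (0 : DForm n M (k + 1)) = 0 := rfl

/-- The Lie derivative on smooth forms. -/
def lieForm {k : ℕ} (v : SmoothField n M) :
    smoothForms n M (k + 1) →ₗ[ℝ] smoothForms n M (k + 1) where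
  toFun α := ⟨lieD v α.1, lieD_mem v α.2⟩
  map_add' α β := Subtype.ext <| by
    simp only [Submodule.coe_add, lieD_eq_cartan v (add_mem α.2 β.2), lieD_eq_cartan v α.2,
      lieD_eq_cartan v β.2, interiorProd_add, extD_add α.2 β.2,
      extD_add (interiorProd_mem v α.2) (interiorProd_mem v β.2)]
    abel
  map_smul' c α := Subtype.ext <| by
    simp only [Submodule.coe_smul, lieD_eq_cartan v (Submodule.smul_mem _ c α.2),
      lieD_eq_cartan v α.2, interiorProd_smul, extD_smul, smul_add, RingHom.id_apply]

/-- By Cartan's formula, the Lie derivative of an exact form is exact. -/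
theorem lieForm_mem_exactForms {k : ℕ} (v : SmoothField n M) {α : smoothForms n M (k + 1)}
    (hα : α ∈ exactForms n M k) : lieForm v α ∈ exactForms n M k := by
  obtain ⟨β, hβ, h⟩ := hα
  refine ⟨interiorProd v α.1, interiorProd_mem v α.2, ?_⟩
  change lieD v α.1 = _
  rw [lieD_eq_cartan v α.2, h, extD_extD hβ, interiorProd_zero, add_zero]

/-- The Lie derivative on cosets of smooth forms modulo exact forms. -/
def lieCoset {k : ℕ} (v : SmoothField n M) : Cosets n M k →ₗ[ℝ] Cosets n M k :=
  (exactForms n M k).mapQ (exactForms n M k) (lieForm v) fun _ hα => lieForm_mem_exactForms v hα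

/-- By Cartan's formula, `v` is symplectic if and only if `i_v ω` is closed. -/
theorem mem_symp_iff (ω₀ : SymplecticForm n M) (v : SmoothField n M) :
    v ∈ symp ω₀ ↔ extD (interiorProd v ω₀.form) = 0 := by
  change lieD v ω₀.form = 0 ↔ _
  rw [lieD_eq_cartan v ω₀.smooth, ω₀.closed, interiorProd_zero, add_zero]

/-- The function `α(v, w)`. -/
def formPair (α : DForm n M 2) (v w : (x : M) → TangentSpace (𝓡 n) x) (p : M) : ℝ :=
  α.val p ![fieldVal v p, fieldVal w p]

theorem formPair_symm (α : DForm n M 2) (v w : (x : M) → TangentSpace (𝓡 n) x) {x : M} {y : 𝔼}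
    (hy : y ∈ (extChartAt (𝓡 n) x).target) : formPair α v w ((extChartAt (𝓡 n) x).symm y) =
      locRep x α y ![locField x v y, locField x w y] := by
  rw [locRep_eq, formPair, ← chartInv_locField v hy, ← chartInv_locField w hy,
    ContinuousAlternatingMap.compContinuousLinearMap_apply]
  congr 1
  funext i
  fin_cases i <;> rfl

theorem contMDiff_formPair {α : DForm n M 2} (hα : α ∈ smoothForms n M 2) (v w : SmoothField n M) :
    ContMDiff (𝓡 n) 𝓘(ℝ, ℝ) ∞ (formPair α v w) :=
  contMDiff_of_contDiffOn_symm fun x => by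
    have h := (hα x).alternating_apply (v := ![locField x v, locField x w]) (fun i => by
      fin_cases i
      · exact contDiffOn_locField v x
      · exact contDiffOn_locField w x)
    refine h.congr fun y hy => ?_
    rw [formPair_symm α v w hy]
    congr 1
    funext i
    fin_cases i <;> rfl

theorem mlieBracket_model (V W : 𝔼 → 𝔼) :
    VectorField.mlieBracket 𝓘(ℝ, EuclideanSpace ℝ (Fin n)) V W = VectorField.lieBracket ℝ V W := by
  have h1 := VectorField.mlieBracketWithin_univ (I := 𝓘(ℝ, EuclideanSpace ℝ (Fin n))) (V := V)
    (W := W)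
  have h2 := VectorField.mlieBracketWithin_eq_lieBracketWithin (𝕜 := ℝ) (V := V) (W := W)
    (s := univ)
  exact h1.symm.trans (h2.trans VectorField.lieBracketWithin_univ)

theorem locField_mlieBracket (v w : SmoothField n M) {x : M} {y : 𝔼}
    (hy : y ∈ (extChartAt (𝓡 n) x).target) :
    locField x (VectorField.mlieBracket (𝓡 n) v w) y =
      VectorField.lieBracket ℝ (locField x v) (locField x w) y := by
  have : IsManifold (𝓡 n) (minSmoothness ℝ 2) M := IsManifold.of_le (n := ∞) two_le_infty
  have h := VectorField.mpullback_mlieBracket (I := 𝓘(ℝ, EuclideanSpace ℝ (Fin n))) (I' := 𝓡 n)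
    (n := ∞) (f := (extChartAt (𝓡 n) x).symm) (V := v) (W := w) (x₀ := y)
    ((v.contMDiff _).mdifferentiableAt (by simp)) ((w.contMDiff _).mdifferentiableAt (by simp))
    ((contMDiffOn_extChartAt_symm x).contMDiffAt ((isOpen_extChartAt_target x).mem_nhds hy))
    two_le_infty
  exact h.trans (congrFun (mlieBracket_model (locField x v) (locField x w)) y)

/-- The commutator of smooth vector fields. -/
def bracketField (v w : SmoothField n M) : SmoothField n M :=
  SmoothField.ofLocal (VectorField.mlieBracket (𝓡 n) v w) fun x => by
    have ht := isOpen_extChartAt_target (I := 𝓡 n) x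
    have hv := contDiffOn_locField v x
    have hw := contDiffOn_locField w x
    refine ContDiffOn.congr (f := VectorField.lieBracket ℝ (locField x v) (locField x w)) ?_
      fun y hy => locField_mlieBracket v w hy
    exact ((hw.fderiv_of_isOpen ht (m := ∞) (by simp)).clm_apply hv).sub
      ((hv.fderiv_of_isOpen ht (m := ∞) (by simp)).clm_apply hw)

/-- The commutator of symplectic fields is Hamiltonian: `i_{[v,w]} ω = - d(ω(v, w))`. -/
theorem interiorProd_bracketField (ω₀ : SymplecticForm n M) {v w : SmoothField n M}
    (hv : v ∈ symp ω₀) (hw : w ∈ symp ω₀) :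
    interiorProd (bracketField v w) ω₀.form = -dFun (formPair ω₀.form v w) :=
  DForm.ext_locRep fun x y hy => by
    have hneg : locRep x (-dFun (formPair ω₀.form v w)) y =
        -locRep x (dFun (formPair ω₀.form v w)) y := rfl
    rw [locRep_interiorProd _ _ hy, hneg, locRep_dFun (contMDiff_formPair ω₀.smooth v w) hy]
    have hd : extDeriv (locRep x ω₀.form) y = 0 := by
      rw [← locRep_extD ω₀.smooth hy, ω₀.closed]; rfl
    have hlie : ∀ u ∈ symp ω₀, flatLieDeriv (locField x u) (locRep x ω₀.form) y = 0 := by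
      intro u hu
      rw [← locRep_lieD u ω₀.smooth hy, show lieD u ω₀.form = 0 from hu]
      rfl
    have hb : locField x (bracketField v w) y =
      VectorField.lieBracket ℝ (locField x v) (locField x w) y := locField_mlieBracket v w hy
    have hf : (fun y => formPair ω₀.form v w ((extChartAt (𝓡 n) x).symm y)) =ᶠ[𝓝 y]
        fun z => locRep x ω₀.form z ![locField x v z, locField x w z] :=
      Filter.eventually_of_mem ((isOpen_extChartAt_target x).mem_nhds hy)
        fun z hz => formPair_symm _ _ _ hz
    ext u
    have h := apply_lieBracket_of_flatLieDeriv_eq_zero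
      ((contDiffAt_locRep ω₀.smooth hy).differentiableAt (by simp))
      ((contDiffAt_locField v hy).differentiableAt (by simp))
      ((contDiffAt_locField w hy).differentiableAt (by simp)) hd (hlie v hv) (hlie w hw) (u 0)
    rw [hb, hf.fderiv_eq, ContinuousAlternatingMap.curryLeft_apply_apply]
    refine Eq.trans ?_ (h.trans ?_)
    · congr 1
      funext i
      fin_cases i <;> rfl
    · simp [covecForm]

theorem extD_neg {k : ℕ} (α : DForm n M k) : extD (-α) = -extD α := by
  have h := extD_smul (-1 : ℝ) α
  rwa [show (-1 : ℝ) • α = -α from neg_one_smul ℝ α,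
    show (-1 : ℝ) • extD α = -extD α from neg_one_smul ℝ _] at h

theorem extD_dFun {f : M → ℝ} (hf : ContMDiff (𝓡 n) 𝓘(ℝ, ℝ) ∞ f) :
    extD (dFun f : DForm n M 1) = 0 := by
  let z : DForm n M 0 := fun p => ContinuousAlternatingMap.constOfIsEmpty ℝ 𝔼 (Fin 0) (f p)
  have hz : ∀ x y, locRep x z y = ContinuousAlternatingMap.constOfIsEmpty ℝ 𝔼 (Fin 0)
    (f ((extChartAt (𝓡 n) x).symm y)) := fun x y => rfl
  have hzs : z ∈ smoothForms n M 0 := fun x =>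
    contDiffOn_alternating_iff.2 fun u => hf.contDiffOn_symm x
  have : dFun f = extD z := DForm.ext_locRep fun x y hy => by
    rw [locRep_dFun hf hy, locRep_extD hzs hy]
    exact (extDeriv_constOfIsEmpty _ _).symm
  rw [this, extD_extD hzs]

theorem bracketField_mem_symp (ω₀ : SymplecticForm n M) {v w : SmoothField n M}
    (hv : v ∈ symp ω₀) (hw : w ∈ symp ω₀) : bracketField v w ∈ symp ω₀ := by
  rw [mem_symp_iff, interiorProd_bracketField ω₀ hv hw, extD_neg,
    extD_dFun (contMDiff_formPair ω₀.smooth v w), neg_zero]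

end Fields

/-! ### The metric and the symplectic form as dualities -/

section Metric

variable {n : ℕ} {M : Type*} [TopologicalSpace M] [ChartedSpace (EuclideanSpace ℝ (Fin n)) M]
  [IsManifold (𝓡 n) ∞ M]

local notation "𝔼" => EuclideanSpace ℝ (Fin n)

/-- The scalar product of the metric on the tangent space at `p`, read as Euclidean space. -/
def metricVal (g : RiemMetric n M) (p : M) : 𝔼 →L[ℝ] 𝔼 →L[ℝ] ℝ := g.inner p

/-- The coordinate expression of the metric in the chart around `x`. -/
def metricRep (g : RiemMetric n M) (x : M) (y : 𝔼) : 𝔼 →L[ℝ] 𝔼 →L[ℝ] ℝ :=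
  (metricVal g ((extChartAt (𝓡 n) x).symm y)).bilinearComp (chartInv x y) (chartInv x y)

theorem contMDiffOn_chartInv (x : M) (a : 𝔼) :
    ContMDiffOn 𝓘(ℝ, EuclideanSpace ℝ (Fin n)) (𝓡 n).tangent ∞
      (fun y : EuclideanSpace ℝ (Fin n) =>
        (⟨(extChartAt (𝓡 n) x).symm y, chartInv x y a⟩ : TangentBundle (𝓡 n) M))
      (extChartAt (𝓡 n) x).target := by
  refine (Bundle.Trivialization.contMDiffOn_iff
    (e := trivializationAt (EuclideanSpace ℝ (Fin n)) (TangentSpace (𝓡 n) : M → Type) x)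
    fun y hy => mem_trivializationAt_source ((extChartAt (𝓡 n) x).map_target hy) _).2
    ⟨contMDiffOn_extChartAt_symm x, ?_⟩
  refine (contMDiffOn_const (c := a)).congr fun y hy => ?_
  refine (trivializationAt_snd ((extChartAt (𝓡 n) x).map_target hy) _).trans ?_
  exact chartDer_chartInv_apply hy a

theorem contDiffOn_metricRep (g : RiemMetric n M) (x : M) :
    ContDiffOn ℝ ∞ (metricRep g x) (extChartAt (𝓡 n) x).target := by
  refine contDiffOn_clm_apply.2 fun a => contDiffOn_clm_apply.2 fun b => ?_
  have h : ContMDiffOn 𝓘(ℝ, EuclideanSpace ℝ (Fin n)) ((𝓡 n).prod 𝓘(ℝ)) ∞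
      (fun y : EuclideanSpace ℝ (Fin n) =>
        Bundle.TotalSpace.mk' ℝ (E := Bundle.Trivial M ℝ) ((extChartAt (𝓡 n) x).symm y)
          (g.inner ((extChartAt (𝓡 n) x).symm y) (chartInv x y a) (chartInv x y b)))
      (extChartAt (𝓡 n) x).target :=
    ContMDiffOn.clm_bundle_apply₂ (F₁ := EuclideanSpace ℝ (Fin n))
      (F₂ := EuclideanSpace ℝ (Fin n))
      (g.contMDiff.comp_contMDiffOn (contMDiffOn_extChartAt_symm x))
      (contMDiffOn_chartInv x a) (contMDiffOn_chartInv x b)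
  refine contMDiffOn_iff_contDiffOn.1 fun y hy => ?_
  have h2 := h y hy
  rw [Bundle.contMDiffWithinAt_totalSpace] at h2
  exact h2.2

theorem locRep_flat (g : RiemMetric n M) (v : (x : M) → TangentSpace (𝓡 n) x) {x : M} {y : 𝔼}
    (hy : y ∈ (extChartAt (𝓡 n) x).target) :
    locRep x (flat g v) y = covecForm (metricRep g x y (locField x v y)) := by
  have h : (flat g v).val ((extChartAt (𝓡 n) x).symm y) =
    covecForm (metricVal g ((extChartAt (𝓡 n) x).symm y)
      (fieldVal v ((extChartAt (𝓡 n) x).symm y))) := rfl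
  rw [locRep_eq, h, covecForm_comp, ← chartInv_locField v hy]
  rfl

/-- The coordinate expression of `v^♭` for a smooth time-dependent field is smooth. -/
theorem SmoothFieldPath.contDiffOn_flat (g : RiemMetric n M) {J : Set ℝ} {v : ℝ → SmoothField n M}
    (hv : SmoothFieldPath J v) (x : M) :
    ContDiffOn ℝ ∞ (fun p : ℝ × 𝔼 => locRep x (flat g (v p.1)) p.2)
      (J ×ˢ (extChartAt (𝓡 n) x).target) := by
  have hg : ContDiffOn ℝ ∞ (fun p : ℝ × 𝔼 => metricRep g x p.2)
      (J ×ˢ (extChartAt (𝓡 n) x).target) :=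
    (contDiffOn_metricRep g x).comp contDiffOn_snd fun p hp => hp.2
  refine ContDiffOn.congr (contDiffOn_alternating_iff.2 fun u => ?_)
    fun p hp => locRep_flat g _ hp.2
  simp only [covecForm, ContinuousAlternatingMap.ofSubsingleton_apply_apply]
  exact (hg.clm_apply (hv.contDiffOn x)).clm_apply contDiffOn_const

theorem flat_mem (g : RiemMetric n M) (v : SmoothField n M) : flat g v ∈ smoothForms n M 1 :=
  fun x => contDiffOn_slice (v.smoothFieldPath_const.contDiffOn_flat g x) (mem_univ (0 : ℝ))

theorem finrank_alternating_one : Module.finrank ℝ (𝔼 [⋀^Fin 1]→L[ℝ] ℝ) = n := by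
  have h1 := (ContinuousAlternatingMap.ofSubsingletonLIE (𝕜 := ℝ) (E := 𝔼) (F := ℝ)
    (i := (0 : Fin 1))).toLinearEquiv.finrank_eq
  have h2 := (LinearMap.toContinuousLinearMap (𝕜 := ℝ) (E := 𝔼) (F' := ℝ)).finrank_eq
  have h3 : Module.finrank ℝ (Module.Dual ℝ 𝔼) = Module.finrank ℝ 𝔼 := Subspace.dual_finrank_eq
  rw [← h1, ← h2]
  exact h3.trans (by simp)

/-- Contraction with a nondegenerate 2-form is an isomorphism of vectors with covectors. -/
def curryLeftEquiv (s : 𝔼 [⋀^Fin 2]→L[ℝ] ℝ) (hs : ∀ u, (∀ w, s ![u, w] = 0) → u = 0) :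
    𝔼 ≃L[ℝ] 𝔼 [⋀^Fin 1]→L[ℝ] ℝ :=
  (LinearEquiv.ofInjectiveOfFinrankEq (s.curryLeft : 𝔼 →ₗ[ℝ] 𝔼 [⋀^Fin 1]→L[ℝ] ℝ) (by
    rw [← LinearMap.ker_eq_bot, LinearMap.ker_eq_bot']
    intro u hu
    refine hs u fun w => ?_
    have := congrArg (fun b : 𝔼 [⋀^Fin 1]→L[ℝ] ℝ => b ![w]) hu
    exact this) (by rw [finrank_alternating_one]; simp)).toContinuousLinearEquiv

theorem curryLeftEquiv_apply (s : 𝔼 [⋀^Fin 2]→L[ℝ] ℝ) (hs : ∀ u, (∀ w, s ![u, w] = 0) → u = 0)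
    (u : 𝔼) : curryLeftEquiv s hs u = s.curryLeft u := rfl

theorem SymplecticForm.val_nondegenerate (ω₀ : SymplecticForm n M) (p : M) (u : 𝔼)
    (h : ∀ w, ω₀.form.val p ![u, w] = 0) : u = 0 := ω₀.nondegenerate p u h

theorem SymplecticForm.locRep_nondegenerate (ω₀ : SymplecticForm n M) {x : M} {y : 𝔼}
    (hy : y ∈ (extChartAt (𝓡 n) x).target) (u : 𝔼) (h : ∀ w, locRep x ω₀.form y ![u, w] = 0) :
    u = 0 := by
  have h1 : chartInv x y u = 0 := by
    refine ω₀.val_nondegenerate ((extChartAt (𝓡 n) x).symm y) _ fun w => ?_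
    have h2 := h (chartDer x ((extChartAt (𝓡 n) x).symm y) w)
    rw [locRep_eq, ContinuousAlternatingMap.compContinuousLinearMap_apply] at h2
    rw [← h2]
    congr 1
    funext i
    fin_cases i
    · rfl
    · exact (chartInv_chartDer_apply hy w).symm
  have h3 := chartDer_chartInv_apply hy u
  rw [h1, map_zero] at h3
  exact h3.symm

/-- The vector field that a nondegenerate 2-form associates to a 1-form. -/
def SymplecticForm.sharp (ω₀ : SymplecticForm n M) (θ : DForm n M 1) :
    (x : M) → TangentSpace (𝓡 n) x := fun p =>
  ((curryLeftEquiv (ω₀.form.val p) (ω₀.val_nondegenerate p)).symm (θ.val p) : 𝔼)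

theorem SymplecticForm.interiorProd_sharp (ω₀ : SymplecticForm n M) (θ : DForm n M 1) :
    interiorProd (ω₀.sharp θ) ω₀.form = θ :=
  DForm.ext_val fun p =>
    (curryLeftEquiv (ω₀.form.val p) (ω₀.val_nondegenerate p)).apply_symm_apply (θ.val p)

theorem SymplecticForm.contDiffOn_locField_sharp (ω₀ : SymplecticForm n M) {θ : DForm n M 1}
    (hθ : θ ∈ smoothForms n M 1) (x : M) :
    ContDiffOn ℝ ∞ (locField x (ω₀.sharp θ)) (extChartAt (𝓡 n) x).target := by
  set B : (𝔼 [⋀^Fin 2]→L[ℝ] ℝ) →L[ℝ] (𝔼 →L[ℝ] 𝔼 [⋀^Fin 1]→L[ℝ] ℝ) :=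
    LinearMap.toContinuousLinearMap
      { toFun := fun s => s.curryLeft, map_add' := fun _ _ => rfl, map_smul' := fun _ _ => rfl }
  intro y hy
  refine ContDiffAt.contDiffWithinAt ?_
  set e := curryLeftEquiv (locRep x ω₀.form y) (ω₀.locRep_nondegenerate hy)
  have h1 : ContDiffAt ℝ ∞ (fun z => (B (locRep x ω₀.form z)).inverse (locRep x θ z)) y := by
    have h2 : ContDiffAt ℝ ∞ ContinuousLinearMap.inverse (B (locRep x ω₀.form y)) :=
      contDiffAt_map_inverse e
    exact (h2.comp y (B.contDiff.contDiffAt.comp y (contDiffAt_locRep ω₀.smooth hy))).clm_apply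
      (contDiffAt_locRep hθ hy)
  refine h1.congr_of_eventuallyEq ?_
  filter_upwards [(isOpen_extChartAt_target x).mem_nhds hy] with z hz
  have h3 : B (locRep x ω₀.form z) =
      (curryLeftEquiv (locRep x ω₀.form z) (ω₀.locRep_nondegenerate hz) : 𝔼 →L[ℝ] _) := rfl
  rw [h3, ContinuousLinearMap.inverse_equiv]
  refine ((ContinuousLinearEquiv.symm_apply_eq _).2 ?_).symm
  rw [curryLeftEquiv_apply, ← locRep_interiorProd _ _ hz, ω₀.interiorProd_sharp]

/-- A smooth 1-form is `i_v ω` for a smooth vector field `v`. -/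
theorem SymplecticForm.exists_interiorProd_eq (ω₀ : SymplecticForm n M) {θ : DForm n M 1}
    (hθ : θ ∈ smoothForms n M 1) : ∃ v : SmoothField n M, interiorProd v ω₀.form = θ :=
  ⟨SmoothField.ofLocal (ω₀.sharp θ) (ω₀.contDiffOn_locField_sharp hθ), ω₀.interiorProd_sharp θ⟩

end Metric

/-! ### Momentum forms -/

section Momentum

variable {k : ℕ} {M : Type*} [TopologicalSpace M]
  [ChartedSpace (EuclideanSpace ℝ (Fin (2 * (k + 1)))) M] [IsManifold (𝓡 (2 * (k + 1))) ∞ M]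

theorem momentumForm_mem (g : RiemMetric (2 * (k + 1)) M) (ω₀ : SymplecticForm (2 * (k + 1)) M)
    (v : symp ω₀) : momentumForm g ω₀ v ∈ smoothForms (2 * (k + 1)) M (2 * k + 1) :=
  wedgeForm_mem _ (flat_mem g _) (powForm_mem ω₀.smooth k)

theorem momentumForm_smoothFormPath (g : RiemMetric (2 * (k + 1)) M)
    (ω₀ : SymplecticForm (2 * (k + 1)) M) {J : Set ℝ} {v : ℝ → symp ω₀}
    (hv : SmoothFieldPath J fun t => (v t).1) :
    SmoothFormPath J fun t => (⟨momentumForm g ω₀ (v t), momentumForm_mem g ω₀ (v t)⟩ :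
      smoothForms (2 * (k + 1)) M (2 * k + 1)) := fun x => by
  have h1 : ContDiffOn ℝ ∞ (fun p : ℝ × EuclideanSpace ℝ (Fin (2 * (k + 1))) =>
      locRep x (powForm ω₀.form k) p.2) (J ×ˢ (extChartAt (𝓡 (2 * (k + 1))) x).target) :=
    ContDiffOn.comp (powForm_mem ω₀.smooth k x) contDiffOn_snd fun p hp => hp.2
  exact (ContDiffOn.wedge (by omega) (hv.contDiffOn_flat g x) h1).congr fun p _ =>
    locRep_wedgeForm _ _ _ x p.2

end Momentum

/-! ### Time derivatives of forms -/

section TimeDerivative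

variable {n : ℕ} {M : Type*} [TopologicalSpace M] [ChartedSpace (EuclideanSpace ℝ (Fin n)) M]
  [IsManifold (𝓡 n) ∞ M]

local notation "𝔼" => EuclideanSpace ℝ (Fin n)

theorem hasDerivAt_slice {X Y : Type*} [NormedAddCommGroup X] [NormedSpace ℝ X]
    [NormedAddCommGroup Y] [NormedSpace ℝ Y] {f : ℝ × X → Y} {t : ℝ} {y : X}
    (h : DifferentiableAt ℝ f (t, y)) :
    HasDerivAt (fun s => f (s, y)) (fderiv ℝ f (t, y) (1, 0)) t :=
  h.hasFDerivAt.comp_hasDerivAt t ((hasDerivAt_id t).prodMk (hasDerivAt_const t y))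

theorem SmoothFormPath.hasDerivAt_locRep {l : ℕ} {J : Set ℝ} (hJ : IsOpen J)
    {α : ℝ → smoothForms n M l} (hα : SmoothFormPath J α) {t : ℝ} (ht : t ∈ J) {x : M} {y : 𝔼}
    (hy : y ∈ (extChartAt (𝓡 n) x).target) :
    HasDerivAt (fun s => locRep x (α s).1 y)
      (fderiv ℝ (fun p : ℝ × 𝔼 => locRep x (α p.1).1 p.2) (t, y) (1, 0)) t :=
  hasDerivAt_slice (f := fun p : ℝ × 𝔼 => locRep x (α p.1).1 p.2)
    (((hα x).contDiffAt ((hJ.prod (isOpen_extChartAt_target x)).mem_nhds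
      ⟨ht, hy⟩)).differentiableAt (by simp))

/-- Pull-back by a linear map, as a continuous linear map on alternating forms. -/
def pullbackCLM {l : ℕ} (f : 𝔼 →L[ℝ] 𝔼) : (𝔼 [⋀^Fin l]→L[ℝ] ℝ) →L[ℝ] (𝔼 [⋀^Fin l]→L[ℝ] ℝ) :=
  LinearMap.toContinuousLinearMap
    { toFun := fun a => a.compContinuousLinearMap f
      map_add' := fun _ _ => rfl
      map_smul' := fun _ _ => rfl }

theorem SmoothFormPath.differentiableAt_val {l : ℕ} {J : Set ℝ} (hJ : IsOpen J)
    {α : ℝ → smoothForms n M l} (hα : SmoothFormPath J α) {t : ℝ} (ht : t ∈ J) (p : M) :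
    DifferentiableAt ℝ (fun s => (α s).1.val p) t := by
  have h1 := hα.hasDerivAt_locRep hJ ht (mem_extChartAt_target p)
  have h2 := (pullbackCLM (chartDer p p)).hasFDerivAt.comp_hasDerivAt t h1
  refine h2.differentiableAt.congr_of_eventuallyEq (Filter.Eventually.of_forall fun s => ?_)
  exact val_eq_locRep _ (mem_extChartAt_source p)

open scoped Classical in
/-- The pointwise time derivative of a family of forms, extended by zero outside `J`. -/
def timeDerivForm {l : ℕ} (J : Set ℝ) (α : ℝ → smoothForms n M l) (t : ℝ) : DForm n M l := fun p =>
  if t ∈ J then (deriv (fun s => (α s).1.val p) t : 𝔼 [⋀^Fin l]→L[ℝ] ℝ) else 0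

theorem locRep_timeDerivForm {l : ℕ} {J : Set ℝ} (hJ : IsOpen J) {α : ℝ → smoothForms n M l}
    (hα : SmoothFormPath J α) {t : ℝ} (ht : t ∈ J) {x : M} {y : 𝔼}
    (hy : y ∈ (extChartAt (𝓡 n) x).target) : locRep x (timeDerivForm J α t) y =
      fderiv ℝ (fun p : ℝ × 𝔼 => locRep x (α p.1).1 p.2) (t, y) (1, 0) := by
  have h1 : (timeDerivForm J α t).val ((extChartAt (𝓡 n) x).symm y) =
      deriv (fun s => (α s).1.val ((extChartAt (𝓡 n) x).symm y)) t := if_pos ht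
  rw [locRep_eq, h1]
  have h2 := (pullbackCLM (chartInv x y)).hasFDerivAt.comp_hasDerivAt t
    (hα.differentiableAt_val hJ ht ((extChartAt (𝓡 n) x).symm y)).hasDerivAt
  exact h2.unique (hα.hasDerivAt_locRep hJ ht hy)

theorem SmoothFormPath.contDiffOn_fderiv {l : ℕ} {J : Set ℝ} (hJ : IsOpen J)
    {α : ℝ → smoothForms n M l} (hα : SmoothFormPath J α) (x : M) :
    ContDiffOn ℝ ∞ (fun q => fderiv ℝ (fun p : ℝ × 𝔼 => locRep x (α p.1).1 p.2) q (1, 0))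
      (J ×ˢ (extChartAt (𝓡 n) x).target) :=
  ((hα x).fderiv_of_isOpen (hJ.prod (isOpen_extChartAt_target x)) (m := ∞) (by simp)).clm_apply
    contDiffOn_const

theorem timeDerivForm_mem {l : ℕ} {J : Set ℝ} (hJ : IsOpen J) {α : ℝ → smoothForms n M l}
    (hα : SmoothFormPath J α) (t : ℝ) : timeDerivForm J α t ∈ smoothForms n M l := by
  by_cases ht : t ∈ J
  · exact fun x => (contDiffOn_slice (hα.contDiffOn_fderiv hJ x) ht).congr fun y hy =>
      locRep_timeDerivForm hJ hα ht hy
  · have : timeDerivForm J α t = 0 := funext fun p => if_neg ht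
    rw [this]
    exact zero_mem _

theorem isTimeDeriv_timeDerivForm {l : ℕ} {J : Set ℝ} (hJ : IsOpen J) {α : ℝ → smoothForms n M l}
    (hα : SmoothFormPath J α) :
    IsTimeDeriv J α fun t => ⟨timeDerivForm J α t, timeDerivForm_mem hJ hα t⟩ := by
  intro t ht p u
  have h1 : (timeDerivForm J α t).val p = deriv (fun s => (α s).1.val p) t := if_pos ht
  have h2 := (hα.differentiableAt_val hJ ht p).hasDerivAt
  rw [← h1] at h2
  let ev : (𝔼 [⋀^Fin l]→L[ℝ] ℝ) →L[ℝ] ℝ := LinearMap.toContinuousLinearMap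
    { toFun := fun a => a u, map_add' := fun _ _ => rfl, map_smul' := fun _ _ => rfl }
  exact ev.hasFDerivAt.comp_hasDerivAt t h2

end TimeDerivative

/-! ### Extension by zero -/

section ZeroExtension

theorem contDiff_of_eq_zero {E F : Type*} [NormedAddCommGroup E] [NormedSpace ℝ E]
    [NormedAddCommGroup F] [NormedSpace ℝ F] {f : E → F} {U K : Set E} (hU : IsOpen U)
    (hK : IsClosed K) (hKU : K ⊆ U) (hf : ContDiffOn ℝ ∞ f U) (h0 : ∀ y ∉ K, f y = 0) :
    ContDiff ℝ ∞ f := by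
  refine contDiff_iff_contDiffAt.2 fun y => ?_
  by_cases hy : y ∈ K
  · exact hf.contDiffAt (hU.mem_nhds (hKU hy))
  · exact (contDiffAt_const (c := (0 : F))).congr_of_eventuallyEq
      (Filter.eventually_of_mem (hK.isOpen_compl.mem_nhds hy) h0)

end ZeroExtension

/-! ### Integration of forms of top degree -/

section Integral

open MeasureTheory

variable {n : ℕ} {M : Type*} [TopologicalSpace M] [ChartedSpace (EuclideanSpace ℝ (Fin n)) M]

local notation "𝔼" => EuclideanSpace ℝ (Fin n)

theorem top_comp (a : 𝔼 [⋀^Fin n]→L[ℝ] ℝ) (f : 𝔼 →L[ℝ] 𝔼) :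
    a.compContinuousLinearMap f = f.det • a := by
  refine top_ext ?_
  have h : (fun i => stdVec i) = (EuclideanSpace.basisFun (Fin n) ℝ).toBasis := by
    funext i
    simp [EuclideanSpace.basisFun_apply]
  have h1 := congrArg (fun b => b fun i => f (stdVec i)) (eq_smul_stdTop a)
  have h2 : stdTop n (fun i => f (stdVec i)) = f.det := by
    have h3 := (EuclideanSpace.basisFun (Fin n) ℝ).toBasis.det_comp (f : 𝔼 →ₗ[ℝ] 𝔼)
      (EuclideanSpace.basisFun (Fin n) ℝ).toBasis
    rw [Module.Basis.det_self, mul_one] at h3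
    rw [← h] at h3
    exact h3
  change a (fun i => f (stdVec i)) = f.det * a fun i => stdVec i
  refine h1.trans ?_
  change a (fun i => stdVec i) * stdTop n (fun i => f (stdVec i)) = _
  rw [h2, mul_comm]

/-- The coefficient of an `n`-form in the chart around `x`. -/
def chartCoeff (η : DForm n M n) (x : M) (y : 𝔼) : ℝ := locRep x η y fun i => stdVec i

/-- The quotient `η / o` of two `n`-forms, with value zero where `o` vanishes. -/
def ratio (o η : DForm n M n) (p : M) : ℝ :=
  η.val p (fun i => stdVec i) / o.val p fun i => stdVec i

/-- Volume forms: smooth forms of top degree without zeros. -/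
def IsVolume (o : DForm n M n) : Prop := o ∈ smoothForms n M n ∧ ∀ p, o.val p ≠ 0

theorem IsVolume.std_ne_zero {o : DForm n M n} (ho : IsVolume o) (p : M) :
    o.val p (fun i => stdVec i) ≠ 0 := fun h => ho.2 p (by
  rw [eq_smul_stdTop (o.val p), h, zero_smul])

theorem funMul_ratio {o : DForm n M n} (ho : IsVolume o) (η : DForm n M n) :
    funMul (ratio o η) o = η := DForm.ext_val fun p => top_ext (by
  change η.val p (fun i => stdVec i) / o.val p (fun i => stdVec i) * o.val p (fun i => stdVec i) = _
  rw [div_mul_cancel₀ _ (ho.std_ne_zero p)])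

theorem ratio_funMul (o : DForm n M n) (f : M → ℝ) (η : DForm n M n) :
    ratio o (funMul f η) = fun p => f p * ratio o η p := funext fun p => by
  change f p * η.val p (fun i => stdVec i) / _ = _
  rw [mul_div_assoc]
  rfl

theorem ratio_self {o : DForm n M n} (ho : IsVolume o) : ratio o o = fun _ => 1 :=
  funext fun p => div_self (ho.std_ne_zero p)

theorem ratio_add (o η η' : DForm n M n) :
    ratio o (η + η') = fun p => ratio o η p + ratio o η' p :=
  funext fun _ => add_div _ _ _

theorem ratio_smul (o : DForm n M n) (c : ℝ) (η : DForm n M n) :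
    ratio o (c • η) = fun p => c * ratio o η p :=
  funext fun _ => mul_div_assoc _ _ _

theorem chartCoeff_eq (η : DForm n M n) (x : M) (y : 𝔼) : chartCoeff η x y =
    (chartInv x y).det * η.val ((extChartAt (𝓡 n) x).symm y) fun i => stdVec i := by
  rw [chartCoeff, locRep_eq, top_comp]
  rfl

/-- The integral, over the chart around `x`, of a function with respect to the density `|o|`. -/
def chartInt (o : DForm n M n) (x : M) (f : M → ℝ) : ℝ :=
  ∫ y in (extChartAt (𝓡 n) x).target, f ((extChartAt (𝓡 n) x).symm y) * |chartCoeff o x y|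

variable [IsManifold (𝓡 n) ∞ M]

theorem chartCoeff_ratio {o : DForm n M n} (ho : IsVolume o) (η : DForm n M n) (x : M) (y : 𝔼) :
    chartCoeff η x y = ratio o η ((extChartAt (𝓡 n) x).symm y) * chartCoeff o x y := by
  conv_lhs => rw [← funMul_ratio ho η]
  rfl

theorem IsVolume.chartCoeff_ne_zero {o : DForm n M n} (ho : IsVolume o) {x : M} {y : 𝔼}
    (hy : y ∈ (extChartAt (𝓡 n) x).target) : chartCoeff o x y ≠ 0 := by
  rw [chartCoeff_eq]
  refine mul_ne_zero (fun h => ?_) (ho.std_ne_zero _)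
  have h1 := congrArg ContinuousLinearMap.det (chartDer_comp_chartInv hy)
  have h2 : (chartDer x ((extChartAt (𝓡 n) x).symm y) ∘L chartInv x y).det =
    (chartDer x ((extChartAt (𝓡 n) x).symm y)).det * (chartInv x y).det := LinearMap.det_comp _ _
  have h3 : (ContinuousLinearMap.id ℝ 𝔼).det = 1 := LinearMap.det_id
  rw [h2, h, h3, mul_zero] at h1
  exact zero_ne_one h1

theorem contDiffOn_chartCoeff {η : DForm n M n} (hη : η ∈ smoothForms n M n) (x : M) :
    ContDiffOn ℝ ∞ (chartCoeff η x) (extChartAt (𝓡 n) x).target :=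
  contDiffOn_alternating_iff.1 (hη x) _

theorem contMDiff_ratio {o η : DForm n M n} (ho : IsVolume o) (hη : η ∈ smoothForms n M n) :
    ContMDiff (𝓡 n) 𝓘(ℝ, ℝ) ∞ (ratio o η) :=
  contMDiff_of_contDiffOn_symm fun x =>
    ((contDiffOn_chartCoeff hη x).div (contDiffOn_chartCoeff ho.1 x) fun _ hy =>
      ho.chartCoeff_ne_zero hy).congr fun y hy => by
        rw [Pi.div_apply, chartCoeff_ratio ho η x y, mul_div_assoc,
          div_self (ho.chartCoeff_ne_zero hy), mul_one]

/-- The change of variables formula. -/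
theorem chartInt_eq_of_eq_zero (o : DForm n M n) (x₀ x₁ : M) {f : M → ℝ}
    (hf : ∀ p, ¬ (p ∈ (extChartAt (𝓡 n) x₀).source ∧ p ∈ (extChartAt (𝓡 n) x₁).source) → f p = 0) :
    chartInt o x₁ f = chartInt o x₀ f := by
  have hres : ∀ x x' : M, (∀ p, ¬ (p ∈ (extChartAt (𝓡 n) x).source ∧
      p ∈ (extChartAt (𝓡 n) x').source) → f p = 0) → chartInt o x' f =
      ∫ y in overlap x x', f ((extChartAt (𝓡 n) x').symm y) * |chartCoeff o x' y| := by
    intro x x' h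
    refine (setIntegral_eq_of_subset_of_forall_sdiff_eq_zero
      (isOpen_extChartAt_target x').measurableSet inter_subset_left fun y hy => ?_)
    rw [h, zero_mul]
    exact fun hc => hy.2 ⟨hy.1, hc.1⟩
  rw [hres x₀ x₁ hf, hres x₁ x₀ fun p hp => hf p fun hc => hp ⟨hc.2, hc.1⟩]
  have himg : transition x₀ x₁ '' overlap (n := n) x₀ x₁ = overlap x₁ x₀ := by
    ext z
    constructor
    · rintro ⟨y, hy, rfl⟩
      exact transition_mem_overlap hy
    · intro hz
      exact ⟨transition x₁ x₀ z, transition_mem_overlap hz, transition_transition hz⟩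
  rw [← himg, integral_image_eq_integral_abs_det_fderiv_smul volume
    (isOpen_overlap x₀ x₁).measurableSet (f' := fun y => fderiv ℝ (transition x₀ x₁) y)]
  · refine setIntegral_congr_fun (isOpen_overlap x₀ x₁).measurableSet fun y hy => ?_
    simp only [smul_eq_mul]
    rw [symm_transition hy, chartCoeff, locRep_transition hy, top_comp]
    change _ * |_ * chartCoeff o x₀ _| = _
    rw [abs_mul]
    ring
  · intro y hy
    exact (((contDiffOn_transition x₀ x₁).contDiffAt
      ((isOpen_overlap x₀ x₁).mem_nhds hy)).differentiableAt
        (by simp)).hasFDerivAt.hasFDerivWithinAt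
  · intro y hy y' hy' h
    rw [← transition_transition hy, h, transition_transition hy']

variable [T2Space M] [CompactSpace M]

theorem tsupport_chartPartition (i : M) :
    tsupport (chartPartition n M i) ⊆ (extChartAt (𝓡 n) i).source := by
  rw [extChartAt_source]
  exact (SmoothPartitionOfUnity.exists_isSubordinate_chartAt_source (𝓡 n) M).choose_spec i

/-- The indices of the functions of a partition of unity that are not identically zero. -/
def SmoothPartitionOfUnity.index (ρ : SmoothPartitionOfUnity M (𝓡 n) M univ) : Finset M :=
  (ρ.locallyFinite.finite_nonempty_of_compact).toFinset

theorem SmoothPartitionOfUnity.eq_zero_of_notMem_index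
    (ρ : SmoothPartitionOfUnity M (𝓡 n) M univ) {i : M} (hi : i ∉ ρ.index) (p : M) :
    ρ i p = 0 := by
  by_contra h
  exact hi ((Set.Finite.mem_toFinset _).2 ⟨p, h⟩)

theorem SmoothPartitionOfUnity.sum_index (ρ : SmoothPartitionOfUnity M (𝓡 n) M univ)
    (p : M) : ∑ i ∈ ρ.index, ρ i p = 1 := by
  rw [← ρ.sum_eq_one (mem_univ p)]
  refine (finsum_eq_sum_of_support_subset _ fun i hi => ?_).symm
  by_contra h
  exact hi (ρ.eq_zero_of_notMem_index h p)

theorem sign_mul_chartCoeff {o : DForm n M n} (ho : IsVolume o) (η : DForm n M n) (x : M) (y : 𝔼) :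
    Real.sign (chartCoeff o x y) * chartCoeff η x y =
      ratio o η ((extChartAt (𝓡 n) x).symm y) * |chartCoeff o x y| := by
  rw [chartCoeff_ratio ho η, mul_left_comm]
  congr 1
  rcases lt_trichotomy (chartCoeff o x y) 0 with h | h | h
  · rw [Real.sign_of_neg h, abs_of_neg h]; ring
  · simp [h]
  · rw [Real.sign_of_pos h, abs_of_pos h]; ring

/-- The integral of a function with respect to the density `|o|`. -/
def volInt (o : DForm n M n) (f : M → ℝ) : ℝ :=
  ∑ i ∈ (chartPartition n M).index, chartInt o i fun p => chartPartition n M i p * f p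

theorem finsum_eq_volInt (o : DForm n M n) (f : M → ℝ) :
    ∑ᶠ i : M, ∫ y in (extChartAt (𝓡 n) i).target,
      chartPartition n M i ((extChartAt (𝓡 n) i).symm y) *
        (f ((extChartAt (𝓡 n) i).symm y) * |chartCoeff o i y|) = volInt o f := by
  rw [volInt]
  refine (finsum_eq_sum_of_support_subset _ (s := (chartPartition n M).index)
    fun i hi => ?_).trans (Finset.sum_congr rfl fun i _ => ?_)
  · by_contra h
    refine hi ?_
    simp [(chartPartition n M).eq_zero_of_notMem_index h]
  · simp only [chartInt, mul_assoc]

/-- The integral of an `n`-form for the orientation `o` is the integral of its quotient by `o`. -/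
theorem integralForm_eq_volInt {o : DForm n M n} (ho : IsVolume o) (η : DForm n M n) :
    integralForm o η = volInt o (ratio o η) := by
  rw [← finsum_eq_volInt]
  refine finsum_congr fun i => integral_congr_ae (Filter.Eventually.of_forall fun y => ?_)
  exact congrArg _ (sign_mul_chartCoeff ho η i y)

theorem isCompact_image_chart {K : Set M} (hK : IsCompact K) {x : M}
    (hKx : K ⊆ (extChartAt (𝓡 n) x).source) : IsCompact (extChartAt (𝓡 n) x '' K) :=
  hK.image_of_continuousOn ((continuousOn_extChartAt x).mono hKx)

theorem image_chart_subset {K : Set M} {x : M} (hKx : K ⊆ (extChartAt (𝓡 n) x).source) :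
    extChartAt (𝓡 n) x '' K ⊆ (extChartAt (𝓡 n) x).target := by
  rintro _ ⟨p, hp, rfl⟩
  exact (extChartAt (𝓡 n) x).map_source (hKx hp)

theorem symm_notMem {K : Set M} {x : M} {y : 𝔼} (hy : y ∈ (extChartAt (𝓡 n) x).target)
    (h : y ∉ extChartAt (𝓡 n) x '' K) : (extChartAt (𝓡 n) x).symm y ∉ K := fun hp =>
  h ⟨_, hp, (extChartAt (𝓡 n) x).right_inv hy⟩

theorem IsVolume.continuousOn_abs {o : DForm n M n} (ho : IsVolume o) (x : M) :
    ContinuousOn (fun y => |chartCoeff o x y|) (extChartAt (𝓡 n) x).target :=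
  (contDiffOn_chartCoeff ho.1 x).continuousOn.abs

theorem chartInt_eq_integral_image (o : DForm n M n) {x : M} {f : M → ℝ} {K : Set M}
    (hKx : K ⊆ (extChartAt (𝓡 n) x).source) (h0 : ∀ p ∉ K, f p = 0) :
    chartInt o x f = ∫ y in extChartAt (𝓡 n) x '' K,
      f ((extChartAt (𝓡 n) x).symm y) * |chartCoeff o x y| := by
  refine (setIntegral_eq_of_subset_of_forall_sdiff_eq_zero
    (isOpen_extChartAt_target x).measurableSet (image_chart_subset hKx) fun y hy => ?_)
  rw [h0 _ (symm_notMem hy.1 hy.2), zero_mul]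

theorem continuousOn_chartInt {o : DForm n M n} (ho : IsVolume o) (x : M) {f : M → ℝ}
    (hf : Continuous f) :
    ContinuousOn (fun y => f ((extChartAt (𝓡 n) x).symm y) * |chartCoeff o x y|)
      (extChartAt (𝓡 n) x).target :=
  (hf.comp_continuousOn (continuousOn_extChartAt_symm x)).mul (ho.continuousOn_abs x)

theorem integrableOn_chartInt {o : DForm n M n} (ho : IsVolume o) {x : M} {f : M → ℝ}
    (hf : Continuous f) {K : Set M}
    (hK : IsCompact K) (hKx : K ⊆ (extChartAt (𝓡 n) x).source) (h0 : ∀ p ∉ K, f p = 0) :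
    IntegrableOn (fun y => f ((extChartAt (𝓡 n) x).symm y) * |chartCoeff o x y|)
      (extChartAt (𝓡 n) x).target := by
  have h1 := ((continuousOn_chartInt ho x hf).mono (image_chart_subset hKx)).integrableOn_compact
    (μ := volume) (isCompact_image_chart hK hKx)
  refine h1.of_forall_sdiff_eq_zero (isOpen_extChartAt_target x).measurableSet fun y hy => ?_
  rw [h0 _ (symm_notMem hy.1 hy.2), zero_mul]

theorem chartInt_finset_sum {o : DForm n M n} (ho : IsVolume o) {x : M} {ι : Type*} (s : Finset ι)
    {f : ι → M → ℝ} (hf : ∀ i ∈ s, Continuous (f i)) {K : Set M} (hK : IsCompact K)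
    (hKx : K ⊆ (extChartAt (𝓡 n) x).source) (h0 : ∀ i ∈ s, ∀ p ∉ K, f i p = 0) :
    chartInt o x (fun p => ∑ i ∈ s, f i p) = ∑ i ∈ s, chartInt o x (f i) := by
  simp only [chartInt, Finset.sum_mul]
  exact integral_finsetSum s fun i hi => integrableOn_chartInt ho (hf i hi) hK hKx (h0 i hi)

theorem continuous_partition (ρ : SmoothPartitionOfUnity M (𝓡 n) M univ) (i : M) :
    Continuous (ρ i) := (ρ i).contMDiff.continuous

theorem isCompact_tsupport_partition (ρ : SmoothPartitionOfUnity M (𝓡 n) M univ) (i : M) :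
    IsCompact (tsupport (ρ i)) := (isClosed_tsupport _).isCompact

theorem volInt_add {o : DForm n M n} (ho : IsVolume o) {f g : M → ℝ} (hf : Continuous f)
    (hg : Continuous g) : volInt o (fun p => f p + g p) = volInt o f + volInt o g := by
  rw [volInt, volInt, volInt, ← Finset.sum_add_distrib]
  refine Finset.sum_congr rfl fun i _ => ?_
  have hint : ∀ u : M → ℝ, Continuous u → IntegrableOn (fun y => chartPartition n M i
      ((extChartAt (𝓡 n) i).symm y) * u ((extChartAt (𝓡 n) i).symm y) * |chartCoeff o i y|)
      (extChartAt (𝓡 n) i).target := fun u hu =>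
    integrableOn_chartInt ho (f := fun p => chartPartition n M i p * u p)
      ((continuous_partition _ i).mul hu) (isCompact_tsupport_partition _ i)
      (tsupport_chartPartition i) fun p hp => by
        rw [image_eq_zero_of_notMem_tsupport hp, zero_mul]
  simp only [chartInt, mul_add, add_mul]
  exact integral_add (hint f hf) (hint g hg)

theorem volInt_const_mul (o : DForm n M n) (c : ℝ) (f : M → ℝ) :
    volInt o (fun p => c * f p) = c * volInt o f := by
  simp only [volInt, chartInt, Finset.mul_sum]
  refine Finset.sum_congr rfl fun i _ => ?_
  rw [← integral_const_mul]
  exact integral_congr_ae (Filter.Eventually.of_forall fun y => by ring)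

/-- The integral of a function supported in a chart can be computed in that chart. -/
theorem volInt_eq_chartInt {o : DForm n M n} (ho : IsVolume o) {x : M} {f : M → ℝ}
    (hf : Continuous f) {K : Set M} (hK : IsCompact K)
    (hKx : K ⊆ (extChartAt (𝓡 n) x).source) (h0 : ∀ p ∉ K, f p = 0) :
    volInt o f = chartInt o x f := by
  have h1 : ∀ i, chartInt o i (fun p => chartPartition n M i p * f p) =
      chartInt o x fun p => chartPartition n M i p * f p := by
    intro i
    refine chartInt_eq_of_eq_zero o x i fun p hp => ?_
    by_cases hpK : p ∈ K
    · have : p ∉ tsupport (chartPartition n M i) := fun h =>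
        hp ⟨hKx hpK, tsupport_chartPartition i h⟩
      rw [image_eq_zero_of_notMem_tsupport this, zero_mul]
    · rw [h0 p hpK, mul_zero]
  rw [volInt, Finset.sum_congr rfl fun i _ => h1 i, ← chartInt_finset_sum ho _
    (f := fun i p => chartPartition n M i p * f p)
    (fun i _ => (continuous_partition _ i).mul hf) hK hKx fun i _ p hp => by rw [h0 p hp, mul_zero]]
  congr 1
  funext p
  rw [← Finset.sum_mul, SmoothPartitionOfUnity.sum_index, one_mul]

theorem chartInt_nonneg (o : DForm n M n) (x : M) {f : M → ℝ} (hf : ∀ p, 0 ≤ f p) :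
    0 ≤ chartInt o x f :=
  integral_nonneg fun _ => mul_nonneg (hf _) (abs_nonneg _)

/-- The density `|o|` has full support: a nonnegative continuous function of integral zero vanishes.
-/
theorem eq_zero_of_volInt_eq_zero {o : DForm n M n} (ho : IsVolume o) {f : M → ℝ}
    (hf : Continuous f) (hpos : ∀ p, 0 ≤ f p) (h : volInt o f = 0) (p : M) : f p = 0 := by
  by_contra hne
  obtain ⟨i, hi, hip⟩ : ∃ i ∈ (chartPartition n M).index, chartPartition n M i p ≠ 0 := by
    by_contra! hcon
    have := (chartPartition n M).sum_index p
    rw [Finset.sum_eq_zero hcon] at this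
    exact zero_ne_one this
  have hnn : ∀ i p, 0 ≤ chartPartition n M i p * f p := fun i p =>
    mul_nonneg ((chartPartition n M).nonneg i p) (hpos p)
  have h1 : chartInt o i (fun p => chartPartition n M i p * f p) = 0 :=
    (Finset.sum_eq_zero_iff_of_nonneg fun i _ => chartInt_nonneg o i (hnn i)).1 h i hi
  have hps : p ∈ (extChartAt (𝓡 n) i).source :=
    tsupport_chartPartition i (subset_tsupport _ hip)
  have hcont := continuousOn_chartInt ho i (f := fun p => chartPartition n M i p * f p)
    ((continuous_partition _ i).mul hf)
  have hint := integrableOn_chartInt ho (f := fun p => chartPartition n M i p * f p)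
      ((continuous_partition _ i).mul hf) (isCompact_tsupport_partition _ i)
      (tsupport_chartPartition i) fun p hp => by
        rw [image_eq_zero_of_notMem_tsupport hp, zero_mul]
  have h2 := (setIntegral_eq_zero_iff_of_nonneg_ae (Filter.Eventually.of_forall fun y =>
    mul_nonneg (hnn i _) (abs_nonneg _)) hint).1 h1
  have h3 := Measure.eqOn_open_of_ae_eq h2 (isOpen_extChartAt_target i) hcont continuousOn_const
    ((extChartAt (𝓡 n) i).map_source hps)
  have h4 : chartPartition n M i p * f p * |chartCoeff o i (extChartAt (𝓡 n) i p)| = 0 := by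
    have := h3
    simp only [(extChartAt (𝓡 n) i).left_inv hps] at this
    exact this
  exact mul_ne_zero (mul_ne_zero hip hne)
    (abs_ne_zero.2 (ho.chartCoeff_ne_zero ((extChartAt (𝓡 n) i).map_source hps))) h4

end Integral

/-! ### Operators on smooth forms -/

section Operators

variable {n : ℕ} {M : Type*} [TopologicalSpace M] [ChartedSpace (EuclideanSpace ℝ (Fin n)) M]
  [IsManifold (𝓡 n) ∞ M]

local notation "𝔼" => EuclideanSpace ℝ (Fin n)

/-- The exterior derivative on smooth forms. -/
def extDL (k : ℕ) : smoothForms n M k →ₗ[ℝ] smoothForms n M (k + 1) where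
  toFun α := ⟨extD α.1, extD_mem α.2⟩
  map_add' α β := Subtype.ext (extD_add α.2 β.2)
  map_smul' c α := Subtype.ext (extD_smul c α.1)

/-- Multiplication of smooth forms by a smooth function. -/
def funMulL {f : M → ℝ} (hf : ContMDiff (𝓡 n) 𝓘(ℝ, ℝ) ∞ f) (k : ℕ) :
    smoothForms n M k →ₗ[ℝ] smoothForms n M k where
  toFun α := ⟨funMul f α.1, funMul_mem hf α.2⟩
  map_add' α β := Subtype.ext (funext fun p => smul_add (f p) (α.1.val p) (β.1.val p))
  map_smul' c α := Subtype.ext (funext fun p => smul_comm (f p) c (α.1.val p))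

/-- The exterior derivative is local. -/
theorem extD_eq_zero_of_isOpen {k : ℕ} {α : DForm n M k} (hα : α ∈ smoothForms n M k) {V : Set M}
    (hV : IsOpen V) (h0 : ∀ p ∈ V, α.val p = 0) {p : M} (hp : p ∈ V) : (extD α).val p = 0 := by
  have h1 : locRep p α =ᶠ[𝓝 (extChartAt (𝓡 n) p p)] fun _ => 0 := by
    have h2 : (extChartAt (𝓡 n) p).symm ⁻¹' V ∈ 𝓝 (extChartAt (𝓡 n) p p) := by
      refine (continuousAt_extChartAt_symm p).preimage_mem_nhds (hV.mem_nhds ?_)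
      rwa [extChartAt_to_inv]
    filter_upwards [h2] with z hz
    rw [locRep_eq, h0 _ hz]
    rfl
  rw [val_eq_locRep _ (mem_extChartAt_source p), locRep_extD hα (mem_extChartAt_target p),
    h1.extDeriv_eq, extDeriv_const]
  rfl

theorem extD_eq_zero_off {k : ℕ} {α : DForm n M k} (hα : α ∈ smoothForms n M k) {K : Set M}
    (hK : IsClosed K) (h0 : ∀ p ∉ K, α.val p = 0) : ∀ p ∉ K, (extD α).val p = 0 := fun _ hp =>
  extD_eq_zero_of_isOpen hα hK.isOpen_compl h0 hp

/-- The exterior product of a closed 1-form with a form. -/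
theorem extD_wedgeForm_closed {k : ℕ} {θ : DForm n M 1} (hθ : θ ∈ smoothForms n M 1)
    (hθ0 : extD θ = 0) {β : DForm n M k} (hβ : β ∈ smoothForms n M k) :
    extD (wedgeForm (Nat.add_comm 1 k) θ β) =
      -wedgeForm (Nat.add_comm 1 (k + 1)) θ (extD β) := by
  refine DForm.ext_locRep fun x y hy => ?_
  set T : 𝔼 → 𝔼 →L[ℝ] ℝ := fun z =>
    (ContinuousAlternatingMap.ofSubsingletonLIE (𝕜 := ℝ) (E := 𝔼) (F := ℝ)
      (i := (0 : Fin 1))).symm (locRep x θ z) with hT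
  have hTθ : ∀ z, locRep x θ z = covecForm (T z) := fun z =>
    ((ContinuousAlternatingMap.ofSubsingletonLIE (𝕜 := ℝ) (E := 𝔼) (F := ℝ)
      (i := (0 : Fin 1))).apply_symm_apply _).symm
  have hTd : DifferentiableAt ℝ T y :=
    (ContinuousAlternatingMap.ofSubsingletonLIE (𝕜 := ℝ) (E := 𝔼) (F := ℝ)
      (i := (0 : Fin 1))).symm.toContinuousLinearEquiv.differentiableAt.comp y
      ((contDiffAt_locRep hθ hy).differentiableAt (by simp))
  have hsymm : ∀ u v, fderiv ℝ T y u v = fderiv ℝ T y v u := by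
    intro u v
    have h1 : extDeriv (locRep x θ) y = 0 := by
      rw [← locRep_extD hθ hy, hθ0]; rfl
    have h2 := extDeriv_apply ((contDiffAt_locRep hθ hy).differentiableAt (by simp)) ![u, v]
    have h3 : ∀ a b : 𝔼, fderiv ℝ (fun z => locRep x θ z ![a]) y b = fderiv ℝ T y b a := by
      intro a b
      have : (fun z => locRep x θ z ![a]) = fun z => T z a := funext fun z => by
        rw [hTθ]; rfl
      rw [this, fderiv_clm_apply hTd (differentiableAt_const a)]
      simp
    have h4 : (0 : Fin 2).removeNth ![u, v] = ![v] := by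
      ext i; fin_cases i; rfl
    have h5 : (1 : Fin 2).removeNth ![u, v] = ![u] := by
      ext i; fin_cases i; rfl
    rw [h1, Fin.sum_univ_two, h4, h5, h3, h3] at h2
    simp only [Fin.val_zero, pow_zero, one_smul, Fin.val_one, pow_one, Matrix.cons_val_zero,
      Matrix.cons_val_one] at h2
    have h6 : (0 : 𝔼 [⋀^Fin 2]→L[ℝ] ℝ) ![u, v] = 0 := rfl
    rw [h6] at h2
    have h7 : (-1 : ℤ) • fderiv ℝ T y v u = -fderiv ℝ T y v u := by simp
    linarith [h2, h7]
  have hneg : locRep x (-wedgeForm (Nat.add_comm 1 (k + 1)) θ (extD β)) y =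
      -locRep x (wedgeForm (Nat.add_comm 1 (k + 1)) θ (extD β)) y := rfl
  rw [locRep_extD (wedgeForm_mem _ hθ hβ) hy, hneg, locRep_wedgeForm, hTθ, wedge_covecForm_left,
    locRep_extD hβ hy, ← extDeriv_covecWedge hTd
      ((contDiffAt_locRep hβ hy).differentiableAt (by simp)) hsymm]
  congr 1
  funext z
  rw [locRep_wedgeForm, hTθ, wedge_covecForm_left]

/-- Exterior multiplication by a 1-form from the right and from the left. -/
theorem wedgeForm_one_right {k : ℕ} (α : DForm n M k) (θ : DForm n M 1) :
    wedgeForm rfl α θ = (-1 : ℝ) ^ k • wedgeForm (Nat.add_comm 1 k) θ α := by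
  refine DForm.ext_val fun p => ?_
  obtain ⟨T, hT⟩ : ∃ T : 𝔼 →L[ℝ] ℝ, θ.val p = covecForm T :=
    ⟨_, ((ContinuousAlternatingMap.ofSubsingletonLIE (𝕜 := ℝ) (E := 𝔼) (F := ℝ)
      (i := (0 : Fin 1))).apply_symm_apply (θ.val p)).symm⟩
  change wedge rfl (α.val p) (θ.val p) =
    (-1 : ℝ) ^ k • wedge (Nat.add_comm 1 k) (θ.val p) (α.val p)
  rw [hT, wedge_covecForm_left, wedge_covecForm_right]

theorem funMul_eq_zero_of_notMem {k : ℕ} {f : M → ℝ} (α : DForm n M k) {p : M}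
    (hp : p ∉ tsupport f) : (funMul f α).val p = 0 := by
  change f p • α.val p = 0
  rw [image_eq_zero_of_notMem_tsupport hp, zero_smul]

end Operators

/-! ### Stokes' theorem -/

section Stokes

open MeasureTheory

/-- Stokes' theorem for compactly supported forms on Euclidean space. -/
theorem integral_extDeriv_eq_zero {d : ℕ}
    {b : EuclideanSpace ℝ (Fin (d + 1)) → (EuclideanSpace ℝ (Fin (d + 1))) [⋀^Fin d]→L[ℝ] ℝ}
    (hb : ContDiff ℝ ∞ b) {K : Set (EuclideanSpace ℝ (Fin (d + 1)))} (hK : IsCompact K)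
    (h0 : ∀ y ∉ K, b y = 0) : ∫ y, extDeriv b y (fun i => stdVec i) = 0 := by
  set X : Fin (d + 1) → EuclideanSpace ℝ (Fin (d + 1)) → ℝ := fun j y =>
    covecWedge (EuclideanSpace.proj (𝕜 := ℝ) j) (b y) (fun i => stdVec i) with hXdef
  have hX : ∀ j, ContDiff ℝ ∞ (X j) := fun j => by
    simp only [hXdef, covecWedge_apply]
    exact ContDiff.sum fun i _ => contDiff_const.mul (contDiff_const.mul
      (contDiff_alternating_iff.1 hb _))
  have hXc : ∀ j, HasCompactSupport (X j) := fun j =>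
    HasCompactSupport.of_support_subset_isCompact hK fun y hy => by
      by_contra h
      exact hy (by simp [hXdef, covecWedge_apply, h0 y h])
  have hbX : b = fun y => ∑ j, X j y • (stdTop (d + 1)).curryLeft (stdVec j) :=
    funext fun y => eq_sum_curryLeft_stdTop (b y)
  have h1 : ∀ y, extDeriv b y (fun i => stdVec i) = ∑ j, pderiv j (X j) y := fun y => by
    conv_lhs => rw [hbX]
    rw [extDeriv_sum_curryLeft hX]
    change _ * stdTop (d + 1) (fun i => stdVec i) = _
    rw [stdTop_apply, mul_one]
  simp_rw [h1]
  rw [integral_finsetSum]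
  · exact Finset.sum_eq_zero fun j _ => integral_fderiv_eq_zero (hX j) (hXc j) _
  · exact fun j _ => (contDiff_pderiv j (hX j)).continuous.integrable_of_hasCompactSupport
      ((hXc j).fderiv_apply ℝ _)

theorem eventually_sign_eq {X : Type*} [TopologicalSpace X] {f : X → ℝ} {x : X}
    (hf : ContinuousAt f x) (h : f x ≠ 0) : ∀ᶠ z in 𝓝 x, Real.sign (f z) = Real.sign (f x) := by
  rcases lt_or_gt_of_ne h with h | h
  · filter_upwards [hf.eventually_lt continuousAt_const h] with z hz
    rw [Real.sign_of_neg h, Real.sign_of_neg hz]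
  · filter_upwards [continuousAt_const.eventually_lt hf h] with z hz
    rw [Real.sign_of_pos h, Real.sign_of_pos hz]

section Linear

variable {n : ℕ} {M : Type*} [TopologicalSpace M] [ChartedSpace (EuclideanSpace ℝ (Fin n)) M]
  [IsManifold (𝓡 n) ∞ M] [T2Space M] [CompactSpace M]

local notation "𝔼" => EuclideanSpace ℝ (Fin n)

theorem IsVolume.continuous_ratio {o η : DForm n M n} (ho : IsVolume o)
    (hη : η ∈ smoothForms n M n) : Continuous (ratio o η) := (contMDiff_ratio ho hη).continuous

/-- The integral as a linear functional on smooth forms of top degree. -/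
def intL {o : DForm n M n} (ho : IsVolume o) : smoothForms n M n →ₗ[ℝ] ℝ where
  toFun η := integralForm o η.1
  map_add' η η' := by
    rw [integralForm_eq_volInt ho, integralForm_eq_volInt ho, integralForm_eq_volInt ho,
      ← volInt_add ho (ho.continuous_ratio η.2) (ho.continuous_ratio η'.2), ← ratio_add]
    rfl
  map_smul' c η := by
    rw [integralForm_eq_volInt ho, integralForm_eq_volInt ho, RingHom.id_apply, smul_eq_mul,
      ← volInt_const_mul, ← ratio_smul]
    rfl

theorem intL_apply {o : DForm n M n} (ho : IsVolume o) (η : smoothForms n M n) :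
    intL ho η = integralForm o η.1 := rfl

/-- The integral of a form supported in a chart, as an integral in the chart. -/
theorem integralForm_eq_setIntegral {o : DForm n M n} (ho : IsVolume o) {η : DForm n M n}
    (hη : η ∈ smoothForms n M n) {K : Set M} (hK : IsCompact K) {x : M}
    (hKx : K ⊆ (extChartAt (𝓡 n) x).source) (h0 : ∀ p ∉ K, η.val p = 0) :
    integralForm o η = ∫ y in (extChartAt (𝓡 n) x).target,
      Real.sign (chartCoeff o x y) * chartCoeff η x y := by
  rw [integralForm_eq_volInt ho, volInt_eq_chartInt ho (ho.continuous_ratio hη) hK hKx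
    fun p hp => by rw [ratio, h0 p hp]; exact zero_div _]
  exact integral_congr_ae (Filter.Eventually.of_forall fun y => (sign_mul_chartCoeff ho η x y).symm)

theorem val_sum {ι : Type*} {k : ℕ} (s : Finset ι) (F : ι → smoothForms n M k) (p : M) :
    (∑ i ∈ s, F i : smoothForms n M k).1.val p = ∑ i ∈ s, (F i).1.val p := by
  rw [Submodule.coe_sum]
  exact Finset.sum_apply p _ _

/-- A partition of unity decomposes a form. -/
theorem sum_funMulL (ρ : SmoothPartitionOfUnity M (𝓡 n) M univ) {k : ℕ} (α : smoothForms n M k) :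
    ∑ i ∈ ρ.index, funMulL (ρ i).contMDiff k α = α := by
  refine Subtype.ext (DForm.ext_val fun p => ?_)
  have h1 : (∑ i ∈ ρ.index, funMulL (ρ i).contMDiff k α : smoothForms n M k).1.val p =
    ∑ i ∈ ρ.index, ρ i p • α.1.val p := val_sum _ _ p
  rw [h1, ← Finset.sum_smul, ρ.sum_index, one_smul]

end Linear

variable {d : ℕ} {M : Type*} [TopologicalSpace M] [ChartedSpace (EuclideanSpace ℝ (Fin (d + 1))) M]
  [IsManifold (𝓡 (d + 1)) ∞ M] [T2Space M] [CompactSpace M]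

/-- Stokes' theorem for forms supported in a chart. The orientation sign of the chart is locally
constant, so that it can be moved into the form before the theorem in Euclidean space is applied. -/
theorem integralForm_extD_of_support {o : DForm (d + 1) M (d + 1)} (ho : IsVolume o)
    {β : DForm (d + 1) M d} (hβ : β ∈ smoothForms (d + 1) M d) {K : Set M} (hK : IsCompact K)
    {x : M} (hKx : K ⊆ (extChartAt (𝓡 (d + 1)) x).source) (h0 : ∀ p ∉ K, β.val p = 0) :
    integralForm o (extD β) = 0 := by
  classical
  rw [integralForm_eq_setIntegral ho (extD_mem hβ) hK hKx (extD_eq_zero_off hβ hK.isClosed h0)]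
  set U := (extChartAt (𝓡 (d + 1)) x).target
  have hU : IsOpen U := isOpen_extChartAt_target x
  set b : EuclideanSpace ℝ (Fin (d + 1)) → (EuclideanSpace ℝ (Fin (d + 1))) [⋀^Fin d]→L[ℝ] ℝ :=
    fun y => if y ∈ U then Real.sign (chartCoeff o x y) • locRep x β y else 0 with hb
  have hbU : ∀ y ∈ U, b y = Real.sign (chartCoeff o x y) • locRep x β y := fun y hy => if_pos hy
  have hev : ∀ y ∈ U, b =ᶠ[𝓝 y] fun z => Real.sign (chartCoeff o x y) • locRep x β z := by
    intro y hy
    filter_upwards [hU.mem_nhds hy, eventually_sign_eq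
      ((contDiffOn_chartCoeff ho.1 x).continuousOn.continuousAt (hU.mem_nhds hy))
      (ho.chartCoeff_ne_zero hy)] with z hz hz'
    rw [hbU z hz, hz']
  have hK' := isCompact_image_chart hK hKx
  have hb0 : ∀ y ∉ extChartAt (𝓡 (d + 1)) x '' K, b y = 0 := by
    intro y hy
    by_cases hyU : y ∈ U
    · rw [hbU y hyU, locRep_eq, h0 _ (symm_notMem hyU hy)]
      exact smul_zero _
    · exact if_neg hyU
  have hbs : ContDiff ℝ ∞ b := by
    refine contDiff_of_eq_zero hU hK'.isClosed (image_chart_subset hKx) (fun y hy => ?_) hb0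
    have h1 : ContDiffAt ℝ ∞ (fun z => Real.sign (chartCoeff o x y) • locRep x β z) y :=
      ContDiffAt.const_smul (Real.sign (chartCoeff o x y)) (contDiffAt_locRep hβ hy)
    exact (h1.congr_of_eventuallyEq (hev y hy)).contDiffWithinAt
  rw [← integral_extDeriv_eq_zero hbs hK' hb0]
  rw [← setIntegral_eq_integral_of_forall_compl_eq_zero (μ := volume) (s := U)]
  · refine setIntegral_congr_fun hU.measurableSet fun y hy => ?_
    have h1 : extDeriv b y = Real.sign (chartCoeff o x y) • extDeriv (locRep x β) y := by
      exact (hev y hy).extDeriv_eq.trans (extDeriv_smul _ _)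
    simp only [h1, chartCoeff, locRep_extD hβ hy]
    rfl
  · intro y hy
    have h1 : b =ᶠ[𝓝 y] fun _ => 0 := Filter.eventually_of_mem
      (hK'.isClosed.isOpen_compl.mem_nhds fun h => hy (image_chart_subset hKx h)) hb0
    rw [h1.extDeriv_eq, extDeriv_const]
    rfl

/-- Stokes' theorem on a closed manifold. -/
theorem integralForm_extD {o : DForm (d + 1) M (d + 1)} (ho : IsVolume o)
    {β : DForm (d + 1) M d} (hβ : β ∈ smoothForms (d + 1) M d) : integralForm o (extD β) = 0 := by
  have h1 := sum_funMulL (chartPartition (d + 1) M) (⟨β, hβ⟩ : smoothForms (d + 1) M d)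
  change intL ho (extDL d ⟨β, hβ⟩) = 0
  rw [← h1, map_sum, map_sum]
  refine Finset.sum_eq_zero fun i _ => ?_
  exact integralForm_extD_of_support ho (funMul_mem ((chartPartition (d + 1) M) i).contMDiff hβ)
    (isCompact_tsupport_partition _ i) (tsupport_chartPartition i)
    fun p hp => funMul_eq_zero_of_notMem β hp

/-- Integration by parts: `∫ f dα = - ∫ df ∧ α`. -/
theorem integralForm_funMul_extD {o : DForm (d + 1) M (d + 1)} (ho : IsVolume o)
    {f : M → ℝ} (hf : ContMDiff (𝓡 (d + 1)) 𝓘(ℝ, ℝ) ∞ f) {α : DForm (d + 1) M d}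
    (hα : α ∈ smoothForms (d + 1) M d) : integralForm o (funMul f (extD α)) =
      -integralForm o (wedgeForm (Nat.add_comm 1 d) (dFun f) α) := by
  have h1 := integralForm_extD ho (funMul_mem hf hα)
  rw [extD_funMul hf hα] at h1
  have h2 := map_add (intL ho)
    ⟨wedgeForm (Nat.add_comm 1 d) (dFun f) α, wedgeForm_mem _ (dFun_mem hf) hα⟩
    ⟨funMul f (extD α), funMul_mem hf (extD_mem hα)⟩
  have h3 : integralForm o (wedgeForm (Nat.add_comm 1 d) (dFun f) α + funMul f (extD α)) =
    integralForm o (wedgeForm (Nat.add_comm 1 d) (dFun f) α) +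
      integralForm o (funMul f (extD α)) := h2
  linarith

end Stokes

/-! ### Forms supported in chart cubes -/

section Cubes

open MeasureTheory

variable {n : ℕ} {M : Type*} [TopologicalSpace M] [ChartedSpace (EuclideanSpace ℝ (Fin n)) M]

local notation "𝔼" => EuclideanSpace ℝ (Fin n)

/-- `V` is the closed cube with centre `c` and side `2 r` in the chart around `x`. -/
structure IsChartCube (x : M) (c : EuclideanSpace ℝ (Fin n)) (r : ℝ) (V : Set M) : Prop where
  pos : 0 < r
  subset : cube c r ⊆ (extChartAt (𝓡 n) x).target
  eq : V = (extChartAt (𝓡 n) x).symm '' cube c r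

/-- The smooth forms that vanish outside `V`. -/
def formsIn (n : ℕ) (M : Type*) [TopologicalSpace M] [ChartedSpace (EuclideanSpace ℝ (Fin n)) M]
    (V : Set M) (k : ℕ) : Submodule ℝ (smoothForms n M k) where
  carrier := {α | ∀ p ∉ V, α.1.val p = 0}
  add_mem' {α β} hα hβ p hp := by
    change α.1.val p + β.1.val p = 0
    rw [hα p hp, hβ p hp, add_zero]
  zero_mem' _ _ := rfl
  smul_mem' c α hα p hp := by
    change c • α.1.val p = 0
    rw [hα p hp, smul_zero]

theorem formsIn_mono {V W : Set M} (h : V ⊆ W) (k : ℕ) : formsIn n M V k ≤ formsIn n M W k :=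
  fun _ hα p hp => hα p fun hV => hp (h hV)

variable {x : M} {c : EuclideanSpace ℝ (Fin n)} {r : ℝ} {V : Set M}

theorem IsChartCube.isCompact (h : IsChartCube x c r V) : IsCompact V := by
  rw [h.eq]
  exact (isCompact_cube c r).image_of_continuousOn ((continuousOn_extChartAt_symm x).mono h.subset)

theorem IsChartCube.subset_source (h : IsChartCube x c r V) : V ⊆ (extChartAt (𝓡 n) x).source := by
  rw [h.eq]
  rintro _ ⟨y, hy, rfl⟩
  exact (extChartAt (𝓡 n) x).map_target (h.subset hy)

theorem IsChartCube.symm_mem_iff (h : IsChartCube x c r V) {y : 𝔼}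
    (hy : y ∈ (extChartAt (𝓡 n) x).target) :
    (extChartAt (𝓡 n) x).symm y ∈ V ↔ y ∈ cube c r := by
  rw [h.eq]
  constructor
  · rintro ⟨z, hz, hzy⟩
    rwa [← (extChartAt (𝓡 n) x).symm.injOn (h.subset hz) hy hzy]
  · exact fun hy => ⟨y, hy, rfl⟩

theorem cube_subset_closedBall [NeZero n] (c : 𝔼) {r : ℝ} (hr : 0 ≤ r) :
    cube c r ⊆ Metric.closedBall c (n * r) := by
  intro y hy
  rw [Metric.mem_closedBall, EuclideanSpace.dist_eq]
  refine Real.sqrt_le_iff.2 ⟨by positivity, ?_⟩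
  calc ∑ i, dist (y i) (c i) ^ 2 ≤ ∑ _i : Fin n, r ^ 2 := Finset.sum_le_sum fun i _ => by
        rw [Real.dist_eq]
        exact pow_le_pow_left₀ (abs_nonneg _) (hy i) 2
    _ = n * r ^ 2 := by simp
    _ ≤ (n * r) ^ 2 := by
        rw [mul_pow]
        have h1 : (1 : ℝ) ≤ n := by exact_mod_cast NeZero.one_le
        exact mul_le_mul_of_nonneg_right (by nlinarith) (sq_nonneg r)

theorem cube_mem_nhds (c : 𝔼) {r : ℝ} (hr : 0 < r) : cube c r ∈ 𝓝 c := by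
  have h1 : ∀ j : Fin n, {y : 𝔼 | |y j - c j| < r} ∈ 𝓝 c := fun j =>
    (isOpen_lt (((contDiff_coord j).continuous.sub continuous_const).abs)
      continuous_const).mem_nhds (by simpa using hr)
  filter_upwards [Filter.iInter_mem.2 h1] with y hy j
  exact (mem_iInter.1 hy j).le

/-- Chart cubes around a point form a basis of its neighbourhoods. -/
theorem exists_isChartCube [NeZero n] (p : M) {U : Set M} (hU : U ∈ 𝓝 p) :
    ∃ V ⊆ U, V ∈ 𝓝 p ∧ ∃ r, IsChartCube p (extChartAt (𝓡 n) p p) r V := by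
  have h1 : (extChartAt (𝓡 n) p).target ∩ (extChartAt (𝓡 n) p).symm ⁻¹' U ∈
      𝓝 (extChartAt (𝓡 n) p p) := by
    refine Filter.inter_mem ((isOpen_extChartAt_target p).mem_nhds (mem_extChartAt_target p)) ?_
    refine (continuousAt_extChartAt_symm p).preimage_mem_nhds ?_
    rwa [extChartAt_to_inv]
  obtain ⟨ε, hε, hεU⟩ := Metric.nhds_basis_closedBall.mem_iff.1 h1
  have hn : (0 : ℝ) < n := by exact_mod_cast NeZero.pos n
  have hr : 0 < ε / n := div_pos hε hn
  have hsub : cube (extChartAt (𝓡 n) p p) (ε / n) ⊆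
      (extChartAt (𝓡 n) p).target ∩ (extChartAt (𝓡 n) p).symm ⁻¹' U := fun y hy => by
    refine hεU ?_
    have := cube_subset_closedBall _ hr.le hy
    rwa [mul_div_cancel₀ _ hn.ne'] at this
  refine ⟨_, ?_, ?_, ε / n, hr, fun y hy => (hsub hy).1, rfl⟩
  · rintro _ ⟨y, hy, rfl⟩
    exact (hsub hy).2
  · have h2 := (continuousAt_extChartAt (I := 𝓡 n) p).preimage_mem_nhds
      (cube_mem_nhds (extChartAt (𝓡 n) p p) hr)
    filter_upwards [h2, extChartAt_source_mem_nhds (I := 𝓡 n) p] with q hq hqs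
    exact ⟨_, hq, (extChartAt (𝓡 n) p).left_inv hqs⟩

open scoped Classical in
/-- The coordinate expression of a form, extended by zero. -/
def zeroRep {k : ℕ} (x : M) (α : DForm n M k) (y : EuclideanSpace ℝ (Fin n)) :
    (EuclideanSpace ℝ (Fin n)) [⋀^Fin k]→L[ℝ] ℝ :=
  if y ∈ (extChartAt (𝓡 n) x).target then locRep x α y else 0

theorem zeroRep_eq {k : ℕ} {x : M} (α : DForm n M k) {y : 𝔼}
    (hy : y ∈ (extChartAt (𝓡 n) x).target) : zeroRep x α y = locRep x α y := if_pos hy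

theorem IsChartCube.zeroRep_eq_zero (h : IsChartCube x c r V) {k : ℕ} {α : smoothForms n M k}
    (hα : α ∈ formsIn n M V k) : ∀ y ∉ cube c r, zeroRep x α.1 y = 0 := by
  intro y hy
  by_cases hyt : y ∈ (extChartAt (𝓡 n) x).target
  · rw [zeroRep_eq _ hyt, locRep_eq, hα _ fun hV => hy ((h.symm_mem_iff hyt).1 hV)]
    rfl
  · exact if_neg hyt

theorem IsChartCube.contDiff_zeroRep (h : IsChartCube x c r V) {k : ℕ} {α : smoothForms n M k}
    (hα : α ∈ formsIn n M V k) : ContDiff ℝ ∞ (zeroRep x α.1) :=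
  contDiff_of_eq_zero (isOpen_extChartAt_target x) (isClosed_cube c r) h.subset
    ((α.2 x).congr fun _ hy => zeroRep_eq _ hy) (h.zeroRep_eq_zero hα)

open scoped Classical in
/-- The form on the manifold with a given coordinate expression in the chart around `x`, extended
by zero. -/
def ofChart {k : ℕ} (x : M) (b : EuclideanSpace ℝ (Fin n) →
    (EuclideanSpace ℝ (Fin n)) [⋀^Fin k]→L[ℝ] ℝ) : DForm n M k := fun p =>
  if p ∈ (extChartAt (𝓡 n) x).source then
    (b (extChartAt (𝓡 n) x p)).compContinuousLinearMap (chartDer x p) else 0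

variable [IsManifold (𝓡 n) ∞ M]

theorem locRep_ofChart {k : ℕ} {x : M} (b : 𝔼 → 𝔼 [⋀^Fin k]→L[ℝ] ℝ) {x' : M} {y : 𝔼}
    (hy : y ∈ overlap (n := n) x x') : locRep x' (ofChart x b) y =
      (b (transition x x' y)).compContinuousLinearMap (fderiv ℝ (transition x x') y) := by
  have h1 : (ofChart x b).val ((extChartAt (𝓡 n) x').symm y) =
      (b (transition x x' y)).compContinuousLinearMap
        (chartDer x ((extChartAt (𝓡 n) x').symm y)) := if_pos hy.2
  rw [locRep_eq, h1, comp_comp, fderiv_transition hy]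

theorem locRep_ofChart_self {k : ℕ} {x : M} (b : 𝔼 → 𝔼 [⋀^Fin k]→L[ℝ] ℝ) {y : 𝔼}
    (hy : y ∈ (extChartAt (𝓡 n) x).target) : locRep x (ofChart x b) y = b y := by
  have h1 : (ofChart x b).val ((extChartAt (𝓡 n) x).symm y) =
      (b y).compContinuousLinearMap (chartDer x ((extChartAt (𝓡 n) x).symm y)) := by
    refine (if_pos ((extChartAt (𝓡 n) x).map_target hy)).trans ?_
    rw [(extChartAt (𝓡 n) x).right_inv hy]
    rfl
  rw [locRep_eq, h1, comp_comp, chartDer_comp_chartInv hy, comp_id]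

theorem IsChartCube.ofChart_eq_zero (h : IsChartCube x c r V) {k : ℕ}
    {b : 𝔼 → 𝔼 [⋀^Fin k]→L[ℝ] ℝ} (hb0 : ∀ y ∉ cube c r, b y = 0) {p : M} (hp : p ∉ V) :
    (ofChart x b).val p = 0 := by
  by_cases hps : p ∈ (extChartAt (𝓡 n) x).source
  · refine (if_pos hps).trans ?_
    rw [hb0]
    · rfl
    · intro hc
      refine hp ?_
      rw [← (extChartAt (𝓡 n) x).left_inv hps]
      exact (h.symm_mem_iff ((extChartAt (𝓡 n) x).map_source hps)).2 hc
  · exact if_neg hps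

/-- A smooth coordinate expression supported in a chart cube extends by zero to a smooth form. -/
theorem IsChartCube.ofChart_mem [T2Space M] (h : IsChartCube x c r V) {k : ℕ}
    {b : 𝔼 → 𝔼 [⋀^Fin k]→L[ℝ] ℝ} (hb : ContDiff ℝ ∞ b) (hb0 : ∀ y ∉ cube c r, b y = 0) :
    ofChart x b ∈ smoothForms n M k := by
  intro x' y hy
  refine ContDiffAt.contDiffWithinAt ?_
  by_cases hyV : (extChartAt (𝓡 n) x').symm y ∈ V
  · have hov : y ∈ overlap (n := n) x x' := ⟨hy, h.subset_source hyV⟩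
    have hev := (isOpen_overlap x x').mem_nhds hov
    have h1 := contDiffOn_transition (n := n) x x'
    have h2 : ContDiffOn ℝ ∞ (fun z => b (transition x x' z)) (overlap x x') :=
      hb.comp_contDiffOn h1
    have h3 := h1.fderiv_of_isOpen (isOpen_overlap x x') (m := ∞) (by simp)
    have h4 : ContDiffOn ℝ ∞ (fun z => (b (transition x x' z)).compContinuousLinearMap
        (fderiv ℝ (transition x x') z)) (overlap x x') :=
      contDiffOn_alternating_iff.2 fun v => h2.alternating_apply fun i =>
        h3.clm_apply contDiffOn_const
    refine (h4.contDiffAt hev).congr_of_eventuallyEq ?_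
    filter_upwards [hev] with z hz
    exact locRep_ofChart b hz
  · have hcl := h.isCompact.isClosed
    have h1 : (extChartAt (𝓡 n) x').symm ⁻¹' Vᶜ ∈ 𝓝 y :=
      (continuousAt_extChartAt_symm'' hy).preimage_mem_nhds (hcl.isOpen_compl.mem_nhds hyV)
    refine (contDiffAt_const (c := 0)).congr_of_eventuallyEq ?_
    filter_upwards [h1] with z hz
    rw [locRep_eq, h.ofChart_eq_zero hb0 hz]
    rfl

/-- Primitives in a cube of Euclidean space give primitives on the manifold. -/
theorem IsChartCube.exists_extD_eq [T2Space M] (h : IsChartCube x c r V) {k : ℕ}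
    {α : smoothForms n M (k + 1)} (hα : α ∈ formsIn n M V (k + 1))
    {b : 𝔼 → 𝔼 [⋀^Fin k]→L[ℝ] ℝ} (hb : ContDiff ℝ ∞ b) (hb0 : ∀ y ∉ cube c r, b y = 0)
    (hd : ∀ y, extDeriv b y = zeroRep x α.1 y) :
    ∃ β ∈ formsIn n M V k, extDL k β = α := by
  have hm := h.ofChart_mem hb hb0
  refine ⟨⟨_, hm⟩, fun p hp => h.ofChart_eq_zero hb0 hp, Subtype.ext (DForm.ext_val fun p => ?_)⟩
  change (extD (ofChart x b)).val p = _
  by_cases hp : p ∈ V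
  · have hps := h.subset_source hp
    have hpt := (extChartAt (𝓡 n) x).map_source hps
    rw [val_eq_locRep _ hps, val_eq_locRep _ hps, locRep_extD hm hpt,
      extDeriv_congr_target hpt fun z hz => locRep_ofChart_self b hz, hd, zeroRep_eq _ hpt]
  · rw [hα p hp, extD_eq_zero_off hm h.isCompact.isClosed
      (fun p hp => h.ofChart_eq_zero hb0 hp) p hp]

end Cubes

/-! ### The Poincaré lemma with supports in a chart cube -/

section Poincare

open MeasureTheory

theorem isPreconnected_cube {n : ℕ} (c : EuclideanSpace ℝ (Fin n)) (r : ℝ) :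
    IsPreconnected (cube c r) := by
  refine Convex.isPreconnected ?_
  have h1 : cube c r = ⋂ j, {y : EuclideanSpace ℝ (Fin n) | |y j - c j| ≤ r} := by ext; simp [cube]
  rw [h1]
  refine convex_iInter fun j => ?_
  have h2 : {y : EuclideanSpace ℝ (Fin n) | |y j - c j| ≤ r} =
      (EuclideanSpace.proj (𝕜 := ℝ) j : EuclideanSpace ℝ (Fin n) →L[ℝ] ℝ) ⁻¹'
        Metric.closedBall (c j) r := by
    ext y
    simp [Real.dist_eq]
  rw [h2]
  exact (convex_closedBall (c j) r).linear_preimage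
    (EuclideanSpace.proj (𝕜 := ℝ) j : EuclideanSpace ℝ (Fin n) →L[ℝ] ℝ).toLinearMap

/-- The sign of a continuous function without zeros is constant on a connected set. -/
theorem sign_eq_of_isPreconnected {X : Type*} [TopologicalSpace X] {s : Set X}
    (hs : IsPreconnected s) {f : X → ℝ} (hf : ContinuousOn f s) (h0 : ∀ x ∈ s, f x ≠ 0) {x y : X}
    (hx : x ∈ s) (hy : y ∈ s) : Real.sign (f x) = Real.sign (f y) := by
  have key : ∀ x ∈ s, ∀ y ∈ s, f x < 0 → ¬ 0 < f y := fun x hx y hy h1 h2 => by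
    obtain ⟨z, hz, hz0⟩ := hs.intermediate_value hx hy hf ⟨h1.le, h2.le⟩
    exact h0 z hz hz0
  rcases lt_or_gt_of_ne (h0 x hx) with h1 | h1 <;> rcases lt_or_gt_of_ne (h0 y hy) with h2 | h2
  · rw [Real.sign_of_neg h1, Real.sign_of_neg h2]
  · exact absurd h2 (key x hx y hy h1)
  · exact absurd h1 (key y hy x hx h2)
  · rw [Real.sign_of_pos h1, Real.sign_of_pos h2]

variable {d : ℕ} {M : Type*} [TopologicalSpace M] [T2Space M]

/-- The compactly supported Poincaré lemma in top degree. -/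
theorem IsChartCube.exists_extD_eq_of_integral [CompactSpace M]
    [ChartedSpace (EuclideanSpace ℝ (Fin (d + 1))) M]
    [IsManifold (𝓡 (d + 1)) ∞ M] {x : M} {c : EuclideanSpace ℝ (Fin (d + 1))} {r : ℝ} {V : Set M}
    (h : IsChartCube x c r V) {o : DForm (d + 1) M (d + 1)} (ho : IsVolume o)
    {η : smoothForms (d + 1) M (d + 1)} (hη : η ∈ formsIn (d + 1) M V (d + 1))
    (h0 : intL ho η = 0) : ∃ β ∈ formsIn (d + 1) M V d, extDL d β = η := by
  have hz := h.zeroRep_eq_zero hη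
  have hint : ∫ y, zeroRep x η.1 y (fun i => stdVec i) = 0 := by
    rw [intL_apply, integralForm_eq_setIntegral ho η.2 h.isCompact h.subset_source hη] at h0
    have hcc : c ∈ cube c r := fun j => by simpa using h.pos.le
    have h1 : ∀ y ∈ (extChartAt (𝓡 (d + 1)) x).target,
        Real.sign (chartCoeff o x y) * chartCoeff η.1 x y =
          Real.sign (chartCoeff o x c) * zeroRep x η.1 y (fun i => stdVec i) := by
      intro y hy
      have h2 : chartCoeff η.1 x y = zeroRep x η.1 y (fun i => stdVec i) := by
        rw [zeroRep_eq _ hy]; rfl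
      rw [h2]
      by_cases hyc : y ∈ cube c r
      · rw [sign_eq_of_isPreconnected (isPreconnected_cube c r)
          ((contDiffOn_chartCoeff ho.1 x).continuousOn.mono h.subset)
          (fun z hz => ho.chartCoeff_ne_zero (h.subset hz)) hyc hcc]
      · rw [hz y hyc]; simp
    rw [setIntegral_congr_fun (isOpen_extChartAt_target x).measurableSet h1, integral_const_mul,
      setIntegral_eq_integral_of_forall_compl_eq_zero fun y hy => by
        rw [hz y fun hc => hy (h.subset hc)]; rfl] at h0
    refine (mul_eq_zero.1 h0).resolve_left fun hs => ?_
    exact ho.chartCoeff_ne_zero (h.subset hcc) (Real.sign_eq_zero_iff.1 hs)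
  obtain ⟨b, hb, hb0, hd⟩ := exists_extDeriv_eq_of_integral_eq_zero h.pos (h.contDiff_zeroRep hη)
    hz hint
  exact h.exists_extD_eq hη hb hb0 hd

/-- The compactly supported Poincaré lemma in codimension one. -/
theorem IsChartCube.exists_extD_eq_of_closed [ChartedSpace (EuclideanSpace ℝ (Fin (d + 1 + 1))) M]
    [IsManifold (𝓡 (d + 1 + 1)) ∞ M] {x : M} {c : EuclideanSpace ℝ (Fin (d + 1 + 1))} {r : ℝ}
    {V : Set M} (h : IsChartCube x c r V) {α : smoothForms (d + 1 + 1) M (d + 1)}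
    (hα : α ∈ formsIn (d + 1 + 1) M V (d + 1)) (h0 : extDL (d + 1) α = 0) :
    ∃ β ∈ formsIn (d + 1 + 1) M V d, extDL d β = α := by
  have hz := h.zeroRep_eq_zero hα
  obtain ⟨b, hb, hb0, hd⟩ := exists_extDeriv_eq_of_closed h.pos (h.contDiff_zeroRep hα) hz
    fun y => by
      by_cases hy : y ∈ (extChartAt (𝓡 (d + 1 + 1)) x).target
      · have h1 : extD α.1 = 0 := congrArg Subtype.val h0
        rw [extDeriv_congr_target hy fun z hz => zeroRep_eq _ hz, ← locRep_extD α.2 hy, h1]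
        rfl
      · have h1 : zeroRep x α.1 =ᶠ[𝓝 y] fun _ => 0 := Filter.eventually_of_mem
          ((isClosed_cube c r).isOpen_compl.mem_nhds fun hc => hy (h.subset hc)) hz
        rw [h1.extDeriv_eq, extDeriv_const]
  exact h.exists_extD_eq hα hb hb0 hd

end Poincare

/-! ### Localization of forms and integrals -/

section Local

variable {n : ℕ} {M : Type*} [TopologicalSpace M] [ChartedSpace (EuclideanSpace ℝ (Fin n)) M]
  [IsManifold (𝓡 n) ∞ M]

local notation "𝔼" => EuclideanSpace ℝ (Fin n)

/-- The exterior product of a 1-form with a form, on smooth forms. -/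
def wedgeL (k : ℕ) : smoothForms n M 1 →ₗ[ℝ] smoothForms n M k →ₗ[ℝ] smoothForms n M (k + 1) :=
  LinearMap.mk₂ ℝ (fun θ α => ⟨wedgeForm (Nat.add_comm 1 k) θ.1 α.1, wedgeForm_mem _ θ.2 α.2⟩)
    (fun θ θ' _ => Subtype.ext (DForm.ext_val fun p => wedge_add_left _ (θ.1.val p) (θ'.1.val p) _))
    (fun c θ _ => Subtype.ext (DForm.ext_val fun p => wedge_smul_left _ c (θ.1.val p) _))
    (fun _ α α' => Subtype.ext (DForm.ext_val fun p =>
      wedge_add_right _ _ (α.1.val p) (α'.1.val p)))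
    (fun c _ α => Subtype.ext (DForm.ext_val fun p => wedge_smul_right _ c _ (α.1.val p)))

theorem wedgeL_funMulL {k : ℕ} {f : M → ℝ} (hf : ContMDiff (𝓡 n) 𝓘(ℝ, ℝ) ∞ f)
    (θ : smoothForms n M 1) (α : smoothForms n M k) :
    wedgeL k (funMulL hf 1 θ) α = wedgeL k θ (funMulL hf k α) :=
  Subtype.ext (DForm.ext_val fun p => (wedge_smul_left _ (f p) (θ.1.val p) _).trans
    (wedge_smul_right _ (f p) _ (α.1.val p)).symm)

theorem funMulL_mem_formsIn {k : ℕ} {f : M → ℝ} (hf : ContMDiff (𝓡 n) 𝓘(ℝ, ℝ) ∞ f) {V : Set M}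
    (hV : tsupport f ⊆ V) (α : smoothForms n M k) : funMulL hf k α ∈ formsIn n M V k :=
  fun _ hp => funMul_eq_zero_of_notMem α.1 fun h => hp (hV h)

theorem funMulL_mem_formsIn_right {k : ℕ} {f : M → ℝ} (hf : ContMDiff (𝓡 n) 𝓘(ℝ, ℝ) ∞ f) {V : Set M}
    {α : smoothForms n M k} (hα : α ∈ formsIn n M V k) : funMulL hf k α ∈ formsIn n M V k :=
  fun p hp => by
    change f p • α.1.val p = 0
    rw [hα p hp, smul_zero]

theorem extDL_mem_formsIn {k : ℕ} {V : Set M} (hV : IsClosed V) {α : smoothForms n M k}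
    (hα : α ∈ formsIn n M V k) : extDL k α ∈ formsIn n M V (k + 1) :=
  extD_eq_zero_off α.2 hV hα

/-- The differential only depends on the function locally, up to a constant. -/
theorem dFun_congr {f g : M → ℝ} {p : M} {c : ℝ} (h : ∀ᶠ q in 𝓝 p, f q = g q + c) :
    (dFun f : DForm n M 1).val p = (dFun g).val p := by
  have h1 : (fun y => f ((extChartAt (𝓡 n) p).symm y)) =ᶠ[𝓝 (extChartAt (𝓡 n) p p)]
      fun y => g ((extChartAt (𝓡 n) p).symm y) + c := by
    have h0 := (continuousAt_extChartAt_symm (I := 𝓡 n) p).tendsto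
    rw [extChartAt_to_inv] at h0
    exact h0.eventually h
  have h2 : fderiv ℝ (fun y => f ((extChartAt (𝓡 n) p).symm y)) (extChartAt (𝓡 n) p p) =
      fderiv ℝ (fun y => g ((extChartAt (𝓡 n) p).symm y)) (extChartAt (𝓡 n) p p) := by
    rw [h1.fderiv_eq, fderiv_add_const]
  change covecForm _ = covecForm _
  rw [h2]

variable [T2Space M]

theorem exists_bump {p : M} {V : Set M} (hV : V ∈ 𝓝 p) : ∃ f : M → ℝ,
    ContMDiff (𝓡 n) 𝓘(ℝ, ℝ) ∞ f ∧ (∀ q, 0 ≤ f q) ∧ (∀ᶠ q in 𝓝 p, f q = 1) ∧ tsupport f ⊆ V := by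
  obtain ⟨f, -, hf⟩ := (SmoothBumpFunction.nhds_basis_tsupport (I := 𝓡 n) p).mem_iff.1 hV
  exact ⟨f, f.contMDiff, fun _ => f.nonneg, f.eventuallyEq_one, hf⟩

variable [CompactSpace M]

/-- If the integrals of `f η` vanish for all `η` supported in `V`, then `f` vanishes inside `V`. -/
theorem eq_zero_of_forall_integral_eq_zero {o : DForm n M n} (ho : IsVolume o) {f : M → ℝ}
    (hf : ContMDiff (𝓡 n) 𝓘(ℝ, ℝ) ∞ f) {V : Set M}
    (h : ∀ η ∈ formsIn n M V n, intL ho (funMulL hf n η) = 0) {p : M} (hp : V ∈ 𝓝 p) : f p = 0 := by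
  obtain ⟨χ, hχ, hχ0, hχ1, hχV⟩ := exists_bump (n := n) hp
  have h1 := h (funMulL hχ n (funMulL hf n ⟨o, ho.1⟩)) (funMulL_mem_formsIn hχ hχV _)
  have h2 : ratio o (funMul f (funMul χ (funMul f o))) = fun q => χ q * f q ^ 2 := by
    rw [ratio_funMul, ratio_funMul, ratio_funMul, ratio_self ho]
    funext q
    ring
  have h3 : volInt o (fun q => χ q * f q ^ 2) = 0 := by
    rw [← h2, ← integralForm_eq_volInt ho]
    exact h1
  have h4 : χ p * f p ^ 2 = 0 := eq_zero_of_volInt_eq_zero ho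
    (hχ.continuous.mul (hf.continuous.pow 2)) (fun q => mul_nonneg (hχ0 q) (sq_nonneg _)) h3 p
  rw [hχ1.self_of_nhds, one_mul] at h4
  exact pow_eq_zero_iff (two_ne_zero) |>.1 h4

theorem exists_intL_ne_zero {o : DForm n M n} (ho : IsVolume o) {p : M} {V : Set M} (hV : V ∈ 𝓝 p) :
    ∃ η ∈ formsIn n M V n, intL ho η ≠ 0 := by
  by_contra! h
  have hone : ContMDiff (𝓡 n) 𝓘(ℝ, ℝ) ∞ fun _ : M => (1 : ℝ) := contMDiff_const
  refine one_ne_zero (eq_zero_of_forall_integral_eq_zero ho hone (V := V) (fun η hη => ?_) hV)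
  exact h _ (funMulL_mem_formsIn_right hone hη)

end Local

/-! ### Poincaré duality in codimension one -/

section Functionals

variable {d : ℕ} {M : Type*} [TopologicalSpace M] [T2Space M]

/-- On top forms supported in a cube, the functionals that vanish on the derivatives of forms
supported there are the multiples of the integral. -/
theorem IsChartCube.exists_eq_const_mul [CompactSpace M]
    [ChartedSpace (EuclideanSpace ℝ (Fin (d + 1))) M] [IsManifold (𝓡 (d + 1)) ∞ M]
    {x : M} {c : EuclideanSpace ℝ (Fin (d + 1))} {r : ℝ} {V : Set M} (h : IsChartCube x c r V)
    {p : M} (hp : V ∈ 𝓝 p) {o : DForm (d + 1) M (d + 1)} (ho : IsVolume o)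
    {D : smoothForms (d + 1) M (d + 1) →ₗ[ℝ] ℝ}
    (hD : ∀ β ∈ formsIn (d + 1) M V d, D (extDL d β) = 0) :
    ∃ C : ℝ, ∀ η ∈ formsIn (d + 1) M V (d + 1), D η = C * intL ho η := by
  obtain ⟨η₀, hη₀, hne⟩ := exists_intL_ne_zero ho hp
  refine ⟨D η₀ / intL ho η₀, fun η hη => ?_⟩
  obtain ⟨β, hβ, hd⟩ := h.exists_extD_eq_of_integral ho
    (sub_mem hη (Submodule.smul_mem _ (intL ho η / intL ho η₀) hη₀)) (by
      rw [map_sub, map_smul, smul_eq_mul, div_mul_cancel₀ _ hne, sub_self])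
  have h1 := hD β hβ
  rw [hd, map_sub, map_smul, smul_eq_mul, sub_eq_zero] at h1
  rw [h1]
  ring

variable [ChartedSpace (EuclideanSpace ℝ (Fin (d + 1 + 1))) M]
    [IsManifold (𝓡 (d + 1 + 1)) ∞ M]

/-- A functional that vanishes on exact forms factors, on forms supported in a cube, through the
exterior derivative. -/
theorem IsChartCube.exists_comp_extDL {x : M} {c : EuclideanSpace ℝ (Fin (d + 1 + 1))} {r : ℝ}
    {V : Set M} (h : IsChartCube x c r V) {L : smoothForms (d + 1 + 1) M (d + 1) →ₗ[ℝ] ℝ}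
    (hL : ∀ γ, L (extDL d γ) = 0) : ∃ T : smoothForms (d + 1 + 1) M (d + 1 + 1) →ₗ[ℝ] ℝ,
      ∀ β ∈ formsIn (d + 1 + 1) M V (d + 1), T (extDL (d + 1) β) = L β := by
  have h1 : L ∘ₗ (formsIn (d + 1 + 1) M V (d + 1)).subtype ∈ LinearMap.range
      (extDL (d + 1) ∘ₗ (formsIn (d + 1 + 1) M V (d + 1)).subtype).dualMap := by
    rw [LinearMap.range_dualMap_eq_dualAnnihilator_ker, Submodule.mem_dualAnnihilator]
    intro β hβ
    obtain ⟨γ, -, hγ⟩ := h.exists_extD_eq_of_closed β.2 hβ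
    change L β.1 = 0
    rw [← hγ, hL]
  obtain ⟨T, hT⟩ := h1
  exact ⟨T, fun β hβ => LinearMap.congr_fun hT ⟨β, hβ⟩⟩

variable [CompactSpace M]

theorem exists_partition {n : ℕ} {M : Type*} [TopologicalSpace M] [T2Space M] [CompactSpace M]
    [ChartedSpace (EuclideanSpace ℝ (Fin n)) M] [IsManifold (𝓡 n) ∞ M]
    {K : M → Set M} (hK : ∀ p, K p ∈ 𝓝 p) :
    ∃ ρ : SmoothPartitionOfUnity M (𝓡 n) M univ, ∀ i, tsupport (ρ i) ⊆ interior (K i) :=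
  SmoothPartitionOfUnity.exists_isSubordinate (𝓡 n) isClosed_univ (fun i => interior (K i))
    (fun _ => isOpen_interior) fun p _ => mem_iUnion.2 ⟨p, mem_interior_iff_mem_nhds.2 (hK p)⟩

/-- A functional on forms of codimension one that vanishes on exact forms is the sum of a functional
of the exterior derivative and of the exterior product with a closed 1-form. -/
theorem exists_eq_add_integral_wedge {o : DForm (d + 1 + 1) M (d + 1 + 1)} (ho : IsVolume o)
    {L : smoothForms (d + 1 + 1) M (d + 1) →ₗ[ℝ] ℝ} (hL : ∀ γ, L (extDL d γ) = 0) :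
    ∃ (G : smoothForms (d + 1 + 1) M (d + 1 + 1) →ₗ[ℝ] ℝ) (θ : smoothForms (d + 1 + 1) M 1),
      extD θ.1 = 0 ∧ ∀ α, L α = G (extDL (d + 1) α) + intL ho (wedgeL (d + 1) θ α) := by
  classical
  choose K _ hK r hKc using fun p : M =>
    exists_isChartCube (n := d + 1 + 1) p (U := univ) Filter.univ_mem
  -- `T p (dβ) = L β` for `β` supported in `K p`; these functionals are glued to `G`
  choose T hT using fun p => (hKc p).exists_comp_extDL hL
  obtain ⟨ρ, hρ⟩ := exists_partition (n := d + 1 + 1) hK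
  set G : smoothForms (d + 1 + 1) M (d + 1 + 1) →ₗ[ℝ] ℝ :=
    ∑ i ∈ ρ.index, T i ∘ₗ funMulL (ρ i).contMDiff (d + 1 + 1) with hG
  -- a cube around each point that lies in the cubes of the partition functions living near it
  have hU : ∀ p : M, K p ∩ (⋂ i ∈ ρ.index, if p ∈ tsupport (ρ i) then interior (K i) else
      (tsupport (ρ i))ᶜ) ∈ 𝓝 p := fun p => by
    refine Filter.inter_mem (hK p) ((Filter.biInter_finset_mem _).2 fun i _ => ?_)
    split_ifs with hpi
    · exact isOpen_interior.mem_nhds (hρ i hpi)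
    · exact (isClosed_tsupport _).isOpen_compl.mem_nhds hpi
  choose W hWU hW r' hWc using fun p => exists_isChartCube (n := d + 1 + 1) p (hU p)
  have hWK : ∀ p, W p ⊆ K p := fun p => (hWU p).trans inter_subset_left
  have hWi : ∀ p, ∀ i ∈ ρ.index, W p ⊆ K i ∨ ∀ q ∈ W p, ρ i q = 0 := by
    intro p i hi
    have h1 := (hWU p).trans (inter_subset_right.trans (biInter_subset_of_mem hi))
    split_ifs at h1 with hpi
    · exact Or.inl (h1.trans interior_subset)
    · exact Or.inr fun q hq => image_eq_zero_of_notMem_tsupport (h1 hq)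
  -- on `W p`, the functionals `T i` and `T p` agree on exact forms, hence differ by a multiple of
  -- the integral
  have hc : ∀ p i, ∃ C : ℝ, i ∈ ρ.index → ∀ η ∈ formsIn (d + 1 + 1) M (W p) (d + 1 + 1),
      T i (funMulL (ρ i).contMDiff (d + 1 + 1) η) =
        T p (funMulL (ρ i).contMDiff (d + 1 + 1) η) +
          C * intL ho (funMulL (ρ i).contMDiff (d + 1 + 1) η) := by
    intro p i
    by_cases hi : i ∈ ρ.index
    · rcases hWi p i hi with h1 | h1
      · obtain ⟨C, hC⟩ := (hWc p).exists_eq_const_mul (hW p) ho (D := T i - T p) fun β hβ => by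
          rw [LinearMap.sub_apply, hT i β (formsIn_mono h1 _ hβ),
            hT p β (formsIn_mono (hWK p) _ hβ), sub_self]
        refine ⟨C, fun _ η hη => ?_⟩
        rw [← hC _ (funMulL_mem_formsIn_right _ hη), LinearMap.sub_apply]
        ring
      · refine ⟨0, fun _ η hη => ?_⟩
        have h2 : funMulL (ρ i).contMDiff (d + 1 + 1) η = 0 :=
          Subtype.ext (DForm.ext_val fun q => by
            change ρ i q • η.1.val q = 0
            by_cases hq : q ∈ W p
            · rw [h1 q hq, zero_smul]
            · rw [hη q hq, smul_zero])
        rw [h2, map_zero, map_zero, map_zero, mul_zero, add_zero]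
    · exact ⟨0, fun h => absurd h hi⟩
  choose C hC using hc
  -- so that `G = T p + ∫ f p` on forms supported in `W p`
  set f : M → M → ℝ := fun p q => ∑ i ∈ ρ.index, C p i * ρ i q with hf
  have hfs : ∀ p, ContMDiff (𝓡 (d + 1 + 1)) 𝓘(ℝ, ℝ) ∞ (f p) := fun p =>
    contMDiff_finsetSum fun i _ => contMDiff_const.mul (ρ i).contMDiff
  have hGf : ∀ p, ∀ η ∈ formsIn (d + 1 + 1) M (W p) (d + 1 + 1),
      G η = T p η + intL ho (funMulL (hfs p) (d + 1 + 1) η) := by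
    intro p η hη
    have h1 : funMulL (hfs p) (d + 1 + 1) η =
        ∑ i ∈ ρ.index, C p i • funMulL (ρ i).contMDiff (d + 1 + 1) η := by
      refine Subtype.ext (DForm.ext_val fun q => ?_)
      rw [val_sum]
      change (∑ i ∈ ρ.index, C p i * ρ i q) • η.1.val q =
        ∑ i ∈ ρ.index, C p i • (ρ i q • η.1.val q)
      rw [Finset.sum_smul]
      exact Finset.sum_congr rfl fun i _ => mul_smul _ _ _
    have h2 : T p η = ∑ i ∈ ρ.index, T p (funMulL (ρ i).contMDiff (d + 1 + 1) η) := by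
      rw [← map_sum, sum_funMulL]
    rw [h1, map_sum, h2, ← Finset.sum_add_distrib, hG, LinearMap.sum_apply]
    refine Finset.sum_congr rfl fun i hi => ?_
    rw [map_smul, smul_eq_mul, LinearMap.comp_apply, hC p i hi η hη]
  -- `T p` and `T p'` differ by a multiple of the integral near `q`, so `f p` and `f p'` by a
  -- constant
  have hdf : ∀ p p' q, q ∈ interior (W p) → q ∈ interior (W p') →
      (dFun (f p) : DForm (d + 1 + 1) M 1).val q = (dFun (f p')).val q := by
    intro p p' q hq hq'
    obtain ⟨V, hVU, hV, r'', hVc⟩ := exists_isChartCube (n := d + 1 + 1) q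
      (Filter.inter_mem (mem_interior_iff_mem_nhds.1 hq) (mem_interior_iff_mem_nhds.1 hq'))
    have hVp := hVU.trans inter_subset_left
    have hVp' := hVU.trans inter_subset_right
    obtain ⟨b, hb⟩ := hVc.exists_eq_const_mul hV ho (D := T p' - T p) fun β hβ => by
      rw [LinearMap.sub_apply, hT p' β (formsIn_mono (hVp'.trans (hWK p')) _ hβ),
        hT p β (formsIn_mono (hVp.trans (hWK p)) _ hβ), sub_self]
    have hs : ContMDiff (𝓡 (d + 1 + 1)) 𝓘(ℝ, ℝ) ∞ fun z => f p z - f p' z - b :=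
      ((hfs p).sub (hfs p')).sub contMDiff_const
    refine dFun_congr (c := b) ?_
    filter_upwards [mem_interior_iff_mem_nhds.2 hV |> isOpen_interior.mem_nhds] with z hz
    have h0 := eq_zero_of_forall_integral_eq_zero ho hs (V := V) (fun η hη => by
      have h1 : funMulL hs (d + 1 + 1) η = funMulL (hfs p) (d + 1 + 1) η -
          funMulL (hfs p') (d + 1 + 1) η - b • η :=
        Subtype.ext (DForm.ext_val fun q => by
          change (f p q - f p' q - b) • η.1.val q =
            f p q • η.1.val q - f p' q • η.1.val q - b • η.1.val q
          rw [sub_smul, sub_smul])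
      have h2 := hGf p η (formsIn_mono hVp _ hη)
      have h3 := hGf p' η (formsIn_mono hVp' _ hη)
      have h4 := hb η hη
      rw [LinearMap.sub_apply] at h4
      rw [h1, map_sub, map_sub, map_smul, smul_eq_mul]
      linarith) (mem_interior_iff_mem_nhds.1 hz)
    linarith
  obtain ⟨σ, hσ⟩ := exists_partition (n := d + 1 + 1) hW
  -- the closed 1-form that equals `d (f p)` inside `W p`
  set θ : smoothForms (d + 1 + 1) M 1 :=
    ∑ p ∈ σ.index, funMulL (σ p).contMDiff 1 ⟨dFun (f p), dFun_mem (hfs p)⟩ with hθ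
  have hθv : ∀ q z, z ∈ interior (W q) → θ.1.val z = (dFun (f q)).val z := by
    intro q z hz
    rw [hθ, val_sum]
    have h1 : ∀ p ∈ σ.index, σ p z • (dFun (f p) : DForm (d + 1 + 1) M 1).val z =
        σ p z • (dFun (f q)).val z := by
      intro p _
      by_cases hpz : z ∈ tsupport (σ p)
      · rw [hdf p q z (hσ p hpz) hz]
      · rw [image_eq_zero_of_notMem_tsupport hpz, zero_smul, zero_smul]
    refine (Finset.sum_congr rfl h1).trans ?_
    rw [← Finset.sum_smul, σ.sum_index, one_smul]
  refine ⟨G, θ, DForm.ext_val fun q => ?_, fun α => ?_⟩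
  · have hdm := dFun_mem (n := d + 1 + 1) (hfs q)
    have h1 := extD_eq_zero_of_isOpen (sub_mem θ.2 hdm) (isOpen_interior (s := W q))
      (fun z hz => by
        change θ.1.val z - (dFun (f q)).val z = 0
        rw [hθv q z hz, sub_self]) (mem_interior_iff_mem_nhds.2 (hW q))
    have h2 : extD (θ.1 - dFun (f q)) = extD θ.1 := by
      rw [sub_eq_add_neg, extD_add θ.2 (neg_mem hdm), extD_neg, extD_dFun (hfs q), neg_zero,
        add_zero]
    rwa [h2] at h1
  -- for `β` supported in `W p`, `L β = T p (dβ) = G (dβ) - ∫ f p dβ = G (dβ) + ∫ d (f p) ∧ β`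
  · have key : ∀ p ∈ σ.index, L (funMulL (σ p).contMDiff (d + 1) α) =
        G (extDL (d + 1) (funMulL (σ p).contMDiff (d + 1) α)) +
          intL ho (wedgeL (d + 1)
            (funMulL (σ p).contMDiff 1 ⟨dFun (f p), dFun_mem (hfs p)⟩) α) := by
      intro p _
      have hin : funMulL (σ p).contMDiff (d + 1) α ∈ formsIn (d + 1 + 1) M (W p) (d + 1) :=
        funMulL_mem_formsIn _ ((hσ p).trans interior_subset) α
      have h1 : intL ho (funMulL (hfs p) (d + 1 + 1)
          (extDL (d + 1) (funMulL (σ p).contMDiff (d + 1) α))) =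
          -intL ho (wedgeL (d + 1) ⟨dFun (f p), dFun_mem (hfs p)⟩
            (funMulL (σ p).contMDiff (d + 1) α)) :=
        integralForm_funMul_extD ho (hfs p) (funMulL (σ p).contMDiff (d + 1) α).2
      rw [wedgeL_funMulL, hGf p _ (extDL_mem_formsIn (hWc p).isCompact.isClosed hin),
        hT p _ (formsIn_mono (hWK p) _ hin), h1]
      ring
    have key' : ∑ p ∈ σ.index, intL ho (wedgeL (d + 1) (funMulL (σ p).contMDiff 1
        ⟨dFun (f p), dFun_mem (hfs p)⟩) α) = intL ho (wedgeL (d + 1) θ α) := by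
      rw [hθ, map_sum, LinearMap.sum_apply, map_sum]
    rw [← key', ← sum_funMulL σ α, map_sum, Finset.sum_congr rfl key, Finset.sum_add_distrib,
      map_sum, map_sum, sum_funMulL]

/-- Poincaré duality in codimension one: a form whose integrals against all closed 1-forms vanish is
exact. -/
theorem mem_exactForms_of_forall_integral_eq_zero {o : DForm (d + 1 + 1) M (d + 1 + 1)}
    (ho : IsVolume o) {α : smoothForms (d + 1 + 1) M (d + 1)}
    (h : ∀ θ : smoothForms (d + 1 + 1) M 1, extD θ.1 = 0 → intL ho (wedgeL (d + 1) θ α) = 0) :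
    α ∈ exactForms (d + 1 + 1) M d := by
  -- if `dα = h o`, the closed 1-form `dh` gives `∫ h² o = 0`
  have hclosed : extDL (d + 1) α = 0 := by
    have hs : ContMDiff (𝓡 (d + 1 + 1)) 𝓘(ℝ, ℝ) ∞ (ratio o (extD α.1)) :=
      contMDiff_ratio ho (extD_mem α.2)
    have h0 : ∀ p, ratio o (extD α.1) p = 0 := fun p =>
      mul_self_eq_zero.1 <| eq_zero_of_volInt_eq_zero ho
        (f := fun q => ratio o (extD α.1) q * ratio o (extD α.1) q)
        (hs.continuous.mul hs.continuous) (fun _ => mul_self_nonneg _) (by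
          have h1 := integralForm_funMul_extD ho hs α.2
          have h2 := h ⟨dFun _, dFun_mem hs⟩ (extD_dFun hs)
          rw [integralForm_eq_volInt ho, ratio_funMul] at h1
          rw [h1, neg_eq_zero]
          exact h2) p
    refine Subtype.ext ?_
    change extD α.1 = 0
    rw [← funMul_ratio ho (extD α.1)]
    refine DForm.ext_val fun p => ?_
    change ratio o (extD α.1) p • o.val p = 0
    rw [h0, zero_smul]
  by_contra hne
  -- a functional that separates `α` from the exact forms
  obtain ⟨L, hLα, hL⟩ := Submodule.exists_le_ker_of_notMem hne
  obtain ⟨G, θ, hθ, hLG⟩ := exists_eq_add_integral_wedge ho (L := L) fun γ =>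
    hL ⟨γ.1, γ.2, rfl⟩
  refine hLα ?_
  rw [hLG, hclosed, map_zero, h θ hθ, add_zero]

end Functionals

/-! ### Differentiation under the integral -/

section TimeDerivative

open MeasureTheory

variable {n : ℕ} {M : Type*} [TopologicalSpace M] [ChartedSpace (EuclideanSpace ℝ (Fin n)) M]
  [IsManifold (𝓡 n) ∞ M]

local notation "𝔼" => EuclideanSpace ℝ (Fin n)

theorem IsTimeDeriv.eq_timeDerivForm {l : ℕ} {J : Set ℝ} {α α' : ℝ → smoothForms n M l}
    (h : IsTimeDeriv J α α') (hJ : IsOpen J) (hα : SmoothFormPath J α) {t : ℝ} (ht : t ∈ J) :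
    (α' t).1 = timeDerivForm J α t :=
  DForm.ext_val fun p => ContinuousAlternatingMap.ext fun u =>
    (h t ht p u).unique (isTimeDeriv_timeDerivForm hJ hα t ht p u)

theorem SmoothFormPath.wedgeL {k : ℕ} {J : Set ℝ} {α : ℝ → smoothForms n M k}
    (hα : SmoothFormPath J α) (θ : smoothForms n M 1) :
    SmoothFormPath J fun t => _root_.wedgeL k θ (α t) := fun x => by
  have h1 : ContDiffOn ℝ ∞ (fun p : ℝ × 𝔼 => locRep x θ.1 p.2)
      (J ×ˢ (extChartAt (𝓡 n) x).target) :=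
    ContDiffOn.comp (θ.2 x) contDiffOn_snd fun p hp => hp.2
  exact (ContDiffOn.wedge (Nat.add_comm 1 k) h1 (hα x)).congr fun p _ =>
    locRep_wedgeForm _ _ _ x p.2

theorem IsTimeDeriv.wedgeL {k : ℕ} {J : Set ℝ} {α α' : ℝ → smoothForms n M k}
    (h : IsTimeDeriv J α α') (θ : smoothForms n M 1) :
    IsTimeDeriv J (fun t => _root_.wedgeL k θ (α t)) fun t => _root_.wedgeL k θ (α' t) := by
  intro t ht p u
  have h1 : ∀ a : DForm n M k, wedgeForm (Nat.add_comm 1 k) θ.1 a p u =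
      (Nat.factorial 1 * k.factorial : ℝ)⁻¹ * ∑ σ : Equiv.Perm (Fin (k + 1)),
        ((Equiv.Perm.sign σ : ℤ) : ℝ) *
        (θ.1 p (fun i => u (σ (Fin.cast (Nat.add_comm 1 k) (Fin.castAdd k i)))) *
          a p (fun i => u (σ (Fin.cast (Nat.add_comm 1 k) (Fin.natAdd 1 i))))) := fun a =>
    wedge_apply _ _ _ _
  change HasDerivAt (fun s => wedgeForm (Nat.add_comm 1 k) θ.1 (α s).1 p u)
    (wedgeForm (Nat.add_comm 1 k) θ.1 (α' t).1 p u) t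
  simp only [h1]
  exact (HasDerivAt.fun_sum fun σ _ => ((h t ht p _).const_mul _).const_mul _).const_mul _

variable [T2Space M] [CompactSpace M]

/-- Differentiation under the integral sign. -/
theorem SmoothFormPath.hasDerivAt_integralForm {o : DForm n M n} (ho : IsVolume o) {J : Set ℝ}
    (hJ : IsOpen J) {η η' : ℝ → smoothForms n M n} (hη : SmoothFormPath J η)
    (hη' : IsTimeDeriv J η η') {t : ℝ} (ht : t ∈ J) :
    HasDerivAt (fun s => integralForm o (η s).1) (integralForm o (η' t).1) t := by
  -- in each chart, the partition function times the orientation sign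
  set w : M → 𝔼 → ℝ := fun i y => chartPartition n M i ((extChartAt (𝓡 n) i).symm y) *
    (|chartCoeff o i y| / chartCoeff o i y) with hw
  have hsum : ∀ a : DForm n M n, integralForm o a = ∑ i ∈ (chartPartition n M).index,
      ∫ y in extChartAt (𝓡 n) i '' tsupport (chartPartition n M i), w i y * chartCoeff a i y := by
    intro a
    rw [integralForm_eq_volInt ho, volInt]
    refine Finset.sum_congr rfl fun i _ => ?_
    have hK := isCompact_tsupport_partition (chartPartition n M) i
    have hKs := tsupport_chartPartition (n := n) i
    rw [chartInt_eq_integral_image o hKs fun p hp => by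
      rw [image_eq_zero_of_notMem_tsupport hp, zero_mul]]
    refine setIntegral_congr_fun (isCompact_image_chart hK hKs).measurableSet fun y hy => ?_
    have hne := ho.chartCoeff_ne_zero (image_chart_subset hKs hy)
    simp only [hw]
    rw [chartCoeff_ratio ho a]
    field_simp
  simp only [hsum]
  refine HasDerivAt.fun_sum fun i _ => ?_
  have hK := isCompact_tsupport_partition (chartPartition n M) i
  have hKs := tsupport_chartPartition (n := n) i
  have hKt := image_chart_subset hKs
  have hwc : ContinuousOn (w i) (extChartAt (𝓡 n) i).target :=
    ((continuous_partition _ i).comp_continuousOn (continuousOn_extChartAt_symm i)).mul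
      ((ho.continuousOn_abs i).div (contDiffOn_chartCoeff ho.1 i).continuousOn
        fun y hy => ho.chartCoeff_ne_zero hy)
  have hder : ∀ s ∈ J, ∀ y ∈ (extChartAt (𝓡 n) i).target, chartCoeff (η' s).1 i y =
      fderiv ℝ (fun p : ℝ × 𝔼 => locRep i (η p.1).1 p.2) (s, y) (1, 0) fun j => stdVec j := by
    intro s hs y hy
    rw [hη'.eq_timeDerivForm hJ hη hs, chartCoeff, locRep_timeDerivForm hJ hη hs hy]
  refine hasDerivAt_setIntegral_of_continuousOn (isCompact_image_chart hK hKs) (hJ.mem_nhds ht)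
    (H' := fun s y => w i y * chartCoeff (η' s).1 i y) ?_ ?_ ?_
  · exact fun s _ => (hwc.mul (contDiffOn_chartCoeff (η s).2 i).continuousOn).mono hKt
  · have h1 : ContinuousOn (fun q : ℝ × 𝔼 => w i q.2 *
        fderiv ℝ (fun p : ℝ × 𝔼 => locRep i (η p.1).1 p.2) q (1, 0) fun j => stdVec j)
        (J ×ˢ (extChartAt (𝓡 n) i).target) :=
      (hwc.comp continuousOn_snd fun q hq => hq.2).mul
        (contDiffOn_alternating_iff.1 (hη.contDiffOn_fderiv hJ i) _).continuousOn
    refine (h1.mono (prod_mono_right hKt)).congr fun q hq => ?_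
    simp only [Function.uncurry]
    rw [hder q.1 hq.1 q.2 (hKt hq.2)]
  · intro s hs y hy
    have h1 := (ContinuousAlternatingMap.apply ℝ 𝔼 ℝ fun j => stdVec j).hasFDerivAt.comp_hasDerivAt
      s (hη.hasDerivAt_locRep hJ hs (hKt hy))
    rw [hder s hs y (hKt hy)]
    exact HasDerivAt.const_mul (w i y) h1

end TimeDerivative

/-! ### Contraction of the symplectic form and the adjoint action -/

section Contraction

variable {n : ℕ} {M : Type*} [TopologicalSpace M] [ChartedSpace (EuclideanSpace ℝ (Fin n)) M]
  [IsManifold (𝓡 n) ∞ M]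

local notation "𝔼" => EuclideanSpace ℝ (Fin n)

/-- The value of a smooth 1-form on a smooth field is a smooth function. -/
theorem contMDiff_apply_field {θ : DForm n M 1} (hθ : θ ∈ smoothForms n M 1) (v : SmoothField n M) :
    ContMDiff (𝓡 n) 𝓘(ℝ, ℝ) ∞ fun p => θ.val p ![fieldVal v p] :=
  contMDiff_of_contDiffOn_symm fun x => by
    have h := (hθ x).alternating_apply (v := ![locField x v]) fun i => by
      fin_cases i
      exact contDiffOn_locField v x
    refine h.congr fun y hy => ?_
    rw [← chartInv_locField (v : (x : M) → TangentSpace (𝓡 n) x) hy, locRep_eq,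
      ContinuousAlternatingMap.compContinuousLinearMap_apply]
    congr 1
    funext i
    fin_cases i
    rfl

/-- The map `v ↦ i_v ω` on symplectic fields. -/
def contractL (ω₀ : SymplecticForm n M) : symp ω₀ →ₗ[ℝ] smoothForms n M 1 where
  toFun v := ⟨interiorProd v.1 ω₀.form, interiorProd_mem v.1 ω₀.smooth⟩
  map_add' v w := Subtype.ext (DForm.ext_val fun p =>
    map_add (ω₀.form.val p).curryLeft (fieldVal v.1 p) (fieldVal w.1 p))
  map_smul' c v := Subtype.ext (DForm.ext_val fun p =>
    map_smul (ω₀.form.val p).curryLeft c (fieldVal v.1 p))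

theorem extD_contractL (ω₀ : SymplecticForm n M) (v : symp ω₀) : extD (contractL ω₀ v).1 = 0 :=
  (mem_symp_iff ω₀ v.1).1 v.2

/-- The closed 1-forms are the contractions of the symplectic form with symplectic fields. -/
theorem exists_contractL_eq (ω₀ : SymplecticForm n M) {θ : smoothForms n M 1}
    (hθ : extD θ.1 = 0) : ∃ v, contractL ω₀ v = θ := by
  obtain ⟨v, hv⟩ := ω₀.exists_interiorProd_eq θ.2
  exact ⟨⟨v, (mem_symp_iff ω₀ v).2 (by rw [hv, hθ])⟩, Subtype.ext hv⟩

/-- The adjoint action `ad_v w = - [v, w]` on symplectic fields. -/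
def adSymp (ω₀ : SymplecticForm n M) : symp ω₀ →ₗ[ℝ] symp ω₀ →ₗ[ℝ] symp ω₀ :=
  haveI hd : ∀ (v : SmoothField n M) (x : M),
      MDifferentiableAt (𝓡 n) (𝓡 n).tangent (fun y => (⟨y, v y⟩ : TangentBundle (𝓡 n) M)) x :=
    fun v x => (v.contMDiff x).mdifferentiableAt (by simp)
  LinearMap.mk₂ ℝ (fun v w => -⟨bracketField v.1 w.1, bracketField_mem_symp ω₀ v.2 w.2⟩)
    (fun v v' w => by
      rw [← neg_add]
      exact congrArg Neg.neg (Subtype.ext (ContMDiffSection.ext fun x =>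
        VectorField.mlieBracket_add_left (hd v.1 x) (hd v'.1 x))))
    (fun c v w => by
      rw [smul_neg]
      exact congrArg Neg.neg (Subtype.ext (ContMDiffSection.ext fun x =>
        VectorField.mlieBracket_const_smul_left (hd v.1 x))))
    (fun v w w' => by
      rw [← neg_add]
      exact congrArg Neg.neg (Subtype.ext (ContMDiffSection.ext fun x =>
        VectorField.mlieBracket_add_right (hd w.1 x) (hd w'.1 x))))
    (fun c v w => by
      rw [smul_neg]
      exact congrArg Neg.neg (Subtype.ext (ContMDiffSection.ext fun x =>
        VectorField.mlieBracket_const_smul_right (hd w.1 x))))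

/-- `i_{ad_v w} ω = d(ω(v, w))`. -/
theorem contractL_adSymp (ω₀ : SymplecticForm n M) (v w : symp ω₀) :
    contractL ω₀ (adSymp ω₀ v w) = ⟨dFun (formPair ω₀.form v.1 w.1),
      dFun_mem (contMDiff_formPair ω₀.smooth v.1 w.1)⟩ := by
  have h1 : contractL ω₀ ⟨bracketField v.1 w.1, bracketField_mem_symp ω₀ v.2 w.2⟩ =
      -⟨dFun (formPair ω₀.form v.1 w.1), dFun_mem (contMDiff_formPair ω₀.smooth v.1 w.1)⟩ :=
    Subtype.ext (interiorProd_bracketField ω₀ v.2 w.2)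
  change contractL ω₀ (-_) = _
  rw [map_neg, h1, neg_neg]

/-- `θ ∧ i_v η = θ(v) η` for a form `η` of top degree. -/
theorem wedgeForm_interiorProd_top {d : ℕ} {M : Type*} [TopologicalSpace M]
    [ChartedSpace (EuclideanSpace ℝ (Fin (d + 1))) M] (θ : DForm (d + 1) M 1)
    (v : (x : M) → TangentSpace (𝓡 (d + 1)) x) (η : DForm (d + 1) M (d + 1)) :
    wedgeForm (Nat.add_comm 1 d) θ (interiorProd v η) =
      funMul (fun p => θ.val p ![fieldVal v p]) η := by
  refine DForm.ext_val fun p => ?_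
  obtain ⟨T, hT⟩ : ∃ T : EuclideanSpace ℝ (Fin (d + 1)) →L[ℝ] ℝ, θ.val p = covecForm T :=
    ⟨_, ((ContinuousAlternatingMap.ofSubsingletonLIE (𝕜 := ℝ)
      (E := EuclideanSpace ℝ (Fin (d + 1))) (F := ℝ)
      (i := (0 : Fin 1))).apply_symm_apply (θ.val p)).symm⟩
  change wedge _ (θ.val p) ((η.val p).curryLeft (fieldVal v p)) =
    θ.val p ![fieldVal v p] • η.val p
  rw [hT, wedge_covecForm_left, covecWedge_curryLeft_top (by simp)]
  rfl

end Contraction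

/-! ### The symplectic volume -/

section Volume

variable {k : ℕ} {M : Type*} [TopologicalSpace M]
  [ChartedSpace (EuclideanSpace ℝ (Fin (2 * (k + 1)))) M]
  [IsManifold (𝓡 (2 * (k + 1))) ∞ M]

/-- The Gram determinant of the standard basis is positive. -/
theorem gramDet_stdVec_pos {n : ℕ} {M : Type*} [TopologicalSpace M]
    [ChartedSpace (EuclideanSpace ℝ (Fin n)) M] [IsManifold (𝓡 n) ∞ M] (g : RiemMetric n M)
    (p : M) : 0 < (Matrix.of fun i j : Fin n => metricVal g p (stdVec i) (stdVec j)).det := by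
  refine Matrix.PosDef.det_pos (Matrix.PosDef.of_dotProduct_mulVec_pos ?_ fun c hc => ?_)
  · ext i j
    simp only [Matrix.conjTranspose_apply, Matrix.of_apply, star_trivial]
    exact g.symm p _ _
  · have h1 : star c ⬝ᵥ (Matrix.of fun i j : Fin n =>
        metricVal g p (stdVec i) (stdVec j)).mulVec c =
        metricVal g p (∑ i, c i • stdVec i) (∑ j, c j • stdVec j) := by
      simp only [dotProduct, Matrix.mulVec, Matrix.of_apply, star_trivial, map_sum, map_smul,
        _root_.sum_apply, _root_.smul_apply, smul_eq_mul, Finset.mul_sum]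
      rw [Finset.sum_comm]
      exact Finset.sum_congr rfl fun i _ => Finset.sum_congr rfl fun j _ => by ring
    rw [h1]
    refine g.pos p _ fun h0 => hc (funext fun i => ?_)
    have h2 : (∑ j, c j • stdVec j : EuclideanSpace ℝ (Fin n)) i = 0 := by
      change (∑ j, c j • stdVec j : EuclideanSpace ℝ (Fin n)) = 0 at h0
      rw [h0]; rfl
    simpa [stdVec, Pi.single_apply] using h2

/-- The symplectic volume has no zeros, since it agrees in absolute value with the Riemannian
volume. -/
theorem isVolume_sympVol {ω₀ : SymplecticForm (2 * (k + 1)) M} {g : RiemMetric (2 * (k + 1)) M}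
    (hvol : VolumesAgree g ω₀) : IsVolume (sympVol ω₀) := by
  refine ⟨Submodule.smul_mem _ _ (powForm_mem ω₀.smooth (k + 1)), fun p h0 => ?_⟩
  have h1 : |(sympVol ω₀).val p fun i => stdVec i| =
      √(Matrix.of fun i j => metricVal g p (stdVec i) (stdVec j)).det := hvol p fun i => stdVec i
  rw [h0] at h1
  have h2 := Real.sqrt_pos.2 (gramDet_stdVec_pos g p)
  rw [← h1] at h2
  simp at h2

/-- The Riemannian integral of a function is its integral against the symplectic volume. -/
theorem integralVol_eq_volInt [T2Space M] [CompactSpace M] {ω₀ : SymplecticForm (2 * (k + 1)) M}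
    {g : RiemMetric (2 * (k + 1)) M} (hvol : VolumesAgree g ω₀) (f : M → ℝ) :
    integralVol g f = volInt (sympVol ω₀) f := by
  rw [← finsum_eq_volInt]
  refine finsum_congr fun i => MeasureTheory.integral_congr_ae
    (Filter.Eventually.of_forall fun y => ?_)
  have h1 : |chartCoeff (sympVol ω₀) i y| = √(gramDet g _ (coordVec i y)) :=
    hvol _ (coordVec i y)
  simp only [h1]

end Volume

/-! ### Densities of functionals -/

section Density

variable {d : ℕ} {M : Type*} [TopologicalSpace M] [ChartedSpace (EuclideanSpace ℝ (Fin (d + 1))) M]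

/-- The 1-form `θ` with `α ∧ i_v s = θ(v) o` for all vectors `v`. -/
def densityForm (o : DForm (d + 1) M (d + 1)) (s : DForm (d + 1) M 2) (α : DForm (d + 1) M d) :
    DForm (d + 1) M 1 := fun p =>
  covecForm (LinearMap.toContinuousLinearMap (𝕜 := ℝ)
    (E := EuclideanSpace ℝ (Fin (d + 1))) (F' := ℝ)
    { toFun := fun u => wedge (rfl : d + 1 = d + 1) (α.val p) ((s.val p).curryLeft u)
        (fun i => stdVec i) / o.val p fun i => stdVec i
      map_add' := fun u u' => by
        rw [map_add, wedge_add_right]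
        exact add_div _ _ _
      map_smul' := fun c u => by
        rw [map_smul, wedge_smul_right]
        exact mul_div_assoc _ _ _ })

theorem densityForm_mem [IsManifold (𝓡 (d + 1)) ∞ M] {o : DForm (d + 1) M (d + 1)}
    (ho : IsVolume o) {s : DForm (d + 1) M 2} (hs : s ∈ smoothForms (d + 1) M 2)
    {α : DForm (d + 1) M d} (hα : α ∈ smoothForms (d + 1) M d) :
    densityForm o s α ∈ smoothForms (d + 1) M 1 := by
  intro x
  refine contDiffOn_alternating_iff.2 fun u => ?_
  have h1 : ContDiffOn ℝ ∞ (fun y => wedge (rfl : d + 1 = d + 1) (locRep x α y)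
      ((locRep x s y).curryLeft (u 0)) (fun i => stdVec i) / chartCoeff o x y)
      (extChartAt (𝓡 (d + 1)) x).target :=
    (contDiffOn_alternating_iff.1 (ContDiffOn.wedge _ (hα x)
      ((hs x).curryLeft_apply contDiffOn_const)) _).div
      (contDiffOn_chartCoeff ho.1 x) fun y hy => ho.chartCoeff_ne_zero hy
  refine h1.congr fun y hy => ?_
  set p := (extChartAt (𝓡 (d + 1)) x).symm y with hp
  have h2 : locRep x (densityForm o s α) y u = wedge (rfl : d + 1 = d + 1) (α.val p)
      ((s.val p).curryLeft (chartInv x y (u 0))) (fun i => stdVec i) /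
        o.val p fun i => stdVec i := rfl
  have h3 : wedge (rfl : d + 1 = d + 1) (locRep x α y) ((locRep x s y).curryLeft (u 0)) =
      (wedge (rfl : d + 1 = d + 1) (α.val p)
        ((s.val p).curryLeft (chartInv x y (u 0)))).compContinuousLinearMap
          (chartInv x y) := by
    rw [locRep_eq, locRep_eq, locRep_eq_curryLeft_comp]
    exact (wedge_compContinuousLinearMap _ _ _ _).symm
  have h4 := ho.chartCoeff_ne_zero hy
  rw [chartCoeff_eq] at h4
  rw [h2, h3, top_comp, chartCoeff_eq]
  exact (mul_div_mul_left _ _ (left_ne_zero_of_mul h4)).symm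

end Density

/-! ### The pairing, the inertia operator and the Euler equation -/

section SymplecticPairing

variable {k : ℕ} {M : Type*} [TopologicalSpace M] [T2Space M] [CompactSpace M]
  [ChartedSpace (EuclideanSpace ℝ (Fin (2 * (k + 1)))) M]
  [IsManifold (𝓡 (2 * (k + 1))) ∞ M]

local notation "𝔼" => EuclideanSpace ℝ (Fin (2 * (k + 1)))

/-- The pairing of symplectic fields with forms of codimension one, as a bilinear map. The 1-form
`i_v ω` stands on the left, which accounts for the sign. -/
def pairL (ω₀ : SymplecticForm (2 * (k + 1)) M) (ho : IsVolume (sympVol ω₀)) :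
    symp ω₀ →ₗ[ℝ] smoothForms (2 * (k + 1)) M (2 * k + 1) →ₗ[ℝ] ℝ :=
  ((wedgeL (2 * k + 1)).compr₂ (-intL ho)) ∘ₗ contractL ω₀

variable {ω₀ : SymplecticForm (2 * (k + 1)) M} (ho : IsVolume (sympVol ω₀))

theorem pairL_apply (v : symp ω₀) (α : smoothForms (2 * (k + 1)) M (2 * k + 1)) :
    pairL ω₀ ho v α = -intL ho (wedgeL (2 * k + 1) (contractL ω₀ v) α) := rfl

/-- Moving the 1-form `i_v ω` past a form of odd degree `2 k + 1` changes the sign. -/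
theorem pairL_eq_pairing (v : symp ω₀) (α : smoothForms (2 * (k + 1)) M (2 * k + 1)) :
    pairL ω₀ ho v α = pairing ω₀ v α.1 := by
  have h1 : wedgeForm (rfl : 2 * k + 1 + 1 = 2 * k + 1 + 1) α.1 (contractL ω₀ v).1 =
      (-wedgeL (2 * k + 1) (contractL ω₀ v) α : smoothForms (2 * (k + 1)) M (2 * k + 1 + 1)).1 := by
    rw [wedgeForm_one_right, Odd.neg_one_pow ⟨k, rfl⟩, neg_one_smul]
    rfl
  rw [pairL_apply, ← map_neg]
  change integralForm (sympVol ω₀) _ =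
    integralForm (sympVol ω₀) (wedgeForm _ α.1 (contractL ω₀ v).1)
  exact congrArg (integralForm (sympVol ω₀)) h1.symm

/-- Exact forms pair to zero, by Stokes' theorem: `i_v ω ∧ dβ = - d(i_v ω ∧ β)`, as `i_v ω` is
closed. -/
theorem pairL_extDL (v : symp ω₀) (β : smoothForms (2 * (k + 1)) M (2 * k)) :
    pairL ω₀ ho v (extDL (2 * k) β) = 0 := by
  have h1 : wedgeL (2 * k + 1) (contractL ω₀ v) (extDL (2 * k) β) =
      -extDL (2 * k + 1) (wedgeL (2 * k) (contractL ω₀ v) β) := Subtype.ext (by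
    refine (neg_eq_iff_eq_neg.2 ?_).symm
    exact extD_wedgeForm_closed (contractL ω₀ v).2 (extD_contractL ω₀ v) β.2)
  have h2 : intL ho (extDL (2 * k + 1) (wedgeL (2 * k) (contractL ω₀ v) β)) = 0 :=
    integralForm_extD (d := 2 * k + 1) ho (wedgeL (2 * k) (contractL ω₀ v) β).2
  rw [pairL_apply, h1, neg_eq_zero]
  exact (map_neg (intL ho) _).trans (by rw [h2, neg_zero])

/-- The map from cosets to functionals on symplectic fields given by the pairing. -/
def cosetDual : Cosets (2 * (k + 1)) M (2 * k) →ₗ[ℝ] Module.Dual ℝ (symp ω₀) :=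
  (exactForms (2 * (k + 1)) M (2 * k)).liftQ (pairL ω₀ ho).flip (by
    rintro α ⟨β, hβ, h⟩
    refine LinearMap.ext fun v => ?_
    rw [show α = extDL (2 * k) ⟨β, hβ⟩ from Subtype.ext h]
    exact pairL_extDL ho v _)

theorem cosetDual_coset (α : smoothForms (2 * (k + 1)) M (2 * k + 1)) (v : symp ω₀) :
    cosetDual ho (coset α) v = pairL ω₀ ho v α := rfl

/-- Poincaré duality in codimension one, as every closed 1-form is some `i_v ω`. -/
theorem cosetDual_injective : Function.Injective (cosetDual ho) := by
  refine (injective_iff_map_eq_zero _).2 fun ξ hξ => ?_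
  induction ξ using Submodule.Quotient.induction_on with
  | _ α =>
    refine (Submodule.Quotient.mk_eq_zero _).2 ?_
    refine mem_exactForms_of_forall_integral_eq_zero (d := 2 * k) ho fun θ hθ => ?_
    obtain ⟨v, hv⟩ := exists_contractL_eq ω₀ hθ
    have h1 : pairL ω₀ ho v α = 0 := LinearMap.congr_fun hξ v
    rw [pairL_apply, hv, neg_eq_zero] at h1
    exact h1

/-- The integral of `θ(v)` against the symplectic volume, through the form `θ ∧ ω ^ k`. -/
theorem pairing_wedge_powForm (θ : DForm (2 * (k + 1)) M 1) (v : symp ω₀) :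
    pairing ω₀ v (wedgeForm (Nat.add_comm 1 (2 * k)) θ (powForm ω₀.form k)) =
      integralForm (sympVol ω₀) (funMul (fun p => θ.val p ![fieldVal v.1 p]) (sympVol ω₀)) := by
  refine congrArg (integralForm (sympVol ω₀)) (DForm.ext_val fun p => ?_)
  obtain ⟨T, hT⟩ : ∃ T : 𝔼 →L[ℝ] ℝ, θ.val p = covecForm T :=
    ⟨_, ((ContinuousAlternatingMap.ofSubsingletonLIE (𝕜 := ℝ) (E := 𝔼) (F := ℝ)
      (i := (0 : Fin 1))).apply_symm_apply (θ.val p)).symm⟩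
  change wedge _ (wedge _ (θ.val p) (wedgePow (ω₀.form.val p) k))
    ((ω₀.form.val p).curryLeft (fieldVal v.1 p)) = θ.val p ![fieldVal v.1 p] •
      (((k + 1 : ℕ) : ℝ)⁻¹ • wedgePow (ω₀.form.val p) (k + 1))
  rw [hT, wedge_wedgePow_curryLeft (by simp)]
  rfl

/-- The functional of `α` has the density `θ` with `α ∧ i_v ω = θ(v) μ`; conversely, the density `θ`
is realized by `α = θ ∧ ω ^ k`. -/
theorem range_cosetDual : range (cosetDual ho) = regularDual ω₀ := by
  ext l
  constructor
  · rintro ⟨ξ, rfl⟩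
    induction ξ using Submodule.Quotient.induction_on with
    | _ α =>
      refine ⟨densityForm (d := 2 * k + 1) (sympVol ω₀) ω₀.form α.1,
        densityForm_mem (d := 2 * k + 1) ho ω₀.smooth α.2, fun v => ?_⟩
      refine (pairL_eq_pairing ho v α).trans ?_
      exact congrArg (integralForm (sympVol ω₀)) (funMul_ratio ho _).symm
  · rintro ⟨θ, hθ, h⟩
    refine ⟨coset ⟨wedgeForm (Nat.add_comm 1 (2 * k)) θ (powForm ω₀.form k),
      wedgeForm_mem _ hθ (powForm_mem ω₀.smooth k)⟩, LinearMap.ext fun v => ?_⟩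
    rw [cosetDual_coset, pairL_eq_pairing, h]
    exact pairing_wedge_powForm θ v

/-- Under the pairing, the coadjoint action is the Lie derivative: `⟨ad_v w, α⟩` and `⟨w, L_v α⟩`
are both the integral of `ω(v, w) dα`. -/
theorem coad_cosetDual (v : symp ω₀) (ξ : Cosets (2 * (k + 1)) M (2 * k)) :
    coad (adSymp ω₀) v (cosetDual ho ξ) = cosetDual ho (lieCoset v.1 ξ) := by
  induction ξ using Submodule.Quotient.induction_on with
  | _ α =>
    refine LinearMap.ext fun w => ?_
    change pairL ω₀ ho (adSymp ω₀ v w) α = pairL ω₀ ho w (lieForm v.1 α)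
    have hf := contMDiff_formPair ω₀.smooth v.1 w.1
    have h1 : pairL ω₀ ho (adSymp ω₀ v w) α =
        intL ho (funMulL hf (2 * k + 1 + 1) (extDL (2 * k + 1) α)) := by
      rw [pairL_apply, contractL_adSymp]
      exact (integralForm_funMul_extD (d := 2 * k + 1) ho hf α.2).symm
    have h2 : lieForm v.1 α = extDL (2 * k) ⟨_, interiorProd_mem v.1 α.2⟩ +
        ⟨_, interiorProd_mem v.1 (extD_mem α.2)⟩ := Subtype.ext (lieD_eq_cartan v.1 α.2)
    have h3 : wedgeL (2 * k + 1) (contractL ω₀ w) ⟨_, interiorProd_mem v.1 (extD_mem α.2)⟩ =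
        -funMulL hf (2 * k + 1 + 1) (extDL (2 * k + 1) α) := by
      refine Subtype.ext ((wedgeForm_interiorProd_top (d := 2 * k + 1) (contractL ω₀ w).1
        v.1 (extD α.1)).trans (DForm.ext_val fun p => ?_))
      change ω₀.form.val p ![fieldVal w.1 p, fieldVal v.1 p] • (extD α.1).val p =
        -(ω₀.form.val p ![fieldVal v.1 p, fieldVal w.1 p] • (extD α.1).val p)
      have h5 : ![fieldVal v.1 p, fieldVal w.1 p] ∘ Equiv.swap (0 : Fin 2) 1 =
          ![fieldVal w.1 p, fieldVal v.1 p] := by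
        funext i
        fin_cases i <;> rfl
      have h4 : ω₀.form.val p (![fieldVal v.1 p, fieldVal w.1 p] ∘ Equiv.swap (0 : Fin 2) 1) =
          -ω₀.form.val p ![fieldVal v.1 p, fieldVal w.1 p] :=
        (ω₀.form.val p).toAlternatingMap.map_swap _ (by decide)
      rw [← h5, h4, neg_smul]
    rw [h1, h2, map_add, pairL_extDL, zero_add, pairL_apply, h3]
    exact (neg_eq_iff_eq_neg.2 (map_neg (intL ho) _)).symm

/-- The momentum `v^♭ ∧ ω^k`, as a linear map. -/
def momentumL (g : RiemMetric (2 * (k + 1)) M) (ω₀ : SymplecticForm (2 * (k + 1)) M) :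
    symp ω₀ →ₗ[ℝ] smoothForms (2 * (k + 1)) M (2 * k + 1) where
  toFun v := ⟨momentumForm g ω₀ v, momentumForm_mem g ω₀ v⟩
  map_add' v w := Subtype.ext (DForm.ext_val fun p => by
    have h1 : (flat g (v + w : symp ω₀).1).val p = (flat g v.1).val p + (flat g w.1).val p := by
      change covecForm (metricVal g p (fieldVal v.1 p + fieldVal w.1 p)) = _
      rw [map_add]; rfl
    change wedge (Nat.add_comm 1 (2 * k)) ((flat g (v + w : symp ω₀).1).val p)
      (wedgePow (ω₀.form.val p) k) = _
    rw [h1, wedge_add_left]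
    rfl)
  map_smul' c v := Subtype.ext (DForm.ext_val fun p => by
    have h1 : (flat g (c • v : symp ω₀).1).val p = c • (flat g v.1).val p := by
      change covecForm (metricVal g p (c • fieldVal v.1 p)) = _
      rw [map_smul]; rfl
    change wedge (Nat.add_comm 1 (2 * k)) ((flat g (c • v : symp ω₀).1).val p)
      (wedgePow (ω₀.form.val p) k) = _
    rw [h1, wedge_smul_left]
    rfl)

/-- The inertia operator `A v = [v^♭ ∧ ω ^ k]`, as a functional on symplectic fields. -/
def inertia (g : RiemMetric (2 * (k + 1)) M) : symp ω₀ →ₗ[ℝ] Module.Dual ℝ (symp ω₀) :=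
  (pairL ω₀ ho).flip ∘ₗ momentumL g ω₀

/-- The inertia operator represents the energy form: `⟨w, A v⟩ = ∫ (v, w) μ`. -/
theorem inertia_apply (g : RiemMetric (2 * (k + 1)) M) (v w : symp ω₀) :
    inertia ho g v w =
      volInt (sympVol ω₀) fun p => metricVal g p (fieldVal v.1 p) (fieldVal w.1 p) := by
  change pairL ω₀ ho w (momentumL g ω₀ v) = _
  rw [pairL_eq_pairing]
  refine (pairing_wedge_powForm (flat g v.1) w).trans ?_
  rw [integralForm_eq_volInt ho, ratio_funMul, ratio_self ho]
  refine congrArg (volInt (sympVol ω₀)) (funext fun p => ?_)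
  rw [mul_one]
  rfl

theorem eq_zero_of_inertia_self_eq_zero {g : RiemMetric (2 * (k + 1)) M} {v : symp ω₀}
    (h : inertia ho g v v = 0) : v = 0 := by
  rw [inertia_apply] at h
  have hpos : ∀ p, 0 ≤ metricVal g p (fieldVal v.1 p) (fieldVal v.1 p) := fun p => by
    by_cases h0 : fieldVal v.1 p = 0
    · rw [h0, map_zero]
    · exact (g.pos p _ h0).le
  have h1 := eq_zero_of_volInt_eq_zero ho
    (contMDiff_apply_field (flat_mem g v.1) v.1).continuous hpos h
  refine Subtype.ext (ContMDiffSection.ext fun p => ?_)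
  by_contra hne
  exact (g.pos p _ hne).ne' (h1 p)

theorem inertia_injective (g : RiemMetric (2 * (k + 1)) M) : Function.Injective (inertia ho g) :=
  (injective_iff_map_eq_zero _).2 fun v hv =>
    eq_zero_of_inertia_self_eq_zero ho (g := g) (by rw [hv]; rfl)

/-- The derivative of the functional of `α` is the functional of the time derivative of `α`. -/
theorem hasDerivAt_cosetDual {J : Set ℝ} (hJ : IsOpen J)
    {α α' : ℝ → smoothForms (2 * (k + 1)) M (2 * k + 1)} (hα : SmoothFormPath J α)
    (hα' : IsTimeDeriv J α α') {t : ℝ} (ht : t ∈ J) (w : symp ω₀) :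
    HasDerivAt (fun s => cosetDual ho (coset (α s)) w) (cosetDual ho (coset (α' t)) w) t :=
  ((hα.wedgeL (contractL ω₀ w)).hasDerivAt_integralForm ho hJ (hα'.wedgeL (contractL ω₀ w))
    ht).neg

/-- The Euler equation in terms of cosets. -/
theorem eulerEquation_iff (g : RiemMetric (2 * (k + 1)) M) {J : Set ℝ} (hJ : IsOpen J)
    {α α' : ℝ → smoothForms (2 * (k + 1)) M (2 * k + 1)} (hα : SmoothFormPath J α)
    (hα' : IsTimeDeriv J α α') {v : ℝ → symp ω₀}
    (hv : ∀ t ∈ J, inertia ho g (v t) = cosetDual ho (coset (α t))) :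
    EulerEquation (adSymp ω₀) (inertia ho g) J (fun t => cosetDual ho (coset (α t))) ↔
      ∀ t ∈ J, coset (α' t) = -lieCoset (v t).1 (coset (α t)) := by
  constructor
  · intro h t ht
    obtain ⟨u, hu, hd⟩ := h t ht
    obtain rfl : u = v t := inertia_injective ho g (hu.trans (hv t ht).symm)
    refine cosetDual_injective ho (LinearMap.ext fun w => ?_)
    rw [(hasDerivAt_cosetDual ho hJ hα hα' ht w).unique (hd w), coad_cosetDual, map_neg]
    rfl
  · intro h t ht
    refine ⟨v t, hv t ht, fun w => ?_⟩
    have h1 := hasDerivAt_cosetDual ho hJ hα hα' ht w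
    rw [h t ht, map_neg, ← coad_cosetDual] at h1
    exact h1

end SymplecticPairing


end

theorem theorem3p1 {k : ℕ} {M : Type*} [TopologicalSpace M] [T2Space M] [CompactSpace M]
    [ChartedSpace (EuclideanSpace ℝ (Fin (2 * (k + 1)))) M] [IsManifold (𝓡 (2 * (k + 1))) ∞ M]
    (ω₀ : SymplecticForm (2 * (k + 1)) M) (g : RiemMetric (2 * (k + 1)) M)
    (hvol : VolumesAgree g ω₀) :
    ∃ (Φ : Cosets (2 * (k + 1)) M (2 * k) →ₗ[ℝ] Module.Dual ℝ (symp ω₀))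
      (ad : symp ω₀ →ₗ[ℝ] symp ω₀ →ₗ[ℝ] symp ω₀)
      (Lie : symp ω₀ → smoothForms (2 * (k + 1)) M (2 * k + 1) →ₗ[ℝ]
        smoothForms (2 * (k + 1)) M (2 * k + 1))
      (LieQ : symp ω₀ → Cosets (2 * (k + 1)) M (2 * k) →ₗ[ℝ] Cosets (2 * (k + 1)) M (2 * k))
      (A : symp ω₀ →ₗ[ℝ] Module.Dual ℝ (symp ω₀)),
      -- the pairing descends to cosets, is nondegenerate, and identifies the cosets with the
      -- regular dual
      (∀ α v, Φ (coset α) v = pairing ω₀ v α.1) ∧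
      (∀ v : symp ω₀, (∀ α : smoothForms (2 * (k + 1)) M (2 * k + 1), pairing ω₀ v α.1 = 0) →
        v = 0) ∧
      Function.Injective Φ ∧
      range Φ = regularDual ω₀ ∧
      -- the Lie algebra: `ad_v w = - [v, w]`
      (∀ (v w : symp ω₀) (x : M), (ad v w).1 x =
        -VectorField.mlieBracket (𝓡 (2 * (k + 1))) v.1 w.1 x) ∧
      -- the Lie derivative on smooth forms and on cosets
      (∀ v α, (Lie v α).1 = lieD v.1 α.1) ∧
      (∀ v α, LieQ v (coset α) = coset (Lie v α)) ∧
      -- the coadjoint action is the Lie derivative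
      (∀ v ξ, coad ad v (Φ ξ) = Φ (LieQ v ξ)) ∧
      -- the inertia operator: `E(v) = ½ ⟨v, A v⟩` with `A` symmetric
      (∀ v, energy g ω₀ v = 1 / 2 * A v v) ∧
      (∀ v w, A v w = A w v) ∧
      Function.Injective A ∧
      (∀ v, ∃ α : smoothForms (2 * (k + 1)) M (2 * k + 1),
        α.1 = momentumForm g ω₀ v ∧ A v = Φ (coset α)) ∧
      -- the Euler equation
      (∀ J : Set ℝ, IsOpen J →
        (∀ v : ℝ → symp ω₀, SmoothFieldPath J (fun t => (v t).1) →
          ∃ α : ℝ → smoothForms (2 * (k + 1)) M (2 * k + 1),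
            (∀ t, (α t).1 = momentumForm g ω₀ (v t)) ∧ SmoothFormPath J α) ∧
        (∀ α : ℝ → smoothForms (2 * (k + 1)) M (2 * k + 1), SmoothFormPath J α →
          ∃ α' : ℝ → smoothForms (2 * (k + 1)) M (2 * k + 1), IsTimeDeriv J α α' ∧
            ∀ v : ℝ → symp ω₀, (∀ t ∈ J, A (v t) = Φ (coset (α t))) →
              (EulerEquation ad A J (fun t => Φ (coset (α t))) ↔
                ∀ t ∈ J, coset (α' t) = -LieQ (v t) (coset (α t))))) := by
  have ho := isVolume_sympVol hvol
  refine ⟨cosetDual ho, adSymp ω₀, fun v => lieForm v.1, fun v => lieCoset v.1, inertia ho g,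
    fun α v => pairL_eq_pairing ho v α, fun v hv => ?_, cosetDual_injective ho,
    range_cosetDual ho, fun _ _ _ => rfl, fun _ _ => rfl, fun _ _ => rfl, coad_cosetDual ho,
    fun v => ?_, fun v w => ?_, inertia_injective ho g,
    fun v => ⟨momentumL g ω₀ v, rfl, rfl⟩, fun J hJ => ⟨fun v hv => ?_, fun α hα => ?_⟩⟩
  · exact eq_zero_of_inertia_self_eq_zero ho (g := g)
      ((pairL_eq_pairing ho v (momentumL g ω₀ v)).trans (hv _))
  · rw [inertia_apply, energy, integralVol_eq_volInt hvol]
    rfl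
  · rw [inertia_apply, inertia_apply]
    exact congrArg (volInt (sympVol ω₀)) (funext fun p => g.symm p _ _)
  · exact ⟨fun t => momentumL g ω₀ (v t), fun _ => rfl, momentumForm_smoothFormPath g ω₀ hv⟩
  · exact ⟨_, isTimeDeriv_timeDerivForm hJ hα, fun v hv =>
      eulerEquation_iff ho g hJ hα (isTimeDeriv_timeDerivForm hJ hα) hv⟩
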